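/- Let $\mathfrak{gl}(1|1)$ be the complex Lie superalgebra with basis $e_{ij}$, $i,j\in\{1,2\}$, of parity $|i|+|j|$, where $|1|=\bar 0$, $|2|=\bar 1$, and let $\mathfrak{gl}(1|1)[t]=\mathfrak{gl}(1|1)\otimes\mathbb C[t]$ be its current superalgebra, with basis $e_{ij}[r]=e_{ij}\otimes t^r$, $r\ge 0$, and supercommutators $$[e_{ij}[r],e_{kl}[s]]=\delta_{jk}e_{il}[r+s]-(-1)^{(|i|+|j|)(|k|+|l|)}\delta_{il}e_{kj}[r+s].$$ Put $e_{ij}(x)=\sum_{r\ge 0}e_{ij}[r]x^{-r-1}$. The Gaudin transfer matrix is the series $$\mathscr H(x)=\sum_{r\ge 2}\mathscr H_r x^{-r}=\frac12\sum_{a,b=1}^2(-1)^{|b|}e_{ab}(x)e_{ba}(x)$$ with coefficients in $\mathrm U(\mathfrak{gl}(1|1)[t])$. For $m\ge 0$ and $b\in\mathbb C$ let $W_m(b)$ be the Weyl module: the $\mathfrak{gl}(1|1)[t]$-module generated by an even vector $w$ subject to the relations $$e_{11}(x)w=\frac{m}{x-b}\,w,\qquad e_{22}(x)w=e_{12}(x)w=0,\qquad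 (e_{21}\otimes(t-b)^m)\,w=0 .$$ For a $\mathfrak{gl}(1|1)[t]$-module $M$ let $M^{\mathrm{sing}}=\{v\in M: e_{12}[0]v=0\}$. A nonzero $v\in M$ is an eigenvector of $\mathscr H(x)$ with eigenvalue $\xi(x)=\sum_{r\ge2}\xi_rx^{-r}$, $\xi_r\in\mathbb C$, if $\mathscr H_rv=\xi_rv$ for all $r\ge2$; rational functions of $x$ are expanded as series in $x^{-1}$. Let $\boldsymbol b=(b_1,\dots,b_k)$ be a sequence of distinct complex numbers and $\boldsymbol n=(n_1,\dots,n_k)$ a sequence of nonnegative integers, not all zero. Consider the (super) tensor product $\bigotimes_{s=1}^kW_{n_s}(b_s)$, and set $$\zeta(x)=\sum_{s=1}^k\frac{n_s}{x-b_s},\qquad \psi(x)=\zeta(x)\prod_{r=1}^k(x-b_r)^{n_r}\in\mathbb C[x].$$ Then $\mathscr H(x)$ has simple spectrum in $\big(\bigotimes_{s=1}^kW_{n_s}(b_s)\big)^{\mathrm{sing}}$: two eigenvectors of $\mathscr H(x)$ in this space that are not proportional have different eigenvalues. Moreover, there is a bijection $y\mapsto v_y$ between the monic divisors $y$ of the polynomial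 $\psi$ and the eigenvectors of $\mathscr H(x)$ in $\big(\bigotimes_{s=1}^kW_{n_s}(b_s)\big)^{\mathrm{sing}}$, considered up to multiplication by a nonzero constant, such that $$\mathscr H(x)v_y=\Big(\frac12\zeta'(x)-\zeta(x)\frac{y'(x)}{y(x)}+\frac12\zeta(x)^2\Big)v_y .$$ -/

import Mathlib

open Polynomial
open scoped TensorProduct LaurentSeries LinearAlgebra.Projectivization

noncomputable section

namespace GL11

/-! Indices `1, 2` of the mathematics are `0, 1 : Fin 2`, so that the parity `|i|` of the basis
vector `v_i` of `ℂ^{1|1}` is the value of `i` itself. -/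

/-- The parity `|i| + |j|` of `e_{ij}[r]` (only its class modulo 2 matters). -/
def par (i j : Fin 2) : ℕ := i.val + j.val

/-! ### The enveloping superalgebra of the current superalgebra -/

/-- The free associative algebra on the basis `e_{ij}[r]` of `gl(1|1)[t]`. -/
abbrev Free : Type := FreeAlgebra ℂ (Fin 2 × Fin 2 × ℕ)

/-- The generator `e_{ij}[r]` of the free algebra. -/
def gen (i j : Fin 2) (r : ℕ) : Free := FreeAlgebra.ι ℂ (i, j, r)

/-- The supercommutator relations
`[e_{ij}[r], e_{kl}[s]] = δ_{jk} e_{il}[r+s] - (-1)^{(|i|+|j|)(|k|+|l|)} δ_{il} e_{kj}[r+s]`. -/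
inductive Rel : Free → Free → Prop
  | bracket (i j k l : Fin 2) (r s : ℕ) :
      Rel (gen i j r * gen k l s - (-1 : ℂ) ^ (par i j * par k l) • (gen k l s * gen i j r))
        ((if j = k then gen i l (r + s) else 0)
          - (-1 : ℂ) ^ (par i j * par k l) • (if i = l then gen k j (r + s) else 0))

/-- The universal enveloping superalgebra `U(gl(1|1)[t])`, as an associative algebra. -/
def U : Type := RingQuot Rel

instance : Ring U := inferInstanceAs (Ring (RingQuot Rel))

instance : Algebra ℂ U := inferInstanceAs (Algebra ℂ (RingQuot Rel))

/-- The projection from the free algebra onto `U(gl(1|1)[t])`. -/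
def toU : Free →ₐ[ℂ] U := RingQuot.mkAlgHom ℂ Rel

theorem toU_rel {x y : Free} (h : Rel x y) : toU x = toU y := RingQuot.mkAlgHom_rel ℂ h

/-- The universal property of the quotient. -/
def liftU {A : Type*} [Ring A] [Algebra ℂ A] (f : Free →ₐ[ℂ] A)
    (hf : ∀ x y, Rel x y → f x = f y) : U →ₐ[ℂ] A :=
  RingQuot.liftAlgHom ℂ ⟨f, fun x y h => hf x y h⟩

theorem liftU_toU {A : Type*} [Ring A] [Algebra ℂ A] (f : Free →ₐ[ℂ] A)
    (hf : ∀ x y, Rel x y → f x = f y) (x : Free) : liftU f hf (toU x) = f x :=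
  RingQuot.liftAlgHom_mkAlgHom_apply ℂ f (fun x y h => hf x y h) x

theorem U_hom_ext {A : Type*} [Ring A] [Algebra ℂ A] {f g : U →ₐ[ℂ] A}
    (h : f.comp toU = g.comp toU) : f = g :=
  RingQuot.ringQuot_ext' ℂ f g h

/-- The element `e_{ij}[r] = e_{ij} ⊗ t^r` of `U(gl(1|1)[t])`. -/
def uE (i j : Fin 2) (r : ℕ) : U := toU (gen i j r)

theorem uE_bracket (i j k l : Fin 2) (r s : ℕ) :
    uE i j r * uE k l s - (-1 : ℂ) ^ (par i j * par k l) • (uE k l s * uE i j r)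
      = (if j = k then uE i l (r + s) else 0)
        - (-1 : ℂ) ^ (par i j * par k l) • (if i = l then uE k j (r + s) else 0) := by
  have h := toU_rel (Rel.bracket i j k l r s)
  simp only [map_sub, map_mul, map_smul, apply_ite toU, map_zero] at h
  exact h

theorem sign_cancel (i j l : Fin 2) :
    (-1 : ℂ) ^ (par i j) * (-1 : ℂ) ^ (par j l) = (-1 : ℂ) ^ (par i l) := by
  fin_cases i <;> fin_cases j <;> fin_cases l <;> norm_num [par]

theorem par_comm (i j : Fin 2) : par i j = par j i := Nat.add_comm _ _

theorem bracket_rhs_smul {A : Type*} [AddCommGroup A] [Module ℂ A]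
    (x : Fin 2 → Fin 2 → A) (i j k l : Fin 2) (c : ℂ) :
    (if j = k then (-1 : ℂ) ^ (par i l) • x i l else 0)
        - c • (if i = l then (-1 : ℂ) ^ (par k j) • x k j else 0)
      = ((-1 : ℂ) ^ (par i j) * (-1 : ℂ) ^ (par k l)) •
        ((if j = k then x i l else 0) - c • (if i = l then x k j else 0)) := by
  rw [smul_sub]
  congr 1
  · split_ifs with h
    · subst h; rw [sign_cancel]
    · simp
  · split_ifs with h
    · subst h
      rw [mul_comm, sign_cancel k i j, smul_comm]
    · simp

/-- The parity automorphism of `U(gl(1|1)[t])`: it is `1` on the even part and `-1` on the odd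
part, that is, `e_{ij}[r] ↦ (-1)^{|i|+|j|} e_{ij}[r]`. -/
def uParity : U →ₐ[ℂ] U :=
  liftU (FreeAlgebra.lift ℂ fun p => (-1 : ℂ) ^ (par p.1 p.2.1) • uE p.1 p.2.1 p.2.2) (by
      rintro _ _ ⟨i, j, k, l, r, s⟩
      have hg : ∀ i j r, (FreeAlgebra.lift ℂ
          fun p : Fin 2 × Fin 2 × ℕ => (-1 : ℂ) ^ (par p.1 p.2.1) • uE p.1 p.2.1 p.2.2)
          (gen i j r) = (-1 : ℂ) ^ (par i j) • uE i j r := by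
        intro i j r
        simp [gen]
      simp only [map_sub, map_mul, map_smul, apply_ite (FreeAlgebra.lift ℂ
          fun p : Fin 2 × Fin 2 × ℕ => (-1 : ℂ) ^ (par p.1 p.2.1) • uE p.1 p.2.1 p.2.2),
        map_zero, hg]
      rw [bracket_rhs_smul (fun i j => uE i j (r + s)), ← uE_bracket, smul_sub]
      simp only [smul_mul_smul_comm]
      rw [mul_comm ((-1 : ℂ) ^ par k l), smul_comm])

theorem uParity_uE (i j : Fin 2) (r : ℕ) :
    uParity (uE i j r) = (-1 : ℂ) ^ (par i j) • uE i j r := by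
  rw [uParity, uE, liftU_toU]
  simp [gen, uE]

theorem uParity_uParity (u : U) : uParity (uParity u) = u := by
  have h : uParity.comp uParity = AlgHom.id ℂ U := by
    apply U_hom_ext
    apply FreeAlgebra.hom_ext
    funext p
    obtain ⟨i, j, r⟩ := p
    change uParity (uParity (uE i j r)) = uE i j r
    rw [uParity_uE, map_smul, uParity_uE, smul_smul, ← mul_pow]
    simp
  exact DFunLike.congr_fun h u

/-! ### Modules over the current superalgebra -/

/-- The structure of a (ℤ/2-graded) `gl(1|1)[t]`-module on a complex vector space `M`.  The
grading is recorded by the parity operator, which is `1` on the even and `-1` on the odd part. -/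
structure CurrentRep (M : Type*) [AddCommGroup M] [Module ℂ M] where
  /-- the parity operator -/
  parity : Module.End ℂ M
  /-- the action of `e_{ij}[r]` -/
  e : Fin 2 → Fin 2 → ℕ → Module.End ℂ M
  parity_sq : parity * parity = 1
  parity_e : ∀ i j r, parity * e i j r = (-1 : ℂ) ^ (par i j) • (e i j r * parity)
  bracket : ∀ i j k l r s,
    e i j r * e k l s - (-1 : ℂ) ^ (par i j * par k l) • (e k l s * e i j r)
      = (if j = k then e i l (r + s) else 0)
        - (-1 : ℂ) ^ (par i j * par k l) • (if i = l then e k j (r + s) else 0)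

namespace CurrentRep

section

variable {M : Type*} [AddCommGroup M] [Module ℂ M] (ρ : CurrentRep M)

/-- The subspace of singular vectors, `{v | e_{12} v = 0}`, where `e_{12} = e_{12}[0]`. -/
def sing : Submodule ℂ M := LinearMap.ker (ρ.e 0 1 0)

/-- The coefficient of `x^{-(m+2)}` in the Gaudin transfer matrix
`H(x) = ½ ∑_{a,b} (-1)^{|b|} e_{ab}(x) e_{ba}(x)`, where `e_{ab}(x) = ∑_p e_{ab}[p] x^{-p-1}`. -/
def transfer (m : ℕ) : Module.End ℂ M :=
  (1 / 2 : ℂ) • ∑ a : Fin 2, ∑ b : Fin 2, (-1 : ℂ) ^ b.val •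
    ∑ p ∈ Finset.HasAntidiagonal.antidiagonal m, ρ.e a b p.1 * ρ.e b a p.2

/-- `v` is an eigenvector of the Gaudin transfer matrix with eigenvalue the series
`ξ(x) = ∑_{r ≥ 2} ξ_r x^{-r}`; Laurent series are taken in the variable `x⁻¹`, so that
`ξ.coeff r` is the coefficient of `x^{-r}`. -/
def IsEigenvector (ξ : ℂ⸨X⸩) (v : M) : Prop :=
  v ≠ 0 ∧ (∀ r : ℤ, r < 2 → ξ.coeff r = 0) ∧
    ∀ m : ℕ, ρ.transfer m v = ξ.coeff ((m : ℤ) + 2) • v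

/-- The transfer matrix has simple spectrum in the subspace `K`: eigenvectors in `K` that are not
proportional have different eigenvalues. -/
def SimpleSpectrum (K : Submodule ℂ M) : Prop :=
  ∀ v₁ ∈ K, ∀ v₂ ∈ K, ∀ ξ₁ ξ₂ : ℂ⸨X⸩, ρ.IsEigenvector ξ₁ v₁ → ρ.IsEigenvector ξ₂ v₂ →
    (¬ ∃ c : ℂ, c ≠ 0 ∧ v₁ = c • v₂) → ξ₁ ≠ ξ₂

/-- The eigenvectors of the transfer matrix in the subspace `K`, up to multiplication by a
nonzero constant. -/
def eigenlines (K : Submodule ℂ M) : Set (ℙ ℂ M) :=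
  {ℓ | ℓ.rep ∈ K ∧ ∃ ξ : ℂ⸨X⸩, ρ.IsEigenvector ξ ℓ.rep}

end

/-! #### Tensor products -/

section Tensor

variable {k : ℕ} {M : Fin k → Type*} [∀ s, AddCommGroup (M s)] [∀ s, Module ℂ (M s)]
  (ρ : ∀ s, CurrentRep (M s))

/-- The operator `γ^p ⊗ ⋯ ⊗ γ^p ⊗ X ⊗ 1 ⊗ ⋯ ⊗ 1` with `X` in the factor `s` and `γ` the parity
operators: the action of an operator `X` of parity `p` on the factor `s`, with the sign rule
`w₁ ⊗ ⋯ ⊗ w_k ↦ (-1)^{p(|w₁| + ⋯ + |w_{s-1}|)} w₁ ⊗ ⋯ ⊗ X w_s ⊗ ⋯ ⊗ w_k`. -/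
def slot (p : ℕ) (s : Fin k) (X : Module.End ℂ (M s)) : Module.End ℂ (⨂[ℂ] q, M q) :=
  PiTensorProduct.map
    (Function.update (fun q => if q < s then (ρ q).parity ^ p else 1) s X)

theorem slot_sub (p : ℕ) (s : Fin k) (X Y : Module.End ℂ (M s)) :
    slot ρ p s (X - Y) = slot ρ p s X - slot ρ p s Y := by
  have h := (PiTensorProduct.mapMultilinear ℂ M M).map_update_sub
    (fun q => if q < s then (ρ q).parity ^ p else 1) s X Y
  exact h

theorem slot_smul (p : ℕ) (s : Fin k) (c : ℂ) (X : Module.End ℂ (M s)) :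
    slot ρ p s (c • X) = c • slot ρ p s X :=
  PiTensorProduct.map_update_smul _ _ _ _

theorem slot_zero (p : ℕ) (s : Fin k) : slot ρ p s 0 = 0 := by
  have h := slot_smul ρ p s 0 0
  simpa using h

theorem slot_mul_same (p p' : ℕ) (s : Fin k) (X Y : Module.End ℂ (M s)) :
    slot ρ p s X * slot ρ p' s Y = slot ρ (p + p') s (X * Y) := by
  unfold slot
  rw [← PiTensorProduct.map_mul]
  congr 1
  funext q
  by_cases h : q = s
  · subst h; simp
  · by_cases h' : q < s <;> simp [h, h', pow_add]

theorem slot_congr {p p' : ℕ} (h : p % 2 = p' % 2) (s : Fin k) (X : Module.End ℂ (M s)) :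
    slot ρ p s X = slot ρ p' s X := by
  have key : ∀ q (n : ℕ), (ρ q).parity ^ n = (ρ q).parity ^ (n % 2) := by
    intro q n
    conv_lhs => rw [← Nat.mod_add_div n 2, pow_add, pow_mul, pow_two, (ρ q).parity_sq]
    simp
  unfold slot
  congr 2
  funext q
  rw [key q p, key q p', h]

theorem parity_pow_e {N : Type*} [AddCommGroup N] [Module ℂ N] (σ : CurrentRep N)
    (i j : Fin 2) (r p : ℕ) :
    σ.parity ^ p * σ.e i j r = (-1 : ℂ) ^ (par i j * p) • (σ.e i j r * σ.parity ^ p) := by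
  induction p with
  | zero => simp
  | succ p ih =>
    rw [pow_succ', mul_assoc, ih, mul_smul_comm, ← mul_assoc, σ.parity_e, smul_mul_assoc,
      smul_smul, mul_assoc, Nat.mul_succ, pow_add]

theorem slot_comm {s s' : Fin k} (h : s < s') (i j i' j' : Fin 2) (r r' : ℕ) :
    slot ρ (par i' j') s' ((ρ s').e i' j' r') * slot ρ (par i j) s ((ρ s).e i j r)
      = (-1 : ℂ) ^ (par i j * par i' j') •
        (slot ρ (par i j) s ((ρ s).e i j r) * slot ρ (par i' j') s' ((ρ s').e i' j' r')) := by
  have h1 : slot ρ (par i j) s ((ρ s).e i j r) * slot ρ (par i' j') s' ((ρ s').e i' j' r')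
      = PiTensorProduct.map (Function.update
        (fun q => (Function.update (fun q => if q < s then (ρ q).parity ^ par i j else 1) s
            ((ρ s).e i j r) q) *
          (Function.update (fun q => if q < s' then (ρ q).parity ^ par i' j' else 1) s'
            ((ρ s').e i' j' r') q)) s ((ρ s).e i j r * (ρ s).parity ^ par i' j')) := by
    unfold slot
    rw [← PiTensorProduct.map_mul]
    congr 1
    funext q
    by_cases hq : q = s
    · subst hq; simp [h.ne, h]
    · simp [hq]
  rw [h1, ← PiTensorProduct.map_update_smul, ← parity_pow_e]
  unfold slot
  rw [← PiTensorProduct.map_mul]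
  congr 1
  funext q
  by_cases hq : q = s
  · subst hq; simp [h.ne, h]
  · by_cases hq' : q = s'
    · subst hq'
      simp [hq, not_lt_of_gt h]
    · by_cases hlt : q < s
      · simp [hq, hq', hlt, hlt.trans h, ← pow_add, add_comm]
      · simp [hq, hq', hlt]

/-- The super tensor product of `gl(1|1)[t]`-modules, through the coproduct
`Δ(X) = X ⊗ 1 + 1 ⊗ X` for `X ∈ gl(1|1)[t]` and the sign rule for superspaces. -/
def tensor : CurrentRep (⨂[ℂ] q, M q) where
  parity := PiTensorProduct.map fun q => (ρ q).parity
  e i j r := ∑ s, slot ρ (par i j) s ((ρ s).e i j r)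
  parity_sq := by
    rw [← PiTensorProduct.map_mul]
    simp only [(ρ _).parity_sq]
    exact PiTensorProduct.map_one
  parity_e i j r := by
    rw [Finset.mul_sum, Finset.sum_mul, Finset.smul_sum]
    refine Finset.sum_congr rfl fun s _ => ?_
    have h1 : slot ρ (par i j) s ((ρ s).e i j r) * PiTensorProduct.map (fun q => (ρ q).parity)
        = PiTensorProduct.map (Function.update
          (fun q => (if q < s then (ρ q).parity ^ par i j else 1) * (ρ q).parity) s
            ((ρ s).e i j r * (ρ s).parity)) := by
      unfold slot
      rw [← PiTensorProduct.map_mul]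
      congr 1
      funext q
      by_cases hq : q = s
      · subst hq; simp
      · simp [hq]
    rw [h1, ← PiTensorProduct.map_update_smul, ← (ρ s).parity_e]
    unfold slot
    rw [← PiTensorProduct.map_mul]
    congr 1
    funext q
    by_cases hq : q = s
    · subst hq; simp
    · by_cases hlt : q < s
      · simp [hq, hlt, ← pow_succ, ← pow_succ']
      · simp [hq, hlt]
  bracket i j k' l r r' := by
    have hdiag : ∀ s : Fin k,
        slot ρ (par i j) s ((ρ s).e i j r) * slot ρ (par k' l) s ((ρ s).e k' l r')
          - (-1 : ℂ) ^ (par i j * par k' l) •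
            (slot ρ (par k' l) s ((ρ s).e k' l r') * slot ρ (par i j) s ((ρ s).e i j r))
        = (if j = k' then slot ρ (par i l) s ((ρ s).e i l (r + r')) else 0)
          - (-1 : ℂ) ^ (par i j * par k' l) •
            (if i = l then slot ρ (par k' j) s ((ρ s).e k' j (r + r')) else 0) := by
      intro s
      rw [slot_mul_same, slot_mul_same, add_comm (par k' l), ← slot_smul, ← slot_sub,
        (ρ s).bracket, slot_sub, slot_smul]
      congr 1
      · split_ifs with h
        · subst h
          exact slot_congr ρ (by simp only [par]; omega) s _
        · exact slot_zero ρ _ s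
      · congr 1
        split_ifs with h
        · subst h
          exact slot_congr ρ (by simp only [par]; omega) s _
        · exact slot_zero ρ _ s
    have hoff : ∀ s s' : Fin k, s ≠ s' →
        slot ρ (par i j) s ((ρ s).e i j r) * slot ρ (par k' l) s' ((ρ s').e k' l r')
          - (-1 : ℂ) ^ (par i j * par k' l) •
            (slot ρ (par k' l) s' ((ρ s').e k' l r') * slot ρ (par i j) s ((ρ s).e i j r))
        = 0 := by
      intro s s' hne
      rcases lt_or_gt_of_ne hne with h | h
      · rw [slot_comm ρ h, smul_smul, ← mul_pow]
        simp
      · rw [slot_comm ρ h, mul_comm (par k' l)]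
        simp
    have hsum : (∑ s, slot ρ (par i j) s ((ρ s).e i j r))
          * (∑ s, slot ρ (par k' l) s ((ρ s).e k' l r'))
          - (-1 : ℂ) ^ (par i j * par k' l) •
            ((∑ s, slot ρ (par k' l) s ((ρ s).e k' l r'))
              * (∑ s, slot ρ (par i j) s ((ρ s).e i j r)))
        = ∑ s, (slot ρ (par i j) s ((ρ s).e i j r) * slot ρ (par k' l) s ((ρ s).e k' l r')
          - (-1 : ℂ) ^ (par i j * par k' l) •
            (slot ρ (par k' l) s ((ρ s).e k' l r') * slot ρ (par i j) s ((ρ s).e i j r))) := by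
      rw [Finset.sum_mul_sum, Finset.sum_mul_sum, Finset.sum_comm (s := Finset.univ)
        (t := Finset.univ) (f := fun a b => slot ρ (par k' l) a ((ρ a).e k' l r')
          * slot ρ (par i j) b ((ρ b).e i j r)), Finset.smul_sum, ← Finset.sum_sub_distrib]
      refine Finset.sum_congr rfl fun s _ => ?_
      rw [Finset.smul_sum, ← Finset.sum_sub_distrib]
      exact Finset.sum_eq_single s (fun s' _ hs' => hoff s s' hs'.symm) (by simp)
    rw [hsum, Finset.sum_congr rfl fun s _ => hdiag s, Finset.sum_sub_distrib,
      ← Finset.smul_sum]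
    congr 1
    · split_ifs <;> simp
    · split_ifs <;> simp

end Tensor

end CurrentRep

/-! ### Rational functions of `x` as series in `x⁻¹` -/

/-- The variable `x`; Laurent series are taken in the variable `x⁻¹`. -/
def xL : ℂ⸨X⸩ := HahnSeries.single (-1) 1

/-- A polynomial `p(x)` as a Laurent series in `x⁻¹`.  Quotients of such series, formed in the
field of Laurent series, are the expansions at infinity of rational functions. -/
def polyL : ℂ[X] →+* ℂ⸨X⸩ := eval₂RingHom HahnSeries.C xL

/-- The derivative `d/dx` of Laurent series in `u = x⁻¹`, which is `- u² d/du`. -/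
def ddx (f : ℂ⸨X⸩) : ℂ⸨X⸩ := -(HahnSeries.single 2 1 * LaurentSeries.derivative ℂ f)

/-! ### Weyl modules -/

/-- The defining relations of the Weyl module `W_η`, as elements of `U(gl(1|1)[t])` that kill the
generator `w`: `e_{11}(x) w = (η'(x)/η(x)) w`, `e_{22}(x) w = e_{12}(x) w = 0` and
`(e_{21} ⊗ η(t)) w = 0`. -/
inductive IsWeylRelation (η : ℂ[X]) : U → Prop
  | e11 (r : ℕ) : IsWeylRelation η (uE 0 0 r
      - algebraMap ℂ U ((polyL (derivative η) / polyL η).coeff ((r : ℤ) + 1)))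
  | e22 (r : ℕ) : IsWeylRelation η (uE 1 1 r)
  | e12 (r : ℕ) : IsWeylRelation η (uE 0 1 r)
  | e21 : IsWeylRelation η (∑ i ∈ Finset.range (η.natDegree + 1), η.coeff i • uE 1 0 i)

/-- The left ideal generated by the relations of the Weyl module. -/
def weylIdeal (η : ℂ[X]) : Submodule U U := Submodule.span U {u | IsWeylRelation η u}

/-- The Weyl module `W_η = U(gl(1|1)[t]) w`, for `η` monic. -/
def Weyl (η : ℂ[X]) : Type := U ⧸ weylIdeal η

instance (η : ℂ[X]) : AddCommGroup (Weyl η) := inferInstanceAs (AddCommGroup (U ⧸ weylIdeal η))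

instance (η : ℂ[X]) : Module U (Weyl η) := inferInstanceAs (Module U (U ⧸ weylIdeal η))

instance (η : ℂ[X]) : Module ℂ (Weyl η) := inferInstanceAs (Module ℂ (U ⧸ weylIdeal η))

instance (η : ℂ[X]) : IsScalarTower ℂ U (Weyl η) :=
  inferInstanceAs (IsScalarTower ℂ U (U ⧸ weylIdeal η))

/-- The vector `u w` of the Weyl module, for `u ∈ U(gl(1|1)[t])` and `w` the generator. -/
def weylMk (η : ℂ[X]) (u : U) : Weyl η := Submodule.Quotient.mk u

theorem weylMk_surjective (η : ℂ[X]) : Function.Surjective (weylMk η) :=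
  Submodule.Quotient.mk_surjective _

theorem weylMk_smul (η : ℂ[X]) (c : ℂ) (u : U) : weylMk η (c • u) = c • weylMk η u := rfl

theorem weylMk_mul (η : ℂ[X]) (v u : U) : weylMk η (v * u) = v • weylMk η u := rfl

theorem weylIdeal_le_comap (η : ℂ[X]) :
    weylIdeal η ≤ (weylIdeal η).comap (uParity : U →+* U).toSemilinearMap := by
  refine Submodule.span_le.2 ?_
  intro u hu
  have hmem : u ∈ weylIdeal η := Submodule.subset_span hu
  change uParity u ∈ weylIdeal η
  have hsm : ∀ c : ℂ, c • u ∈ weylIdeal η := fun c => by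
    rw [Algebra.smul_def]
    exact (weylIdeal η).smul_mem (algebraMap ℂ U c) hmem
  have hc : ∃ c : ℂ, uParity u = c • u := by
    rcases hu with r | r | r | _
    · exact ⟨1, by rw [map_sub, uParity_uE, AlgHom.commutes]; simp [par]⟩
    · exact ⟨_, uParity_uE _ _ _⟩
    · exact ⟨_, uParity_uE _ _ _⟩
    · refine ⟨-1, ?_⟩
      rw [map_sum, Finset.smul_sum]
      refine Finset.sum_congr rfl fun i _ => ?_
      rw [map_smul, uParity_uE, smul_comm]
      norm_num [par]
  obtain ⟨c, hc⟩ := hc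
  rw [hc]
  exact hsm c

/-- The parity operator of the Weyl module, for which the generator `w` is even:
`u w ↦ γ(u) w`, with `γ` the parity automorphism. -/
def weylParity (η : ℂ[X]) : Module.End ℂ (Weyl η) where
  toFun := Submodule.mapQ (weylIdeal η) (weylIdeal η) (uParity : U →+* U).toSemilinearMap
    (weylIdeal_le_comap η)
  map_add' := map_add _
  map_smul' c x := by
    obtain ⟨u, rfl⟩ := weylMk_surjective η x
    change weylMk η (uParity (c • u)) = c • weylMk η (uParity u)
    rw [map_smul, weylMk_smul]

theorem weylParity_mk (η : ℂ[X]) (u : U) :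
    weylParity η (weylMk η u) = weylMk η (uParity u) := rfl

/-- The Weyl module `W_η` as a `gl(1|1)[t]`-module: `U(gl(1|1)[t])` acts by left
multiplication. -/
def weylRep (η : ℂ[X]) : CurrentRep (Weyl η) where
  parity := weylParity η
  e i j r := Algebra.lsmul ℂ ℂ (Weyl η) (uE i j r)
  parity_sq := by
    refine LinearMap.ext fun x => ?_
    obtain ⟨u, rfl⟩ := weylMk_surjective η x
    change weylParity η (weylParity η (weylMk η u)) = weylMk η u
    rw [weylParity_mk, weylParity_mk, uParity_uParity]
  parity_e i j r := by
    refine LinearMap.ext fun x => ?_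
    obtain ⟨u, rfl⟩ := weylMk_surjective η x
    change weylParity η (uE i j r • weylMk η u)
      = (-1 : ℂ) ^ (par i j) • (uE i j r • weylParity η (weylMk η u))
    rw [← weylMk_mul, weylParity_mk, weylParity_mk, ← weylMk_mul, ← weylMk_smul, map_mul,
      uParity_uE, smul_mul_assoc]
  bracket i j k l r s := by
    have h := congrArg (Algebra.lsmul ℂ ℂ (Weyl η)) (uE_bracket i j k l r s)
    simpa only [map_sub, map_mul, map_smul, apply_ite (Algebra.lsmul ℂ ℂ (Weyl η)), map_zero]
      using h

/-- `W_m(b) = W_η` for `η(x) = (x - b)^m`. -/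
def weylPt (m : ℕ) (b : ℂ) : CurrentRep (Weyl ((X - C b) ^ m)) := weylRep ((X - C b) ^ m)

/-- The tensor product `W_{n_1}(b_1) ⊗ ⋯ ⊗ W_{n_k}(b_k)`. -/
def weylTensor {k : ℕ} (n : Fin k → ℕ) (b : Fin k → ℂ) :
    CurrentRep (⨂[ℂ] s, Weyl ((X - C (b s)) ^ n s)) :=
  CurrentRep.tensor fun s => weylPt (n s) (b s)

/-! ### The eigenvalues -/

/-- `ζ(x) = ∑_s n_s / (x - b_s)`, expanded in `x⁻¹`. -/
def zeta {k : ℕ} (n : Fin k → ℕ) (b : Fin k → ℂ) : ℂ⸨X⸩ :=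
  ∑ s, (n s : ℂ⸨X⸩) / polyL (X - C (b s))

/-- The polynomial `ψ(x) = ζ(x) ∏_r (x - b_r)^{n_r}`. -/
def psi {k : ℕ} (n : Fin k → ℕ) (b : Fin k → ℂ) : ℂ[X] :=
  ∑ s, (n s : ℂ[X]) * (X - C (b s)) ^ (n s - 1) *
    ∏ r ∈ Finset.univ.erase s, (X - C (b r)) ^ n r

/-- The series `½ ζ'(x) - ζ(x) y'(x)/y(x) + ½ ζ(x)²`. -/
def eigenvalue {k : ℕ} (n : Fin k → ℕ) (b : Fin k → ℂ) (y : ℂ[X]) : ℂ⸨X⸩ :=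
  HahnSeries.C (1 / 2 : ℂ) * ddx (zeta n b)
    - zeta n b * (polyL (derivative y) / polyL y)
    + HahnSeries.C (1 / 2 : ℂ) * zeta n b ^ 2

theorem polyL_X_sub_C_ne_zero (c : ℂ) : polyL (X - C c) ≠ 0 := by
  intro h
  have h1 := congrArg (fun f : ℂ⸨X⸩ => f.coeff (-1)) h
  simp [polyL, xL, HahnSeries.C_apply] at h1

/-- The polynomial `psi` is `ζ(x) ∏_r (x - b_r)^{n_r}`. -/
theorem polyL_psi {k : ℕ} (n : Fin k → ℕ) (b : Fin k → ℂ) :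
    polyL (psi n b) = zeta n b * ∏ r, polyL (X - C (b r)) ^ n r := by
  rw [zeta, psi, Finset.sum_mul, map_sum]
  refine Finset.sum_congr rfl fun s _ => ?_
  have h0 := polyL_X_sub_C_ne_zero (b s)
  rw [← Finset.mul_prod_erase Finset.univ _ (Finset.mem_univ s)]
  simp only [map_mul, map_prod, map_pow, map_natCast]
  rcases Nat.eq_zero_or_pos (n s) with h | h
  · simp [h]
  · obtain ⟨m, hm⟩ := Nat.exists_eq_succ_of_ne_zero h.ne'
    rw [hm, Nat.succ_eq_add_one, Nat.add_sub_cancel, pow_succ]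
    field_simp

end GL11

end

/-! Put η = ∏ (x - b_s)^{n_s}, N = deg η and A = ℂ[t]/(η), so that ζ = η'/η and ψ = η'. The tensor
product is a fermionic Fock space Λ(A): e_21[r] is multiplication by t^r, e_12[r] is contraction
with the form v ↦ tr(t^r v), where tr p is the sum of p over the roots of η with multiplicity,
e_22[r] is the derivation dΓ extending multiplication by t^r on A, and e_11[r] + e_22[r] is the
scalar ∑ a^r over these roots. For a single Weyl module these formulas define a representation,
which inverts the evident surjection Λ(A) → W_η (`weylToFock_fockMap`). For the tensor product, the
Chinese remainder theorem shows that the product of the generators generates everything under e_21,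
and both sides have dimension 2^N (`lowSpan_tensorVec`, `fockMap_tensorVec_bijective`).

Since e_21[r] e_12[s] is dΓ of a rank one operator, the transfer matrix is a scalar plus dΓ of an
operator on A (`transfer_fockMap`). The singular vectors are those killed by contraction with tr,
that is, Λ(ker tr), and on ker tr the operator is -ζ(x)(x - T)⁻¹, with T the multiplication by t
followed by the projection onto ker tr along 1 (`gaudinOp_eq`). As ζ has leading coefficient N ≠ 0,
the singular eigenvectors are the joint eigenvectors of all dΓ(T^r). Divisors of η' enter because
taking the polynomial part of gη/η' identifies (ker tr, T) with ℂ[t]/(η') (`isCyclic_compression`).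

It remains to find the joint eigenvectors x in Λ^l of a cyclic module ℂ[t]/(ψ). Evaluating x on
forms φ_i T^{s_i} gives linear functionals on ℂ[X_1,…,X_l] on which power sums, hence all symmetric
polynomials, act by their values at a point a ∈ ℂ^l. Each X_j is a root of ∏ (Z - X_i), so the
functionals vanish on y(X_j) for y = ∏ (Z - a_i), and x lives on ker y(T)
(`exists_point_of_psumEigen`, `exists_point_of_eigen`). Cyclicity gives dim ker y(T) ≤ l, with
equality only if y ∣ ψ; so x spans the line Λ^l(ker y(T)), and conversely each such line consists of
eigenvectors (`exists_divisor`, `exists_eq_smul`, `exists_eigenvector`). The power sums of the roots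
of y are the coefficients of y'/y, which yields the eigenvalue. Nothing here requires T to be
diagonalizable, so multiple roots of ψ need no separate treatment. -/

noncomputable section

namespace GL11

/-! ### The exterior algebra as a fermionic Fock space -/

namespace Fock

open ExteriorAlgebra

variable {V : Type*} [AddCommGroup V] [Module ℂ V]

/-- Contraction with a linear form. -/
def annih (φ : Module.Dual ℂ V) : Module.End ℂ (ExteriorAlgebra ℂ V) :=
  CliffordAlgebra.contractLeft φ

theorem induction_left {P : ExteriorAlgebra ℂ V → Prop} (one : P 1)
    (add : ∀ x y, P x → P y → P (x + y)) (smul : ∀ (c : ℂ) x, P x → P (c • x))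
    (ι_mul : ∀ v x, P x → P (ι ℂ v * x)) (x : ExteriorAlgebra ℂ V) : P x := by
  induction x using CliffordAlgebra.left_induction with
  | algebraMap r => rw [Algebra.algebraMap_eq_smul_one]; exact smul r 1 one
  | add x y hx hy => exact add x y hx hy
  | ι_mul x v hx => exact ι_mul v x hx

/-- A linear endomorphism of the exterior algebra is determined by its value at `1` and its
commutation with left multiplication by vectors. -/
theorem linearMap_eq_zero {W : Type*} [AddCommGroup W] [Module ℂ W]
    (D : ExteriorAlgebra ℂ V →ₗ[ℂ] W) (one : D 1 = 0)
    (ι_mul : ∀ v x, D x = 0 → D (ι ℂ v * x) = 0) (x : ExteriorAlgebra ℂ V) : D x = 0 := by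
  induction x using induction_left with
  | one => exact one
  | add x y hx hy => rw [map_add, hx, hy, add_zero]
  | smul c x hx => rw [map_smul, hx, smul_zero]
  | ι_mul v x hx => exact ι_mul v x hx

@[simp] theorem annih_one (φ : Module.Dual ℂ V) : annih φ 1 = 0 :=
  CliffordAlgebra.contractLeft_one _ _

theorem annih_ι_mul (φ : Module.Dual ℂ V) (v : V) (x : ExteriorAlgebra ℂ V) :
    annih φ (ι ℂ v * x) = φ v • x - ι ℂ v * annih φ x :=
  CliffordAlgebra.contractLeft_ι_mul φ v x

theorem annih_annih_self (φ : Module.Dual ℂ V) (x : ExteriorAlgebra ℂ V) :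
    annih φ (annih φ x) = 0 :=
  CliffordAlgebra.contractLeft_contractLeft φ x

theorem annih_anticomm (φ χ : Module.Dual ℂ V) (x : ExteriorAlgebra ℂ V) :
    annih φ (annih χ x) = -annih χ (annih φ x) :=
  CliffordAlgebra.contractLeft_comm φ χ x

theorem annih_add (φ χ : Module.Dual ℂ V) : annih (φ + χ) = annih φ + annih χ :=
  map_add _ _ _

theorem annih_smul (c : ℂ) (φ : Module.Dual ℂ V) : annih (c • φ) = c • annih φ :=
  map_smul _ _ _

theorem ι_mul_anticomm (u v : V) (x : ExteriorAlgebra ℂ V) :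
    ι ℂ u * (ι ℂ v * x) = -(ι ℂ v * (ι ℂ u * x)) := by
  rw [← mul_assoc, ← mul_assoc, ← neg_mul, eq_neg_of_add_eq_zero_left (ι_add_mul_swap u v)]

/-- The value of `x` on `l` linear forms: the degree zero part of the iterated contraction. -/
def pairing : ∀ {l : ℕ}, (Fin l → Module.Dual ℂ V) → ExteriorAlgebra ℂ V →ₗ[ℂ] ℂ
  | 0, _ => (algebraMapInv (R := ℂ) (M := V)).toLinearMap
  | _ + 1, φ => pairing (Fin.tail φ) ∘ₗ annih (φ 0)

theorem pairing_zero (φ : Fin 0 → Module.Dual ℂ V) (x : ExteriorAlgebra ℂ V) :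
    pairing φ x = algebraMapInv x := rfl

theorem pairing_succ {l : ℕ} (φ : Fin (l + 1) → Module.Dual ℂ V) (x : ExteriorAlgebra ℂ V) :
    pairing φ x = pairing (Fin.tail φ) (annih (φ 0) x) := rfl

theorem annih_sup_span_singleton {S : Submodule ℂ (Module.Dual ℂ V)} {x : ExteriorAlgebra ℂ V}
    (hS : ∀ φ ∈ S, annih φ x = 0) {χ : Module.Dual ℂ V} (hχ : annih χ x = 0) :
    ∀ φ ∈ S ⊔ Submodule.span ℂ {χ}, annih φ x = 0 := by
  intro φ hφ
  obtain ⟨a, ha, b, hb, rfl⟩ := Submodule.mem_sup.1 hφ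
  obtain ⟨c, rfl⟩ := Submodule.mem_span_singleton.1 hb
  simp [annih_add, annih_smul, hS a ha, hχ]

/-- Lets an induction on `d` absorb the forms of `χ` into `S` one at a time. -/
theorem sup_span_tail {S : Submodule ℂ (Module.Dual ℂ V)} {d : ℕ}
    {χ : Fin (d + 1) → Module.Dual ℂ V} (h : S ⊔ Submodule.span ℂ (Set.range χ) = ⊤) :
    S ⊔ Submodule.span ℂ {χ 0} ⊔ Submodule.span ℂ (Set.range (Fin.tail χ)) = ⊤ := by
  rw [sup_assoc, ← Submodule.span_union, ← h]
  congr 2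
  ext φ
  simp only [Set.singleton_union, Set.mem_insert_iff, Set.mem_range, Fin.exists_fin_succ, Fin.tail]
  exact or_congr eq_comm Iff.rfl

/-! ### Derivations of the exterior algebra induced by endomorphisms of V -/

section dGamma

variable [FiniteDimensional ℂ V]

/-- The extension of an endomorphism of `V` to a derivation of the exterior algebra. -/
def dGamma (S : Module.End ℂ V) : Module.End ℂ (ExteriorAlgebra ℂ V) :=
  ∑ i, LinearMap.mulLeft ℂ (ι ℂ (S (Module.finBasis ℂ V i))) *
    annih ((Module.finBasis ℂ V).coord i)

theorem dGamma_apply (S : Module.End ℂ V) (x : ExteriorAlgebra ℂ V) :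
    dGamma S x = ∑ i, ι ℂ (S (Module.finBasis ℂ V i)) *
      annih ((Module.finBasis ℂ V).coord i) x := by
  simp [dGamma]

@[simp] theorem dGamma_one (S : Module.End ℂ V) : dGamma S 1 = 0 := by
  simp [dGamma_apply]

theorem dGamma_ι_mul (S : Module.End ℂ V) (v : V) (x : ExteriorAlgebra ℂ V) :
    dGamma S (ι ℂ v * x) = ι ℂ (S v) * x + ι ℂ v * dGamma S x := by
  simp only [dGamma_apply, annih_ι_mul, mul_sub, Finset.sum_sub_distrib, Finset.mul_sum]
  rw [sub_eq_add_neg, ← Finset.sum_neg_distrib]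
  congr 1
  · conv_rhs => rw [← (Module.finBasis ℂ V).sum_repr v, map_sum, map_sum, Finset.sum_mul]
    simp
  · refine Finset.sum_congr rfl fun i _ => ?_
    rw [ι_mul_anticomm, neg_neg]

theorem dGamma_add (S S' : Module.End ℂ V) : dGamma (S + S') = dGamma S + dGamma S' := by
  ext x; simp [dGamma_apply, add_mul, Finset.sum_add_distrib]

theorem dGamma_smul (c : ℂ) (S : Module.End ℂ V) : dGamma (c • S) = c • dGamma S := by
  ext x; simp [dGamma_apply, Finset.smul_sum]

/-- `dGamma` as a linear map. -/
def dGammaₗ : Module.End ℂ V →ₗ[ℂ] Module.End ℂ (ExteriorAlgebra ℂ V) where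
  toFun := dGamma
  map_add' := dGamma_add
  map_smul' := dGamma_smul

theorem dGamma_sub (S S' : Module.End ℂ V) : dGamma (S - S') = dGamma S - dGamma S' :=
  map_sub dGammaₗ S S'

theorem dGamma_sum {α : Type*} (s : Finset α) (S : α → Module.End ℂ V) :
    dGamma (∑ i ∈ s, S i) = ∑ i ∈ s, dGamma (S i) :=
  map_sum dGammaₗ S s

/-- The difference of the two sides kills 1 and anticommutes with left multiplication by vectors,
hence vanishes. -/
theorem annih_dGamma (φ : Module.Dual ℂ V) (S : Module.End ℂ V) (x : ExteriorAlgebra ℂ V) :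
    annih φ (dGamma S x) = dGamma S (annih φ x) + annih (φ ∘ₗ S) x := by
  rw [← sub_eq_zero]
  refine linearMap_eq_zero (annih φ * dGamma S - (dGamma S * annih φ + annih (φ ∘ₗ S)))
    (by simp) (fun v x hx => ?_) x
  simp only [LinearMap.sub_apply, LinearMap.add_apply, Module.End.mul_apply, sub_eq_zero] at hx ⊢
  simp only [dGamma_ι_mul, annih_ι_mul, map_add, map_sub, map_smul, hx, mul_add,
    LinearMap.comp_apply]
  abel

/-- This identity turns the products e_21[r] e_12[s] in the transfer matrix into derivations. -/
theorem dGamma_smulRight (φ : Module.Dual ℂ V) (u : V) (x : ExteriorAlgebra ℂ V) :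
    dGamma (φ.smulRight u) x = ι ℂ u * annih φ x := by
  rw [← sub_eq_zero]
  refine linearMap_eq_zero (dGamma (φ.smulRight u) - LinearMap.mulLeft ℂ (ι ℂ u) * annih φ)
    (by simp) (fun v x hx => ?_) x
  simp only [LinearMap.sub_apply, Module.End.mul_apply, sub_eq_zero, LinearMap.mulLeft_apply]
    at hx ⊢
  rw [dGamma_ι_mul, hx, annih_ι_mul, mul_sub, ι_mul_anticomm v u]
  simp [sub_eq_add_neg]

theorem dGamma_comm {S S' : Module.End ℂ V} (h : Commute S S') (x : ExteriorAlgebra ℂ V) :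
    dGamma S (dGamma S' x) = dGamma S' (dGamma S x) := by
  rw [← sub_eq_zero]
  refine linearMap_eq_zero (dGamma S * dGamma S' - dGamma S' * dGamma S)
    (by simp) (fun v x hx => ?_) x
  simp only [LinearMap.sub_apply, Module.End.mul_apply, sub_eq_zero] at hx ⊢
  have h' : S (S' v) = S' (S v) := LinearMap.congr_fun h v
  simp only [dGamma_ι_mul, map_add, hx, h']
  abel

theorem algebraMapInv_dGamma (S : Module.End ℂ V) (x : ExteriorAlgebra ℂ V) :
    algebraMapInv (dGamma S x) = 0 := by
  refine linearMap_eq_zero ((algebraMapInv (R := ℂ) (M := V)).toLinearMap ∘ₗ dGamma S)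
    (by simp) (fun v x hx => ?_) x
  simp [dGamma_ι_mul, algebraMapInv]

/-! #### The degree -/

theorem dGamma_one_ι_mul {l : ℂ} {x : ExteriorAlgebra ℂ V} (hx : dGamma 1 x = l • x) (v : V) :
    dGamma 1 (ι ℂ v * x) = (l + 1) • (ι ℂ v * x) := by
  rw [dGamma_ι_mul, hx, add_smul, mul_smul_comm]
  simp [add_comm]

theorem dGamma_one_annih {l : ℂ} {x : ExteriorAlgebra ℂ V} (hx : dGamma 1 x = l • x)
    (φ : Module.Dual ℂ V) : dGamma 1 (annih φ x) = (l - 1) • annih φ x := by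
  have h := annih_dGamma φ 1 x
  rw [hx, map_smul, show φ ∘ₗ (1 : Module.End ℂ V) = φ from rfl] at h
  rw [sub_smul, h]
  simp

/-- The grading is read off from the number operator `dGamma 1`: multiplication by a vector raises
its eigenvalue by one, so everything beyond the scalar part has positive integer eigenvalues.
Independence of eigenspaces then gives the next two lemmas. -/
theorem sub_algebraMapInv_mem (x : ExteriorAlgebra ℂ V) :
    x - algebraMap ℂ _ (algebraMapInv x) ∈
      ⨆ l : ℕ, (dGamma (1 : Module.End ℂ V)).eigenspace ((l : ℂ) + 1) := by
  have step : ∀ (v : V), ∀ y ∈ ⨆ l : ℕ, (dGamma (1 : Module.End ℂ V)).eigenspace ((l : ℂ) + 1),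
      ι ℂ v * y ∈ ⨆ l : ℕ, (dGamma (1 : Module.End ℂ V)).eigenspace ((l : ℂ) + 1) := by
    intro v y hy
    induction hy using Submodule.iSup_induction' with
    | mem l y hy =>
      refine Submodule.mem_iSup_of_mem (l + 1) ?_
      rw [Module.End.mem_eigenspace_iff] at hy ⊢
      rw [dGamma_one_ι_mul hy]; push_cast; rfl
    | zero => simp
    | add a b _ _ ha hb => rw [mul_add]; exact add_mem ha hb
  induction x using induction_left with
  | one => simp
  | add x y hx hy => convert add_mem hx hy using 1; simp; abel
  | smul c x hx =>
    convert Submodule.smul_mem _ c hx using 1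
    simp [Algebra.smul_def, mul_sub]
  | ι_mul v x hx =>
    have h0 : algebraMapInv (ι ℂ v * x) = 0 := by simp [algebraMapInv]
    rw [h0, map_zero, sub_zero]
    rw [← sub_add_cancel x (algebraMap ℂ _ (algebraMapInv x)), mul_add]
    refine add_mem (step v _ hx) (Submodule.mem_iSup_of_mem 0 ?_)
    rw [Module.End.mem_eigenspace_iff]
    refine (dGamma_one_ι_mul (l := 0) ?_ v).trans (by simp)
    rw [Algebra.algebraMap_eq_smul_one]; simp

theorem eq_algebraMap_of_dGamma_one_eq_zero {x : ExteriorAlgebra ℂ V} (hx : dGamma 1 x = 0) :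
    x = algebraMap ℂ _ (algebraMapInv x) := by
  rw [← sub_eq_zero]
  have h1 := sub_algebraMapInv_mem x
  have h2 : x - algebraMap ℂ _ (algebraMapInv x) ∈
      (dGamma (1 : Module.End ℂ V)).eigenspace 0 := by
    rw [Module.End.mem_eigenspace_iff, map_sub, hx, Algebra.algebraMap_eq_smul_one]; simp
  have hd := (Module.End.eigenspaces_iSupIndep (dGamma (1 : Module.End ℂ V))) 0
  rw [disjoint_iff] at hd
  have : x - algebraMap ℂ _ (algebraMapInv x) ∈ (⊥ : Submodule ℂ (ExteriorAlgebra ℂ V)) := by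
    rw [← hd]
    refine ⟨h2, ?_⟩
    revert h1
    apply SetLike.le_def.1
    refine iSup_le fun l => ?_
    exact le_iSup₂_of_le ((l : ℂ) + 1) (by exact_mod_cast Nat.succ_ne_zero l) le_rfl
  simpa using this

theorem exists_nat_of_dGamma_one {x : ExteriorAlgebra ℂ V} (hx0 : x ≠ 0) {μ : ℂ}
    (hx : dGamma 1 x = μ • x) : ∃ l : ℕ, μ = l := by
  by_contra! hμ
  apply hx0
  have hd := (Module.End.eigenspaces_iSupIndep (dGamma (1 : Module.End ℂ V))) μ
  rw [disjoint_iff] at hd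
  have : x ∈ (⊥ : Submodule ℂ (ExteriorAlgebra ℂ V)) := by
    rw [← hd]
    refine ⟨Module.End.mem_eigenspace_iff.2 hx, ?_⟩
    rw [← sub_add_cancel x (algebraMap ℂ _ (algebraMapInv x))]
    refine add_mem (SetLike.le_def.1 ?_ (sub_algebraMapInv_mem x)) ?_
    · refine iSup_le fun l => ?_
      exact le_iSup₂_of_le ((l : ℂ) + 1) (by have := hμ (l + 1); push_cast at this; exact this.symm)
        le_rfl
    · have h0 : (0 : ℂ) ≠ μ := by have := hμ 0; push_cast at this; exact this.symm
      refine SetLike.le_def.1 (le_iSup₂_of_le (0 : ℂ) h0 le_rfl) ?_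
      rw [Module.End.mem_eigenspace_iff, Algebra.algebraMap_eq_smul_one]; simp
  simpa using this

/-- Euler's identity: `l • x` is a sum of vectors times contractions of `x`. -/
theorem eq_zero_of_annih_eq_zero {x : ExteriorAlgebra ℂ V} {l : ℂ} (hl : l ≠ 0)
    (hx : dGamma 1 x = l • x) (h : ∀ φ, annih φ x = 0) : x = 0 := by
  have : dGamma 1 x = 0 := by simp [dGamma_apply, h]
  rw [hx] at this
  exact (smul_eq_zero.1 this).resolve_left hl

/-! #### Iterated contractions -/

/-- A derivation acts on an alternating form by inserting `S` in each argument in turn; commuting it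
past one contraction at a time produces these terms, and its image has no scalar part. -/
theorem pairing_dGamma (S : Module.End ℂ V) {l : ℕ} (φ : Fin l → Module.Dual ℂ V)
    (x : ExteriorAlgebra ℂ V) :
    pairing φ (dGamma S x) = ∑ i, pairing (Function.update φ i (φ i ∘ₗ S)) x := by
  induction l generalizing x with
  | zero => simpa [pairing_zero] using algebraMapInv_dGamma S x
  | succ l ih =>
    rw [pairing_succ, annih_dGamma, map_add, ih, Fin.sum_univ_succ, add_comm]
    congr 1
    refine Finset.sum_congr rfl fun i _ => ?_
    rw [pairing_succ, Fin.tail_update_succ, Function.update_of_ne (Fin.succ_ne_zero i).symm]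
    rfl

theorem eq_zero_of_pairing_eq_zero {l : ℕ} {x : ExteriorAlgebra ℂ V}
    (hx : dGamma 1 x = (l : ℂ) • x) (h : ∀ φ : Fin l → Module.Dual ℂ V, pairing φ x = 0) :
    x = 0 := by
  induction l generalizing x with
  | zero =>
    rw [eq_algebraMap_of_dGamma_one_eq_zero (x := x) (by simpa using hx)]
    have := h 0
    rw [pairing_zero] at this
    rw [this, map_zero]
  | succ l ih =>
    refine eq_zero_of_annih_eq_zero (Nat.cast_ne_zero.2 l.succ_ne_zero) hx fun φ => ?_
    refine ih ?_ fun χ => ?_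
    · rw [dGamma_one_annih hx]; simp
    · have := h (Fin.cons φ χ)
      rwa [pairing_succ, Fin.tail_cons, Fin.cons_zero] at this

/-! #### Elements supported on a subspace -/

/-- The forms outside `S` leave at most `d` dimensions for `x`, whose degree is larger. The
induction hypothesis is used twice: for the contraction of `x` with `χ 0`, then for `x` itself once
`χ 0` has joined `S`. -/
theorem eq_zero_of_lt {d : ℕ} {S : Submodule ℂ (Module.Dual ℂ V)} {χ : Fin d → Module.Dual ℂ V}
    (h : S ⊔ Submodule.span ℂ (Set.range χ) = ⊤) {l : ℕ} (hl : d < l) {x : ExteriorAlgebra ℂ V}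
    (hx : dGamma 1 x = (l : ℂ) • x) (hS : ∀ φ ∈ S, annih φ x = 0) : x = 0 := by
  induction d generalizing S l x with
  | zero =>
    refine eq_zero_of_annih_eq_zero (Nat.cast_ne_zero.2 (by omega : l ≠ 0)) hx fun φ => hS φ ?_
    rw [Set.range_eq_empty, Submodule.span_empty, sup_bot_eq] at h
    rw [h]; trivial
  | succ d ih =>
    have h' := sup_span_tail h
    have h0 : annih (χ 0) x = 0 := by
      refine ih h' (l := l - 1) (by omega) ?_ (annih_sup_span_singleton (fun φ hφ => ?_) ?_)
      · rw [dGamma_one_annih hx, Nat.cast_sub (by omega), Nat.cast_one]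
      · rw [annih_anticomm, hS φ hφ]; simp
      · exact annih_annih_self _ _
    exact ih h' (by omega) hx (annih_sup_span_singleton hS h0)

/-- In top degree a single number determines the element. If it is zero, contraction with `χ 0`
kills `x`, and then the degree exceeds the room left. -/
theorem eq_zero_of_pairing {d : ℕ} {S : Submodule ℂ (Module.Dual ℂ V)}
    {χ : Fin d → Module.Dual ℂ V} (h : S ⊔ Submodule.span ℂ (Set.range χ) = ⊤)
    {x : ExteriorAlgebra ℂ V} (hx : dGamma 1 x = (d : ℂ) • x) (hS : ∀ φ ∈ S, annih φ x = 0)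
    (h0 : pairing χ x = 0) : x = 0 := by
  induction d generalizing S x with
  | zero =>
    rw [eq_algebraMap_of_dGamma_one_eq_zero (x := x) (by simpa using hx)]
    rw [pairing_zero] at h0
    rw [h0, map_zero]
  | succ d ih =>
    have h' := sup_span_tail h
    have hz : annih (χ 0) x = 0 := by
      refine ih h' ?_ (annih_sup_span_singleton (fun φ hφ => ?_) ?_) h0
      · rw [dGamma_one_annih hx]; simp
      · rw [annih_anticomm, hS φ hφ]; simp
      · exact annih_annih_self _ _
    exact eq_zero_of_lt h' (Nat.lt_succ_self d) hx (annih_sup_span_singleton hS hz)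

theorem exists_sup_span_eq_top (W : Submodule ℂ V) :
    ∃ χ : Fin (Module.finrank ℂ W) → Module.Dual ℂ V,
      W.dualAnnihilator ⊔ Submodule.span ℂ (Set.range χ) = ⊤ := by
  obtain ⟨Q, hQ⟩ := Submodule.exists_isCompl W.dualAnnihilator
  have h1 := Subspace.finrank_add_finrank_dualAnnihilator_eq W
  have h2 := Submodule.finrank_add_eq_of_isCompl hQ
  rw [Subspace.dual_finrank_eq] at h2
  have h3 : Module.finrank ℂ Q = Module.finrank ℂ W := by omega
  let e := Module.finBasisOfFinrankEq ℂ Q h3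
  refine ⟨fun i => (e i : Module.Dual ℂ V), ?_⟩
  have : Submodule.span ℂ (Set.range fun i => (e i : Module.Dual ℂ V)) = Q := by
    have := congrArg (Submodule.map Q.subtype) e.span_eq
    rw [Submodule.map_span, ← Set.range_comp] at this
    simpa [Function.comp_def] using this
  rw [this]
  exact hQ.sup_eq_top

/-- Elements of degree `l` of the exterior algebra of the subspace `W`, inside that of `V`. -/
def IsSupported (W : Submodule ℂ V) (l : ℕ) (x : ExteriorAlgebra ℂ V) : Prop :=
  dGamma 1 x = (l : ℂ) • x ∧ ∀ φ ∈ W.dualAnnihilator, annih φ x = 0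

theorem IsSupported.le_finrank {W : Submodule ℂ V} {l : ℕ} {x : ExteriorAlgebra ℂ V}
    (h : IsSupported W l x) (hx : x ≠ 0) : l ≤ Module.finrank ℂ W := by
  by_contra! hl
  obtain ⟨χ, hχ⟩ := exists_sup_span_eq_top W
  exact hx (eq_zero_of_lt hχ hl h.1 h.2)

/-- The top exterior power of `W` is a line, with coordinate the pairing with forms complementary to
the annihilator of `W`. -/
theorem IsSupported.exists_eq_smul {W : Submodule ℂ V} {l : ℕ} (hl : Module.finrank ℂ W = l)
    {x x' : ExteriorAlgebra ℂ V} (h : IsSupported W l x) (hx : x ≠ 0) (h' : IsSupported W l x') :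
    ∃ c : ℂ, x' = c • x := by
  subst hl
  obtain ⟨χ, hχ⟩ := exists_sup_span_eq_top W
  have hne : pairing χ x ≠ 0 := fun h0 => hx (eq_zero_of_pairing hχ h.1 h.2 h0)
  refine ⟨pairing χ x' / pairing χ x, ?_⟩
  rw [← sub_eq_zero]
  refine eq_zero_of_pairing hχ ?_ (fun φ hφ => ?_) ?_
  · rw [map_sub, map_smul, h.1, h'.1, smul_sub, smul_comm]
  · rw [map_sub, map_smul, h.2 φ hφ, h'.2 φ hφ]; simp
  · rw [map_sub, map_smul, smul_eq_mul, div_mul_cancel₀ _ hne, sub_self]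

theorem IsSupported.dGamma {W : Submodule ℂ V} {l : ℕ} {x : ExteriorAlgebra ℂ V}
    (h : IsSupported W l x) {S : Module.End ℂ V} (hS : ∀ w ∈ W, S w ∈ W) :
    IsSupported W l (dGamma S x) := by
  refine ⟨?_, fun φ hφ => ?_⟩
  · rw [dGamma_comm (Commute.one_left S), h.1, map_smul]
  · rw [annih_dGamma, h.2 φ hφ, h.2 (φ ∘ₗ S), map_zero, add_zero]
    rw [Submodule.mem_dualAnnihilator] at hφ ⊢
    exact fun w hw => hφ _ (hS w hw)

theorem isSupported_ιMulti {W : Submodule ℂ V} {l : ℕ} (v : Fin l → V) (hv : ∀ i, v i ∈ W) :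
    IsSupported W l (ιMulti ℂ l v) := by
  induction l with
  | zero => exact ⟨by simp, fun φ _ => by simp⟩
  | succ l ih =>
    obtain ⟨h1, h2⟩ := ih (fun i => v i.succ) fun i => hv _
    rw [ιMulti_succ_apply]
    refine ⟨?_, fun φ hφ => ?_⟩
    · exact (dGamma_one_ι_mul h1 _).trans (by push_cast; rfl)
    · have := h2 φ hφ
      rw [annih_ι_mul, (Submodule.mem_dualAnnihilator φ).1 hφ _ (hv 0)]
      erw [this]; simp

/-- The wedge product of a basis of `W`. -/
theorem exists_isSupported (W : Submodule ℂ V) {l : ℕ} (hl : Module.finrank ℂ W = l) :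
    ∃ x : ExteriorAlgebra ℂ V, x ≠ 0 ∧ IsSupported W l x := by
  let e := Module.finBasisOfFinrankEq ℂ W hl
  let v : Fin l → V := fun i => e i
  have hv : LinearIndependent ℂ v :=
    e.linearIndependent.map' W.subtype (Submodule.ker_subtype W)
  let s : Set.powersetCard (Fin l) l := ⟨Finset.univ, by simp [Set.powersetCard]⟩
  have h0 := (exteriorPower.ιMulti_family_linearIndependent_field (n := l) hv).ne_zero s
  refine ⟨_, fun h => h0 (Subtype.ext h), ?_⟩
  exact isSupported_ιMulti _ fun i => (e _).2

end dGamma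

end Fock

/-! ### Functionals on polynomials that are eigenvectors of the symmetric polynomials -/

section Symmetric

open MvPolynomial

/-- Linear forms on polynomials in `l` variables on which the power sums act by the scalars `p`. -/
def PsumEigen {l : ℕ} (p : ℕ → ℂ) (L : MvPolynomial (Fin l) ℂ →ₗ[ℂ] ℂ) : Prop :=
  ∀ r q, L (psum (Fin l) ℂ r * q) = p r * L q

theorem linear_neg_one_pow_mul {l : ℕ} (L : MvPolynomial (Fin l) ℂ →ₗ[ℂ] ℂ) (k : ℕ)
    (q : MvPolynomial (Fin l) ℂ) : L ((-1) ^ k * q) = (-1) ^ k * L q := by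
  rcases neg_one_pow_eq_or (MvPolynomial (Fin l) ℂ) k with h | h <;>
    rcases Nat.even_or_odd k with h' | h' <;> simp [h'.neg_one_pow]

theorem linear_natCast_mul {l : ℕ} (L : MvPolynomial (Fin l) ℂ →ₗ[ℂ] ℂ) (k : ℕ)
    (q : MvPolynomial (Fin l) ℂ) : L (k * q) = k * L q := by
  rw [← nsmul_eq_mul, map_nsmul, nsmul_eq_mul]

/-- Newton's identities express k·e_k through power sums and lower e_j. The scalar depends only on
`p`, so it serves all functionals `L` at once. -/
theorem exists_esymm_eigen {l : ℕ} (p : ℕ → ℂ) (k : ℕ) :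
    ∃ c : ℂ, ∀ L : MvPolynomial (Fin l) ℂ →ₗ[ℂ] ℂ, PsumEigen p L →
      ∀ q, L (esymm (Fin l) ℂ k * q) = c * L q := by
  induction k using Nat.strong_induction_on with
  | _ k ih =>
    choose! e he using ih
    rcases Nat.eq_zero_or_pos k with rfl | hk
    · exact ⟨1, fun L _ q => by simp⟩
    · refine ⟨(k : ℂ)⁻¹ * ((-1) ^ (k + 1) * ∑ a ∈ Finset.HasAntidiagonal.antidiagonal k with a.1 < k,
        (-1) ^ a.1 * e a.1 * p a.2), fun L hL q => ?_⟩
      have hk' : (k : ℂ) ≠ 0 := by exact_mod_cast hk.ne'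
      have h := congrArg (fun P => L (P * q)) (mul_esymm_eq_sum (Fin l) ℂ k)
      simp only [mul_assoc, Finset.sum_mul, linear_neg_one_pow_mul, map_sum,
        linear_natCast_mul] at h
      rw [mul_assoc, eq_inv_mul_iff_mul_eq₀ hk', h, mul_assoc, Finset.sum_mul]
      congr 1
      refine Finset.sum_congr rfl fun a ha => ?_
      rw [he _ (Finset.mem_filter.1 ha).2 L hL, hL]
      ring

/-- Newton's identities in the opposite direction, applied both to the variables and to the point
`a`. -/
theorem psum_eigen_of_esymm_eigen {l : ℕ} {a : Fin l → ℂ} {L : MvPolynomial (Fin l) ℂ →ₗ[ℂ] ℂ}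
    (h : ∀ k q, L (esymm (Fin l) ℂ k * q) = aeval a (esymm (Fin l) ℂ k) * L q) (r : ℕ)
    (q : MvPolynomial (Fin l) ℂ) :
    L (psum (Fin l) ℂ r * q) = aeval a (psum (Fin l) ℂ r) * L q := by
  induction r using Nat.strong_induction_on generalizing q with
  | _ r ih =>
    rcases Nat.eq_zero_or_pos r with rfl | hr
    · simp [linear_natCast_mul]
    · rw [psum_eq_mul_esymm_sub_sum _ _ r hr]
      simp only [sub_mul, mul_assoc, Finset.sum_mul, linear_neg_one_pow_mul, map_sum, map_sub,
        linear_natCast_mul, map_mul, map_pow, map_neg, map_one, map_natCast, h]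
      congr 1
      refine Finset.sum_congr rfl fun b hb => ?_
      obtain ⟨hb1, hb2⟩ := Finset.mem_filter.1 hb
      rw [Finset.HasAntidiagonal.mem_antidiagonal] at hb1
      rw [ih b.2 (by have := hb2.1; omega)]

/-- If the power sums act by scalars on a linear form, then so do all symmetric polynomials,
through a point; the characteristic equation of the variables holds at that point. -/
theorem exists_point_of_psumEigen {l : ℕ} (p : ℕ → ℂ) :
    ∃ a : Fin l → ℂ, ∀ L : MvPolynomial (Fin l) ℂ →ₗ[ℂ] ℂ, PsumEigen p L →
      (∀ r q, p r * L q = (∑ i, a i ^ r) * L q) ∧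
      ∀ j, L (Polynomial.aeval (X j) (∏ i, (Polynomial.X - Polynomial.C (a i)))) = 0 := by
  choose e he using exists_esymm_eigen (l := l) p
  by_cases hL0 : ∀ L : MvPolynomial (Fin l) ℂ →ₗ[ℂ] ℂ, PsumEigen p L → L = 0
  · exact ⟨0, fun L hL => by simp [hL0 L hL]⟩
  push Not at hL0
  obtain ⟨L₀, hL₀, hne⟩ := hL0
  obtain ⟨q₀, hq₀⟩ : ∃ q, L₀ q ≠ 0 := by
    by_contra! h; exact hne (LinearMap.ext h)
  -- The scalars `e` were merely chosen; a nonzero functional is what pins down `e 0`, and with it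
  -- the leading coefficient of `y`.
  have he0 : e 0 = 1 := by
    have := he 0 L₀ hL₀ q₀
    simp only [esymm_zero, one_mul] at this
    exact (mul_right_cancel₀ hq₀ (by rw [one_mul]; exact this)).symm
  -- The polynomial whose roots should have the scalars `e` as elementary symmetric functions; the
  -- point `a` lists these roots with multiplicity.
  let y : ℂ[X] := ∑ j ∈ Finset.range (l + 1),
    Polynomial.C ((-1) ^ j * e j) * Polynomial.X ^ (l - j)
  have hcoeff : ∀ j ≤ l, y.coeff (l - j) = (-1) ^ j * e j := by
    intro j hj
    simp only [y, Polynomial.finsetSum_coeff, Polynomial.coeff_C_mul, Polynomial.coeff_X_pow]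
    rw [Finset.sum_eq_single j]
    · simp
    · intro i hi hij
      rw [if_neg, mul_zero]
      have := Finset.mem_range.1 hi
      omega
    · intro h; exact absurd (Finset.mem_range.2 (by omega)) h
  have hdeg : y.natDegree ≤ l := by
    refine Polynomial.natDegree_sum_le_of_forall_le _ _ fun j _ => ?_
    exact (Polynomial.natDegree_C_mul_X_pow_le _ _).trans (Nat.sub_le _ _)
  have hmon : y.Monic := Polynomial.monic_of_natDegree_le_of_coeff_eq_one l hdeg (by
    simpa [he0] using hcoeff 0 (Nat.zero_le l))
  have hnat : y.natDegree = l := le_antisymm hdeg (Polynomial.le_natDegree_of_ne_zero (by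
    have := hcoeff 0 (Nat.zero_le l); simp [he0] at this; simp [this]))
  have hsplit := IsAlgClosed.splits y
  have hcard : Multiset.card y.roots = l := by
    rw [← hsplit.natDegree_eq_card_roots, hnat]
  obtain ⟨a, ha⟩ : ∃ a : Fin l → ℂ, Finset.univ.val.map a = y.roots := by
    obtain ⟨s, hs⟩ := Quot.exists_rep y.roots
    have hs' : (s : Multiset ℂ) = y.roots := hs
    have hlen : s.length = l := by rw [← hcard, ← hs', Multiset.coe_card]
    subst hlen
    refine ⟨s.get, ?_⟩
    rw [← hs', Fin.univ_val_map, List.ofFn_get]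
  have hy : ∏ i, (Polynomial.X - Polynomial.C (a i)) = y := by
    conv_rhs => rw [hsplit.eq_prod_roots_of_monic hmon, ← ha]
    rw [Multiset.map_map]; rfl
  have hea : ∀ k ≤ l, aeval a (esymm (Fin l) ℂ k) = e k := by
    intro k hk
    have h1 := Multiset.prod_X_sub_C_coeff (Finset.univ.val.map a) (k := l - k) (by simp)
    have h2 : ((Finset.univ.val.map a).map fun t => Polynomial.X - Polynomial.C t).prod = y := by
      rw [← hy, Multiset.map_map]; rfl
    rw [h2, hcoeff k hk] at h1
    simp only [Multiset.card_map, Finset.card_val, Finset.card_univ, Fintype.card_fin,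
      Nat.sub_sub_self hk] at h1
    rw [aeval_esymm_eq_multiset_esymm]
    have := mul_left_cancel₀ (pow_ne_zero k (neg_ne_zero.2 one_ne_zero)) h1
    exact this.symm
  refine ⟨a, fun L hL => ⟨fun r q => ?_, fun j => ?_⟩⟩
  · rw [← hL r q]
    have := psum_eigen_of_esymm_eigen (a := a) (L := L) (fun k q => ?_) r q
    · rw [this]; simp [psum]
    · rcases le_or_gt k l with hk | hk
      · rw [he k L hL, hea k hk]
      · have h0 : esymm (Fin l) ℂ k = 0 := by
          rw [esymm, Finset.powersetCard_eq_empty.2 (by simpa using hk), Finset.sum_empty]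
        simp [h0]
  -- The variable `X j` is a root of ∏ (Z - X_i). Expanding in elementary symmetric polynomials and
  -- applying `L` replaces these by the scalars `e`, which leaves `L (y (X j))`.
  · have h1 := Multiset.prod_X_sub_X_eq_sum_esymm
      (Finset.univ.val.map (X : Fin l → MvPolynomial (Fin l) ℂ))
    have h2 := congrArg (Polynomial.eval (X j)) h1
    have h3 : Polynomial.eval (X j) (((Finset.univ.val.map
        (X : Fin l → MvPolynomial (Fin l) ℂ)).map fun t => Polynomial.X - Polynomial.C t).prod)
        = 0 := by
      simp only [Multiset.map_map, Function.comp_def]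
      change Polynomial.eval (X j) (∏ i, (Polynomial.X - Polynomial.C (X i))) = 0
      rw [Polynomial.eval_prod]
      exact Finset.prod_eq_zero (Finset.mem_univ j) (by simp)
    rw [h3] at h2
    rw [hy]
    have h4 : L (Polynomial.aeval (X j) y) = ∑ k ∈ Finset.range (l + 1),
        (-1) ^ k * (e k * L (X j ^ (l - k))) := by
      simp only [y, map_sum, map_mul, Polynomial.aeval_C, Polynomial.aeval_X, map_pow]
      refine Finset.sum_congr rfl fun k _ => ?_
      have : ((algebraMap ℂ (MvPolynomial (Fin l) ℂ)) (-1) ^ k * algebraMap ℂ _ (e k)) *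
          X j ^ (l - k) = ((-1) ^ k * e k) • X j ^ (l - k) := by
        rw [Algebra.smul_def]; simp
      rw [this, map_smul, smul_eq_mul, mul_assoc]
    rw [h4]
    have h5 := congrArg L h2
    rw [map_zero, Polynomial.eval_finsetSum, map_sum] at h5
    rw [h5]
    simp only [Multiset.card_map, Finset.card_val, Finset.card_univ, Fintype.card_fin]
    refine Finset.sum_congr rfl fun k _ => ?_
    rw [← he k L hL, ← linear_neg_one_pow_mul]
    simp [esymm_eq_multiset_esymm]

end Symmetric

namespace Fock

variable {V : Type*} [AddCommGroup V] [Module ℂ V]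

/-! ### Cyclic endomorphisms of a hyperplane -/

/-- The kernel of `y(T)` on the kernel of the linear form `f`. -/
def kerOn (T : Module.End ℂ V) (f : Module.Dual ℂ V) (y : ℂ[X]) : Submodule ℂ V :=
  LinearMap.ker f ⊓ LinearMap.ker (aeval T y)

/-- `β` identifies the kernel of the linear form `f`, with the action of `T`, with `ℂ[X]/(ψ)`. -/
structure IsCyclic (T : Module.End ℂ V) (f : Module.Dual ℂ V) (ψ : ℂ[X])
    (β : ℂ[X] →ₗ[ℂ] V) : Prop where
  ne_zero : ψ ≠ 0
  map_X_mul : ∀ g, β (X * g) = T (β g)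
  map_eq_zero : ∀ g, β g = 0 ↔ ψ ∣ g
  range_eq : LinearMap.range β = LinearMap.ker f

namespace IsCyclic

variable {T : Module.End ℂ V} {f : Module.Dual ℂ V} {ψ : ℂ[X]} {β : ℂ[X] →ₗ[ℂ] V}

theorem map_mul (h : IsCyclic T f ψ β) (y g : ℂ[X]) : β (y * g) = aeval T y (β g) := by
  induction y using Polynomial.induction_on' with
  | add y z hy hz => rw [add_mul, map_add, hy, hz, map_add, LinearMap.add_apply]
  | monomial k c =>
    rw [← smul_X_eq_monomial, smul_mul_assoc, map_smul, map_smul, LinearMap.smul_apply]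
    congr 1
    induction k with
    | zero => simp
    | succ k ih => rw [pow_succ', mul_assoc, h.map_X_mul, ih]; simp

theorem mem_kerOn (h : IsCyclic T f ψ β) (y : ℂ[X]) (v : V) :
    v ∈ kerOn T f y ↔ ∃ g, ψ ∣ y * g ∧ β g = v := by
  constructor
  · rintro ⟨h1, h2⟩
    rw [← h.range_eq] at h1
    obtain ⟨g, rfl⟩ := h1
    exact ⟨g, (h.map_eq_zero _).1 (by rw [h.map_mul]; exact h2), rfl⟩
  · rintro ⟨g, hg, rfl⟩
    refine ⟨h.range_eq ▸ LinearMap.mem_range_self β g, ?_⟩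
    change aeval T y (β g) = 0
    rw [← h.map_mul]
    exact (h.map_eq_zero _).2 hg

/-- In ℂ[X]/(dq) the kernel of dy consists of the multiples of q, because y is invertible modulo q.
These multiples form a copy of ℂ[X]/(d). -/
theorem finrank_kerOn_of_isCoprime (h : IsCyclic T f ψ β) {d y q : ℂ[X]} (hq : ψ = d * q)
    (hyq : IsCoprime y q) : Module.finrank ℂ (kerOn T f (d * y)) = d.natDegree := by
  have hd : d ≠ 0 := fun h0 => h.ne_zero (by rw [hq, h0, zero_mul])
  have hq0 : q ≠ 0 := fun h0 => h.ne_zero (by rw [hq, h0, mul_zero])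
  let θ : degreeLT ℂ d.natDegree →ₗ[ℂ] V := β ∘ₗ LinearMap.mulLeft ℂ q ∘ₗ Submodule.subtype _
  have hθ : ∀ g, θ g = β (q * g) := fun g => rfl
  have hinj : Function.Injective θ := by
    rw [← LinearMap.ker_eq_bot, LinearMap.ker_eq_bot']
    intro g hg
    rw [hθ, h.map_eq_zero, hq, mul_comm d, mul_dvd_mul_iff_left hq0] at hg
    by_contra hne
    have h1 : (g : ℂ[X]) ≠ 0 := fun h0 => hne (Subtype.ext h0)
    have h2 := degree_le_of_dvd hg h1
    have h3 := mem_degreeLT.1 g.2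
    rw [degree_eq_natDegree hd] at h2
    exact absurd (h2.trans_lt h3) (lt_irrefl _)
  have hrange : LinearMap.range θ = kerOn T f (d * y) := by
    ext v
    rw [h.mem_kerOn]
    constructor
    · rintro ⟨g, rfl⟩
      exact ⟨q * g, ⟨y * g, by rw [hq]; ring⟩, rfl⟩
    · rintro ⟨g, hg, rfl⟩
      rw [hq, mul_assoc, mul_dvd_mul_iff_left hd] at hg
      obtain ⟨k, rfl⟩ := hyq.symm.dvd_of_dvd_mul_left hg
      refine ⟨⟨k % d, mem_degreeLT.2 ?_⟩, ?_⟩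
      · rw [← degree_eq_natDegree hd]
        exact EuclideanDomain.mod_lt k hd
      · rw [hθ, ← sub_eq_zero, ← map_sub, h.map_eq_zero, hq]
        refine ⟨-(k / d), ?_⟩
        have := EuclideanDomain.div_add_mod k d
        linear_combination q * this
  rw [← hrange, LinearMap.finrank_range_of_inj hinj, (degreeLTEquiv ℂ _).finrank_eq]
  simp

/-- The divisor is gcd(y, ψ). -/
theorem exists_finrank_kerOn (h : IsCyclic T f ψ β) (y : ℂ[X]) :
    ∃ d, d ∣ y ∧ d ∣ ψ ∧ Module.finrank ℂ (kerOn T f y) = d.natDegree := by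
  obtain ⟨y', hy⟩ := EuclideanDomain.gcd_dvd_left y ψ
  obtain ⟨q, hq⟩ := EuclideanDomain.gcd_dvd_right y ψ
  have hcop : IsCoprime y' q := by
    have hg : EuclideanDomain.gcd y ψ ≠ 0 := fun h0 => h.ne_zero (by rw [hq, h0, zero_mul])
    refine ⟨EuclideanDomain.gcdA y ψ, EuclideanDomain.gcdB y ψ, mul_left_cancel₀ hg ?_⟩
    have := EuclideanDomain.gcd_eq_gcd_ab y ψ
    linear_combination -this - EuclideanDomain.gcdA y ψ * hy - EuclideanDomain.gcdB y ψ * hq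
  refine ⟨_, EuclideanDomain.gcd_dvd_left y ψ, EuclideanDomain.gcd_dvd_right y ψ, ?_⟩
  rw [← h.finrank_kerOn_of_isCoprime hq hcop, ← hy]

theorem finrank_kerOn_le (h : IsCyclic T f ψ β) {y : ℂ[X]} (hy : y ≠ 0) :
    Module.finrank ℂ (kerOn T f y) ≤ y.natDegree := by
  obtain ⟨d, hd, -, hf⟩ := h.exists_finrank_kerOn y
  exact hf ▸ natDegree_le_of_dvd hd hy

/-- The gcd of y and ψ then has the full degree of y, so it is associated to y. -/
theorem dvd_of_le_finrank_kerOn (h : IsCyclic T f ψ β) {y : ℂ[X]} (hy : y ≠ 0)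
    (hle : y.natDegree ≤ Module.finrank ℂ (kerOn T f y)) : y ∣ ψ := by
  obtain ⟨d, hd, hdψ, hf⟩ := h.exists_finrank_kerOn y
  have : Associated d y := associated_of_dvd_of_natDegree_le hd hy (by omega)
  exact this.dvd_iff_dvd_left.1 hdψ

theorem finrank_kerOn_of_dvd (h : IsCyclic T f ψ β) {y : ℂ[X]} (hy : y ∣ ψ) :
    Module.finrank ℂ (kerOn T f y) = y.natDegree := by
  obtain ⟨q, hq⟩ := hy
  have := h.finrank_kerOn_of_isCoprime hq (y := 1) isCoprime_one_left
  rwa [mul_one] at this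

end IsCyclic

/-! ### Joint eigenvectors of the derivations extending the powers of an endomorphism -/

theorem pairing_update_add {l : ℕ} (φ : Fin l → Module.Dual ℂ V) (x : ExteriorAlgebra ℂ V)
    (T : Module.End ℂ V) (s : Fin l →₀ ℕ) (i : Fin l) (r : ℕ) :
    pairing (Function.update (fun j => φ j ∘ₗ T ^ s j) i ((φ i ∘ₗ T ^ s i) ∘ₗ T ^ r)) x
      = pairing (fun j => φ j ∘ₗ T ^ (s + Finsupp.single i r) j) x := by
  congr 2
  funext j
  by_cases h : j = i
  · subst h
    rw [Function.update_self]
    simp [pow_add, Module.End.mul_eq_comp, LinearMap.comp_assoc]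
  · rw [Function.update_of_ne h]
    simp [Finsupp.single_eq_of_ne h]

/-- The linear form `X^s ↦ x(φ₁ T^{s₁}, …, φ_l T^{s_l})` on polynomials in `l` variables. -/
def polyForm (T : Module.End ℂ V) {l : ℕ} (φ : Fin l → Module.Dual ℂ V)
    (x : ExteriorAlgebra ℂ V) : MvPolynomial (Fin l) ℂ →ₗ[ℂ] ℂ :=
  (MvPolynomial.basisMonomials (Fin l) ℂ).constr ℂ fun s =>
    pairing (fun i => φ i ∘ₗ T ^ s i) x

theorem polyForm_monomial (T : Module.End ℂ V) {l : ℕ} (φ : Fin l → Module.Dual ℂ V)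
    (x : ExteriorAlgebra ℂ V) (s : Fin l →₀ ℕ) :
    polyForm T φ x (MvPolynomial.monomial s 1) = pairing (fun i => φ i ∘ₗ T ^ s i) x := by
  have := (MvPolynomial.basisMonomials (Fin l) ℂ).constr_basis ℂ
    (fun s : Fin l →₀ ℕ => pairing (fun i => φ i ∘ₗ T ^ s i) x) s
  rwa [MvPolynomial.coe_basisMonomials] at this

theorem polyForm_aeval (T : Module.End ℂ V) {l : ℕ} (φ : Module.Dual ℂ V)
    (χ : Fin l → Module.Dual ℂ V) (x : ExteriorAlgebra ℂ V) (y : ℂ[X]) :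
    polyForm T (Fin.cons φ χ : Fin (l + 1) → Module.Dual ℂ V) x
        (aeval (MvPolynomial.X 0 : MvPolynomial (Fin (l + 1)) ℂ) y)
      = pairing χ (annih (φ ∘ₗ aeval T y) x) := by
  induction y using Polynomial.induction_on' with
  | add y z hy hz =>
    rw [map_add, map_add, hy, hz, map_add, LinearMap.comp_add, annih_add, LinearMap.add_apply,
      map_add]
  | monomial k c =>
    rw [aeval_monomial, aeval_monomial, ← Algebra.smul_def, ← Algebra.smul_def, map_smul,
      MvPolynomial.X_pow_eq_monomial, polyForm_monomial, LinearMap.comp_smul, annih_smul,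
      LinearMap.smul_apply, map_smul, pairing_succ]
    congr 3
    · funext i
      simp [Fin.tail, Module.End.one_eq_id]
    · simp

variable [FiniteDimensional ℂ V]

/-- By `pairing_dGamma`, applying `dGamma (T ^ r)` to `x` multiplies the argument of `polyForm` by
the power sum ∑ X_i^r. -/
theorem psumEigen_polyForm {T : Module.End ℂ V} {p : ℕ → ℂ} {x : ExteriorAlgebra ℂ V}
    (h : ∀ r, dGamma (T ^ r) x = p r • x) {l : ℕ} (φ : Fin l → Module.Dual ℂ V) :
    PsumEigen p (polyForm T φ x) := by
  intro r q
  induction q using MvPolynomial.induction_on' with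
  | monomial s c =>
    have hc : MvPolynomial.monomial s c = c • MvPolynomial.monomial s (1 : ℂ) := by
      rw [MvPolynomial.smul_monomial, smul_eq_mul, mul_one]
    have hX : ∀ i : Fin l, MvPolynomial.X i ^ r * MvPolynomial.monomial s (1 : ℂ)
        = MvPolynomial.monomial (s + Finsupp.single i r) 1 := by
      intro i
      rw [MvPolynomial.X_pow_eq_monomial, MvPolynomial.monomial_mul, one_mul, add_comm]
    have hd := pairing_dGamma (T ^ r) (fun i => φ i ∘ₗ T ^ s i) x
    rw [h r, map_smul, smul_eq_mul] at hd
    rw [hc, mul_smul_comm, map_smul, map_smul, polyForm_monomial, smul_eq_mul, smul_eq_mul,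
      mul_left_comm, hd, MvPolynomial.psum, Finset.sum_mul, map_sum]
    congr 1
    refine Finset.sum_congr rfl fun i _ => ?_
    rw [hX, polyForm_monomial, pairing_update_add]
  | add a b ha hb => rw [mul_add, map_add, map_add, ha, hb, mul_add]

/-- The order of quantifiers matters: the point depends on the eigenvalues and the degree only, so
two eigenvectors with the same eigenvalues are supported on the same subspace. -/
theorem exists_point_of_eigen (T : Module.End ℂ V) (p : ℕ → ℂ) (l : ℕ) :
    ∃ a : Fin l → ℂ, ∀ x : ExteriorAlgebra ℂ V, x ≠ 0 → dGamma 1 x = (l : ℂ) • x →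
      (∀ r, dGamma (T ^ r) x = p r • x) →
      (∀ r, p r = ∑ i, a i ^ r) ∧
      ∀ φ, annih (φ ∘ₗ aeval T (∏ i, (X - C (a i)))) x = 0 := by
  obtain ⟨a, ha⟩ := exists_point_of_psumEigen (l := l) p
  refine ⟨a, fun x hx hl h => ⟨fun r => ?_, fun φ => ?_⟩⟩
  · obtain ⟨φ, hφ⟩ : ∃ φ : Fin l → Module.Dual ℂ V, pairing φ x ≠ 0 := by
      by_contra! h0
      exact hx (eq_zero_of_pairing_eq_zero hl h0)
    have h1 := (ha _ (psumEigen_polyForm h φ)).1 r (MvPolynomial.monomial 0 1)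
    refine mul_right_cancel₀ ?_ h1
    rw [polyForm_monomial]
    simpa [Module.End.one_eq_id] using hφ
  · cases l with
    | zero =>
      rw [eq_algebraMap_of_dGamma_one_eq_zero (x := x) (by simpa using hl),
        Algebra.algebraMap_eq_smul_one]
      simp
    | succ l =>
      refine eq_zero_of_pairing_eq_zero (l := l) ?_ fun χ => ?_
      · rw [dGamma_one_annih hl]; simp
      · rw [← polyForm_aeval]
        exact (ha _ (psumEigen_polyForm h _)).2 0

/-- The annihilator of the kernel of v ↦ (f v, y(T) v) is the range of its transpose, so it is made
of multiples of f plus forms φ ∘ y(T). -/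
theorem isSupported_kerOn {T : Module.End ℂ V} {f : Module.Dual ℂ V} {y : ℂ[X]} {l : ℕ}
    {x : ExteriorAlgebra ℂ V} :
    IsSupported (kerOn T f y) l x ↔ dGamma 1 x = (l : ℂ) • x ∧ annih f x = 0 ∧
      ∀ φ, annih (φ ∘ₗ aeval T y) x = 0 := by
  refine and_congr_right fun _ => ⟨fun h => ⟨h _ ?_, fun φ => h _ ?_⟩, fun h φ hφ => ?_⟩
  · rw [Submodule.mem_dualAnnihilator]
    exact fun w hw => hw.1
  · rw [Submodule.mem_dualAnnihilator]
    intro w hw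
    rw [LinearMap.comp_apply, LinearMap.mem_ker.1 hw.2, map_zero]
  · have hk : kerOn T f y = LinearMap.ker (f.prod (aeval T y)) := (LinearMap.ker_prod _ _).symm
    rw [hk, ← LinearMap.range_dualMap_eq_dualAnnihilator_ker] at hφ
    obtain ⟨χ, rfl⟩ := hφ
    have : (f.prod (aeval T y)).dualMap χ
        = χ (1, 0) • f + (χ ∘ₗ LinearMap.inr ℂ ℂ V) ∘ₗ aeval T y := by
      ext v
      have : (f v, aeval T y v) = f v • ((1 : ℂ), (0 : V)) + (0, aeval T y v) := by simp
      simp only [LinearMap.dualMap_apply, LinearMap.prod_apply, Function.prod_apply, LinearMap.add_apply,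
        LinearMap.smul_apply, LinearMap.comp_apply, LinearMap.inr_apply, smul_eq_mul]
      rw [this, map_add, map_smul, smul_eq_mul, mul_comm]
    rw [this, annih_add, annih_smul, LinearMap.add_apply, LinearMap.smul_apply, h.1, h.2]
    simp

/-! ### Classification of joint eigenvectors for a cyclic endomorphism -/

namespace IsCyclic

variable {T : Module.End ℂ V} {f : Module.Dual ℂ V} {ψ : ℂ[X]} {β : ℂ[X] →ₗ[ℂ] V}

/-- An element of the exterior algebra is supported on at most one of the subspaces `ker y(T)`
with `deg y` the degree of the element. -/
theorem eq_of_isSupported (h : IsCyclic T f ψ β) {y z : ℂ[X]} (hy : y.Monic) (hz : z.Monic)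
    {x : ExteriorAlgebra ℂ V} (hx : x ≠ 0) (h1 : IsSupported (kerOn T f y) y.natDegree x)
    (h2 : IsSupported (kerOn T f z) z.natDegree x) : y = z := by
  have hdeg : y.natDegree = z.natDegree := by
    have := h1.1.symm.trans h2.1
    exact_mod_cast smul_left_injective ℂ hx this
  rw [isSupported_kerOn] at h1 h2
  set g := EuclideanDomain.gcd y z with hg
  have hg0 : g ≠ 0 := fun h0 => hy.ne_zero (EuclideanDomain.gcd_eq_zero_iff.1 h0).1
  -- By Bézout, forms factoring through `g(T)` are sums of forms factoring through `y(T)` and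
  -- `z(T)`. Support on so small a kernel forces deg g ≥ deg y.
  have hs : IsSupported (kerOn T f g) y.natDegree x := by
    rw [isSupported_kerOn]
    refine ⟨h1.1, h1.2.1, fun φ => ?_⟩
    have : φ ∘ₗ aeval T g = (φ ∘ₗ aeval T (EuclideanDomain.gcdA y z)) ∘ₗ aeval T y
        + (φ ∘ₗ aeval T (EuclideanDomain.gcdB y z)) ∘ₗ aeval T z := by
      rw [hg, EuclideanDomain.gcd_eq_gcd_ab, mul_comm y, mul_comm z, map_add, _root_.map_mul,
        _root_.map_mul, LinearMap.comp_add]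
      rfl
    rw [this, annih_add, LinearMap.add_apply, h1.2.2, h2.2.2, add_zero]
  have hle := (hs.le_finrank hx).trans (h.finrank_kerOn_le hg0)
  have a1 : Associated g y := associated_of_dvd_of_natDegree_le
    (EuclideanDomain.gcd_dvd_left y z) hy.ne_zero hle
  have a2 : Associated g z := associated_of_dvd_of_natDegree_le
    (EuclideanDomain.gcd_dvd_right y z) hz.ne_zero (hdeg ▸ hle)
  exact eq_of_monic_of_associated hy hz (a1.symm.trans a2)

theorem roots_prod_sum {l : ℕ} (a : Fin l → ℂ) (r : ℕ) :
    ((∏ i, (X - C (a i))).roots.map (· ^ r)).sum = ∑ i, a i ^ r := by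
  have h : ∏ i, (X - C (a i)) = ((Finset.univ.val.map a).map fun t => X - C t).prod := by
    rw [Multiset.map_map]; rfl
  rw [h, roots_multiset_prod_X_sub_C, Multiset.map_map]
  rfl

/-- Joint eigenvectors are supported on the kernel of a divisor of `ψ`. -/
theorem exists_divisor (h : IsCyclic T f ψ β) {x : ExteriorAlgebra ℂ V} (hx : x ≠ 0)
    (hf : annih f x = 0) {p : ℕ → ℂ} (hp : ∀ r, dGamma (T ^ r) x = p r • x) :
    ∃ y : ℂ[X], y.Monic ∧ y ∣ ψ ∧ (∀ r, p r = (y.roots.map (· ^ r)).sum) ∧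
      IsSupported (kerOn T f y) y.natDegree x := by
  obtain ⟨l, hl⟩ := exists_nat_of_dGamma_one hx (by simpa using hp 0)
  have hdeg : dGamma 1 x = (l : ℂ) • x := by rw [← hl]; simpa using hp 0
  obtain ⟨a, ha⟩ := exists_point_of_eigen T p l
  obtain ⟨h1, h2⟩ := ha x hx hdeg hp
  have hmon : (∏ i, (X - C (a i))).Monic := monic_prod_of_monic _ _ fun i _ => monic_X_sub_C _
  have hnat : (∏ i, (X - C (a i))).natDegree = l := by
    rw [natDegree_prod_of_monic _ _ fun i _ => monic_X_sub_C _]; simp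
  have hs : IsSupported (kerOn T f (∏ i, (X - C (a i)))) l x :=
    isSupported_kerOn.2 ⟨hdeg, hf, h2⟩
  refine ⟨_, hmon, ?_, fun r => by rw [h1, roots_prod_sum], hnat.symm ▸ hs⟩
  exact h.dvd_of_le_finrank_kerOn hmon.ne_zero (hnat.trans_le (hs.le_finrank hx))

/-- Joint eigenvectors with the same eigenvalues are proportional. -/
theorem exists_eq_smul (h : IsCyclic T f ψ β) {x x' : ExteriorAlgebra ℂ V} (hx : x ≠ 0)
    (hx' : x' ≠ 0) (hf : annih f x = 0) (hf' : annih f x' = 0) {p : ℕ → ℂ}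
    (hp : ∀ r, dGamma (T ^ r) x = p r • x) (hp' : ∀ r, dGamma (T ^ r) x' = p r • x') :
    ∃ c : ℂ, x' = c • x := by
  obtain ⟨l, hl⟩ := exists_nat_of_dGamma_one hx (by simpa using hp 0)
  have hdeg : dGamma 1 x = (l : ℂ) • x := by rw [← hl]; simpa using hp 0
  have hdeg' : dGamma 1 x' = (l : ℂ) • x' := by rw [← hl]; simpa using hp' 0
  obtain ⟨a, ha⟩ := exists_point_of_eigen T p l
  have hmon : (∏ i, (X - C (a i))).Monic := monic_prod_of_monic _ _ fun i _ => monic_X_sub_C _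
  have hnat : (∏ i, (X - C (a i))).natDegree = l := by
    rw [natDegree_prod_of_monic _ _ fun i _ => monic_X_sub_C _]; simp
  have hs : IsSupported (kerOn T f (∏ i, (X - C (a i)))) l x :=
    isSupported_kerOn.2 ⟨hdeg, hf, (ha x hx hdeg hp).2⟩
  refine hs.exists_eq_smul (le_antisymm ?_ (hs.le_finrank hx)) hx
    (isSupported_kerOn.2 ⟨hdeg', hf', (ha x' hx' hdeg' hp').2⟩)
  exact (h.finrank_kerOn_le hmon.ne_zero).trans_eq hnat

/-- Each divisor of `ψ` gives a joint eigenvector. -/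
theorem exists_eigenvector (h : IsCyclic T f ψ β) {y : ℂ[X]} (hy : y.Monic) (hyψ : y ∣ ψ) :
    ∃ x : ExteriorAlgebra ℂ V, x ≠ 0 ∧ IsSupported (kerOn T f y) y.natDegree x ∧
      ∀ r, dGamma (T ^ r) x = (y.roots.map (· ^ r)).sum • x := by
  have hfin := h.finrank_kerOn_of_dvd hyψ
  obtain ⟨x, hx, hs⟩ := exists_isSupported _ hfin
  have hT : ∀ r, ∀ w ∈ kerOn T f y, (T ^ r) w ∈ kerOn T f y := by
    intro r w hw
    obtain ⟨g, hg, rfl⟩ := (h.mem_kerOn y w).1 hw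
    refine (h.mem_kerOn y _).2 ⟨X ^ r * g, ?_, by rw [h.map_mul]; simp⟩
    rw [mul_left_comm]
    exact hg.mul_left _
  -- The top exterior power of `kerOn T f y` is a stable line, so `x` is an eigenvector with unknown
  -- eigenvalues `p`. The classification attaches a divisor `z` to them, and `z = y` since `x` has
  -- only one support of this kind.
  choose p hp using fun r => hs.exists_eq_smul hfin hx (hs.dGamma (hT r))
  obtain ⟨z, hz, -, hpz, hsz⟩ := h.exists_divisor hx (isSupported_kerOn.1 hs).2.1 hp
  obtain rfl := h.eq_of_isSupported hy hz hx hs hsz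
  exact ⟨x, hx, hs, fun r => by rw [hp, hpz]⟩

end IsCyclic

end Fock

/-! ### Sums over the roots of a polynomial and the hyperplane they define -/

/-- The power sums `∑ a ^ r` over the roots of a polynomial. -/
def rootPsum (η : ℂ[X]) (r : ℕ) : ℂ := (η.roots.map (· ^ r)).sum

/-- The sum of the values of `p` at the roots of `η`. -/
def rootSum (η : ℂ[X]) : ℂ[X] →ₗ[ℂ] ℂ where
  toFun p := (η.roots.map fun a => p.eval a).sum
  map_add' p q := by simp [Multiset.sum_map_add]
  map_smul' c p := by simp [Multiset.sum_map_mul_left]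

theorem rootSum_apply (η p : ℂ[X]) : rootSum η p = (η.roots.map fun a => p.eval a).sum := rfl

theorem rootSum_X_pow (η : ℂ[X]) (r : ℕ) : rootSum η (X ^ r) = rootPsum η r := by
  simp [rootSum_apply, rootPsum]

theorem rootSum_eq_zero_of_dvd {η p : ℂ[X]} (h : η ∣ p) : rootSum η p = 0 := by
  rw [rootSum_apply]
  refine Multiset.sum_eq_zero fun c hc => ?_
  obtain ⟨a, ha, rfl⟩ := Multiset.mem_map.1 hc
  exact (isRoot_of_mem_roots ha).dvd h

theorem eq_prod_roots {η : ℂ[X]} (hη : η.Monic) : η = (η.roots.map fun a => X - C a).prod :=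
  (IsAlgClosed.splits η).eq_prod_roots_of_monic hη

theorem card_roots_eq (η : ℂ[X]) : Multiset.card η.roots = η.natDegree :=
  (IsAlgClosed.splits η).natDegree_eq_card_roots.symm

/-- With θ the product, pθ'/θ = ∑ p(x)/(x - a), and p(x) = p(a) + (x - a)P_a(x). Hence G is the sum
of the P_a and h = ∑ p(a) θ/(x - a), whose coefficient below the degree of θ is the sum of the p(a).
For empty `s` the truncated index is 0 and both sides vanish. -/
theorem exists_mul_derivative_eq (p : ℂ[X]) (s : Multiset ℂ) :
    ∃ G h : ℂ[X], p * derivative (s.map fun a => X - C a).prod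
        = G * (s.map fun a => X - C a).prod + h ∧
      h.degree < (Multiset.card s : WithBot ℕ) ∧
      h.coeff (Multiset.card s - 1) = (s.map fun a => p.eval a).sum := by
  induction s using Multiset.induction_on with
  | empty => exact ⟨0, 0, by simp, by simp, by simp⟩
  | cons a s ih =>
    obtain ⟨G, h, h1, h2, h3⟩ := ih
    obtain ⟨P, hP⟩ : X - C a ∣ p - C (p.eval a) := X_sub_C_dvd_sub_C_eval
    set θ := (s.map fun a => X - C a).prod with hθ
    have hmon : θ.Monic := monic_multiset_prod_of_monic _ _ fun a _ => monic_X_sub_C a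
    have hdeg : θ.natDegree = Multiset.card s := natDegree_multiset_prod_X_sub_C_eq_card s
    have hcoeff : θ.coeff (Multiset.card s) = 1 := hdeg ▸ hmon.coeff_natDegree
    refine ⟨P + G, C (p.eval a) * θ + (X - C a) * h, ?_, ?_, ?_⟩
    · simp only [Multiset.map_cons, Multiset.prod_cons, ← hθ, derivative_mul, derivative_sub,
        derivative_X, derivative_C]
      linear_combination (X - C a) * h1 + θ * hP
    · rw [Multiset.card_cons]
      refine (degree_add_le _ _).trans_lt (max_lt ?_ ?_)
      · rw [← smul_eq_C_mul]
        refine (degree_smul_le _ _).trans_lt ?_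
        rw [degree_eq_natDegree hmon.ne_zero, hdeg]
        exact_mod_cast Nat.lt_succ_self _
      · rw [degree_mul, degree_X_sub_C]
        rcases eq_or_ne h 0 with rfl | hh
        · simp
        · rw [degree_eq_natDegree hh] at h2 ⊢
          have : h.natDegree < Multiset.card s := by exact_mod_cast h2
          exact_mod_cast (by omega : 1 + h.natDegree < Multiset.card s + 1)
    · have hh : h.coeff (Multiset.card s) = 0 := coeff_eq_zero_of_degree_lt h2
      rw [Multiset.card_cons, Nat.add_sub_cancel, coeff_add, coeff_C_mul, hcoeff, mul_one,
        Multiset.map_cons, Multiset.sum_cons, sub_mul, coeff_sub, coeff_C_mul, hh, mul_zero,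
        sub_zero]
      congr 1
      rcases Nat.eq_zero_or_pos (Multiset.card s) with h0 | h0
      · rw [h0, coeff_X_mul_zero]
        rw [Multiset.card_eq_zero] at h0
        simp [h0]
      · rw [← h3]
        conv_lhs => rw [← Nat.sub_add_cancel h0]
        exact coeff_X_mul _ _

/-- Uniqueness of division with remainder identifies `h` with the remainder of
`exists_mul_derivative_eq`. This replaces a residue at infinity of pη'/η. -/
theorem rootSum_eq_coeff {η : ℂ[X]} (hη : η.Monic) {p g h : ℂ[X]}
    (hp : p * derivative η = g * η + h) (hh : h.degree < η.degree) :
    rootSum η p = h.coeff (η.natDegree - 1) := by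
  obtain ⟨G, k, h1, h2, h3⟩ := exists_mul_derivative_eq p η.roots
  rw [← eq_prod_roots hη, card_roots_eq] at *
  rw [← degree_eq_natDegree hη.ne_zero] at h2
  have e1 := (div_modByMonic_unique (f := p * derivative η) g h hη ⟨by rw [hp]; ring, hh⟩).2
  have e2 := (div_modByMonic_unique (f := p * derivative η) G k hη ⟨by rw [h1]; ring, h2⟩).2
  rw [rootSum_apply, ← h3, ← e1, ← e2]

/-! ### The kernel of the trace form as the cyclic module ℂ[X]/(η') -/

section AdjoinRoot

variable {η : ℂ[X]} (hη : η.Monic)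

/-- A linear map on polynomials that vanishes on the multiples of `η`, as a map on `ℂ[X]/(η)`. -/
def liftAdjoin {W : Type*} [AddCommGroup W] [Module ℂ W] (g : ℂ[X] →ₗ[ℂ] W) :
    AdjoinRoot η →ₗ[ℂ] W :=
  g ∘ₗ AdjoinRoot.modByMonicHom hη

theorem liftAdjoin_mk {W : Type*} [AddCommGroup W] [Module ℂ W] {g : ℂ[X] →ₗ[ℂ] W}
    (hg : ∀ p, η ∣ p → g p = 0) (p : ℂ[X]) :
    liftAdjoin hη g (AdjoinRoot.mk η p) = g p := by
  rw [liftAdjoin, LinearMap.comp_apply, AdjoinRoot.modByMonicHom_mk, ← sub_eq_zero, ← map_sub]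
  refine hg _ ⟨-(p /ₘ η), ?_⟩
  have := modByMonic_add_div p η
  linear_combination this

/-- The linear form on `ℂ[X]/(η)` given by the sum over the roots of `η`. -/
def traceForm : Module.Dual ℂ (AdjoinRoot η) := liftAdjoin hη (rootSum η)

theorem traceForm_mk (p : ℂ[X]) : traceForm hη (AdjoinRoot.mk η p) = rootSum η p :=
  liftAdjoin_mk hη (fun _ h => rootSum_eq_zero_of_dvd h) p

theorem traceForm_one : traceForm hη 1 = η.natDegree := by
  rw [← map_one (AdjoinRoot.mk η), traceForm_mk, rootSum_apply]
  simp [card_roots_eq]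

/-- Multiplication by `X` on `ℂ[X]/(η)` followed by the projection onto the kernel of the trace
form along `1`. -/
def compression : Module.End ℂ (AdjoinRoot η) :=
  LinearMap.mulLeft ℂ (AdjoinRoot.root η) -
    ((η.natDegree : ℂ)⁻¹ • (traceForm hη ∘ₗ LinearMap.mulLeft ℂ (AdjoinRoot.root η))).smulRight 1

theorem compression_apply (v : AdjoinRoot η) : compression hη v = AdjoinRoot.root η * v -
    ((η.natDegree : ℂ)⁻¹ * traceForm hη (AdjoinRoot.root η * v)) • 1 := rfl

theorem finrank_adjoinRoot (h : η.Monic) : Module.finrank ℂ (AdjoinRoot η) = η.natDegree := by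
  rw [(AdjoinRoot.powerBasis' h).finrank]; rfl

theorem finiteDimensional_adjoinRoot (h : η.Monic) : FiniteDimensional ℂ (AdjoinRoot η) :=
  (AdjoinRoot.powerBasis' h).finite

theorem add_divByMonic {q : ℂ[X]} (hq : q.Monic) (f g : ℂ[X]) :
    (f + g) /ₘ q = f /ₘ q + g /ₘ q := by
  refine (div_modByMonic_unique (f /ₘ q + g /ₘ q) (f %ₘ q + g %ₘ q) hq ⟨?_, ?_⟩).1
  · have h1 := modByMonic_add_div f q
    have h2 := modByMonic_add_div g q
    linear_combination h1 + h2
  · exact (degree_add_le _ _).trans_lt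
      (max_lt (degree_modByMonic_lt _ hq) (degree_modByMonic_lt _ hq))

theorem smul_divByMonic {q : ℂ[X]} (hq : q.Monic) (c : ℂ) (f : ℂ[X]) :
    (c • f) /ₘ q = c • (f /ₘ q) := by
  refine (div_modByMonic_unique (c • (f /ₘ q)) (c • (f %ₘ q)) hq ⟨?_, ?_⟩).1
  · have h1 := modByMonic_add_div f q
    rw [mul_smul_comm, ← smul_add, h1]
  · exact (degree_smul_le _ _).trans_lt (degree_modByMonic_lt _ hq)

/-- The derivative of `η`, made monic. -/
def monicDeriv (η : ℂ[X]) : ℂ[X] := (η.natDegree : ℂ)⁻¹ • derivative η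

theorem derivative_eq_smul_monicDeriv (hN : η.natDegree ≠ 0) :
    derivative η = (η.natDegree : ℂ) • monicDeriv η := by
  rw [monicDeriv, smul_inv_smul₀ (Nat.cast_ne_zero.2 hN)]

theorem natDegree_monicDeriv_le : (monicDeriv η).natDegree ≤ η.natDegree - 1 :=
  (natDegree_smul_le _ _).trans (natDegree_derivative_le η)

theorem monic_monicDeriv (h : η.Monic) (hN : η.natDegree ≠ 0) : (monicDeriv η).Monic := by
  refine monic_of_natDegree_le_of_coeff_eq_one (η.natDegree - 1) natDegree_monicDeriv_le ?_
  rw [monicDeriv, coeff_smul, coeff_derivative, Nat.sub_add_cancel (Nat.pos_of_ne_zero hN),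
    h.coeff_natDegree, Nat.cast_sub (Nat.pos_of_ne_zero hN)]
  simp [hN]

theorem natDegree_monicDeriv (h : η.Monic) (hN : η.natDegree ≠ 0) :
    (monicDeriv η).natDegree = η.natDegree - 1 := by
  refine le_antisymm natDegree_monicDeriv_le (le_natDegree_of_ne_zero ?_)
  rw [monicDeriv, coeff_smul, coeff_derivative, Nat.sub_add_cancel (Nat.pos_of_ne_zero hN),
    h.coeff_natDegree, Nat.cast_sub (Nat.pos_of_ne_zero hN)]
  simp [hN]

/-- The map `g ↦ [g η / η']`, the polynomial part of the quotient. -/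
def cyclicMap (hN : η.natDegree ≠ 0) : ℂ[X] →ₗ[ℂ] AdjoinRoot η where
  toFun g := AdjoinRoot.mk η ((g * η) /ₘ monicDeriv η)
  map_add' f g := by rw [add_mul, add_divByMonic (monic_monicDeriv hη hN), map_add]
  map_smul' c g := by
    rw [smul_mul_assoc, smul_divByMonic (monic_monicDeriv hη hN), AdjoinRoot.smul_mk]; rfl

theorem cyclicMap_apply (hN : η.natDegree ≠ 0) (g : ℂ[X]) :
    cyclicMap hη hN g = AdjoinRoot.mk η ((g * η) /ₘ monicDeriv η) := rfl

/-- If q is the polynomial part of gη divided by the monic derivative, then qη' is a multiple of η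
minus N times a remainder of degree below N - 1. The coefficient that computes the trace is
therefore zero. -/
theorem traceForm_cyclicMap (hN : η.natDegree ≠ 0) (g : ℂ[X]) :
    traceForm hη (cyclicMap hη hN g) = 0 := by
  have hm := monic_monicDeriv hη hN
  have h1 := modByMonic_add_div (g * η) (monicDeriv η)
  have hlt : ((-(η.natDegree : ℂ)) • ((g * η) %ₘ monicDeriv η)).degree
      < ((η.natDegree - 1 : ℕ) : WithBot ℕ) := by
    refine (degree_smul_le _ _).trans_lt ((degree_modByMonic_lt _ hm).trans_le ?_)
    rw [degree_eq_natDegree hm.ne_zero, natDegree_monicDeriv hη hN]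
  rw [cyclicMap_apply, traceForm_mk, rootSum_eq_coeff hη (g := (η.natDegree : ℂ) • g)
    (h := (-(η.natDegree : ℂ)) • ((g * η) %ₘ monicDeriv η)), coeff_eq_zero_of_degree_lt hlt]
  · rw [derivative_eq_smul_monicDeriv hN, mul_smul_comm, smul_mul_assoc, neg_smul, ← sub_eq_add_neg,
      ← smul_sub]
    congr 1
    linear_combination h1
  · refine hlt.trans_le ?_
    rw [degree_eq_natDegree hη.ne_zero]
    exact_mod_cast Nat.sub_le _ _

/-- Multiplying g by X multiplies the quotient by X up to an additive constant. Vanishing of the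
trace determines that constant, and it is the one subtracted by `compression`. -/
theorem cyclicMap_X_mul (hN : η.natDegree ≠ 0) (g : ℂ[X]) :
    cyclicMap hη hN (X * g) = compression hη (cyclicMap hη hN g) := by
  have hm := monic_monicDeriv hη hN
  have hN' : (η.natDegree : ℂ) ≠ 0 := Nat.cast_ne_zero.2 hN
  set q := (g * η) /ₘ monicDeriv η with hq
  set r := (g * η) %ₘ monicDeriv η with hr
  have h1 : r + monicDeriv η * q = g * η := modByMonic_add_div (g * η) (monicDeriv η)
  obtain ⟨c, hc⟩ : ∃ c, (X * r) /ₘ monicDeriv η = C c := by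
    refine ⟨_, eq_C_of_natDegree_eq_zero ?_⟩
    rw [natDegree_divByMonic _ hm, natDegree_monicDeriv hη hN]
    rcases eq_or_ne r 0 with h0 | h0
    · simp [h0]
    · have := natDegree_lt_natDegree h0 (degree_modByMonic_lt (g * η) hm)
      rw [natDegree_monicDeriv hη hN] at this
      rw [natDegree_X_mul h0]
      omega
  have h2 : (X * g * η) /ₘ monicDeriv η = X * q + C c := by
    rw [mul_assoc, ← h1, mul_add, mul_left_comm, add_divByMonic hm, hc,
      mul_divByMonic_cancel_left _ hm, add_comm]
  have h3 : cyclicMap hη hN (X * g) = AdjoinRoot.root η * cyclicMap hη hN g + c • 1 := by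
    rw [cyclicMap_apply, cyclicMap_apply, h2, map_add, map_mul, AdjoinRoot.mk_X,
      AdjoinRoot.mk_C, Algebra.smul_def, mul_one]
    rfl
  have h4 := traceForm_cyclicMap hη hN (X * g)
  rw [h3, map_add, map_smul, traceForm_one, smul_eq_mul] at h4
  rw [h3, compression_apply, sub_eq_add_neg, ← neg_smul]
  congr 2
  field_simp
  linear_combination h4

theorem cyclicMap_monicDeriv_mul (hN : η.natDegree ≠ 0) (h : ℂ[X]) :
    cyclicMap hη hN (monicDeriv η * h) = 0 := by
  rw [cyclicMap_apply, mul_assoc, mul_divByMonic_cancel_left _ (monic_monicDeriv hη hN),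
    AdjoinRoot.mk_eq_zero]
  exact dvd_mul_left _ _

/-- For g ≠ 0 the quotient has degree deg g + 1 < deg η, too small for a nonzero multiple of η. -/
theorem eq_zero_of_cyclicMap_eq_zero (hN : η.natDegree ≠ 0) {g : ℂ[X]}
    (hg : g.degree < ((η.natDegree - 1 : ℕ) : WithBot ℕ)) (h : cyclicMap hη hN g = 0) : g = 0 := by
  have hm := monic_monicDeriv hη hN
  by_contra h0
  have hlt : g.natDegree < η.natDegree - 1 := by
    rw [degree_eq_natDegree h0] at hg
    exact_mod_cast hg
  have hdeg : ((g * η) /ₘ monicDeriv η).natDegree = g.natDegree + 1 := by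
    rw [natDegree_divByMonic _ hm, natDegree_monicDeriv hη hN, natDegree_mul h0 hη.ne_zero]
    omega
  rw [cyclicMap_apply, AdjoinRoot.mk_eq_zero] at h
  have hne : (g * η) /ₘ monicDeriv η ≠ 0 := fun h' => by rw [h'] at hdeg; simp at hdeg
  have := natDegree_le_of_dvd h hne
  omega

/-- Injectivity in degrees below N - 1 gives the kernel; the image then fills the trace-zero
hyperplane, which has dimension N - 1. -/
theorem isCyclic_compression (hN : η.natDegree ≠ 0) :
    Fock.IsCyclic (compression hη) (traceForm hη) (derivative η) (cyclicMap hη hN) := by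
  have hm := monic_monicDeriv hη hN
  have hN' : (η.natDegree : ℂ) ≠ 0 := Nat.cast_ne_zero.2 hN
  have hassoc : ∀ g, derivative η ∣ g ↔ monicDeriv η ∣ g := fun g => by
    rw [derivative_eq_smul_monicDeriv hN, smul_eq_C_mul]
    exact (isUnit_C.2 hN'.isUnit).mul_left_dvd
  have := finiteDimensional_adjoinRoot hη
  refine ⟨?_, cyclicMap_X_mul hη hN, fun g => ?_, ?_⟩
  · rw [derivative_eq_smul_monicDeriv hN]
    exact smul_ne_zero hN' hm.ne_zero
  · rw [hassoc]
    constructor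
    · intro h
      rw [← modByMonic_eq_zero_iff_dvd hm]
      refine eq_zero_of_cyclicMap_eq_zero hη hN ?_ ?_
      · have := degree_modByMonic_lt g hm
        rwa [degree_eq_natDegree hm.ne_zero, natDegree_monicDeriv hη hN] at this
      · rw [← modByMonic_add_div g (monicDeriv η), map_add, cyclicMap_monicDeriv_mul, add_zero] at h
        exact h
    · rintro ⟨h, rfl⟩
      exact cyclicMap_monicDeriv_mul hη hN h
  · refine Submodule.eq_of_le_of_finrank_le ?_ ?_
    · rintro _ ⟨g, rfl⟩
      exact traceForm_cyclicMap hη hN g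
    · have hne : traceForm hη ≠ 0 := fun h => by
        have := traceForm_one hη
        rw [h] at this
        exact hN' this.symm
      have h1 := Module.Dual.finrank_ker_add_one_of_ne_zero hne
      rw [finrank_adjoinRoot hη] at h1
      have hinj : Function.Injective
          (cyclicMap hη hN ∘ₗ (degreeLT ℂ (η.natDegree - 1)).subtype) := by
        rw [← LinearMap.ker_eq_bot, LinearMap.ker_eq_bot']
        exact fun g hg => Subtype.ext (eq_zero_of_cyclicMap_eq_zero hη hN (mem_degreeLT.1 g.2) hg)
      have h2 := LinearMap.finrank_range_of_inj hinj
      rw [(degreeLTEquiv ℂ _).finrank_eq, Module.finrank_fin_fun] at h2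
      have h3 := Submodule.finrank_mono (LinearMap.range_comp_le_range
        (degreeLT ℂ (η.natDegree - 1)).subtype (cyclicMap hη hN))
      omega

end AdjoinRoot

/-! ### Modules generated by a highest weight vector -/

namespace CurrentRep

section

variable {M : Type*} [AddCommGroup M] [Module ℂ M] (ρ : CurrentRep M)

/-- The action of `e_{21} ⊗ p(t)`. -/
def low : ℂ[X] →ₗ[ℂ] Module.End ℂ M := (Polynomial.basisMonomials ℂ).constr ℂ (ρ.e 1 0)

theorem low_X_pow (r : ℕ) : ρ.low (X ^ r) = ρ.e 1 0 r := by
  have := (Polynomial.basisMonomials ℂ).constr_basis ℂ (ρ.e 1 0) r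
  rw [coe_basisMonomials] at this
  rw [← monomial_one_right_eq_X_pow]
  exact this

theorem low_eq_sum (p : ℂ[X]) :
    ρ.low p = ∑ i ∈ Finset.range (p.natDegree + 1), p.coeff i • ρ.e 1 0 i := by
  conv_lhs => rw [p.as_sum_range]
  rw [map_sum]
  refine Finset.sum_congr rfl fun i _ => ?_
  rw [← smul_X_eq_monomial, map_smul, low_X_pow]

/-- A property that is linear in `p` holds for all polynomials if it holds for the powers of
`X`. -/
theorem polynomial_linear_induction {P : ℂ[X] → Prop} (hX : ∀ r : ℕ, P (X ^ r))
    (hadd : ∀ p q, P p → P q → P (p + q)) (hsmul : ∀ (c : ℂ) p, P p → P (c • p)) (p : ℂ[X]) :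
    P p := by
  induction p using Polynomial.induction_on' with
  | add p q hp hq => exact hadd p q hp hq
  | monomial r c => rw [← smul_X_eq_monomial]; exact hsmul c _ (hX r)

theorem e10_anticomm (r s : ℕ) : ρ.e 1 0 r * ρ.e 1 0 s = -(ρ.e 1 0 s * ρ.e 1 0 r) := by
  have h := ρ.bracket 1 0 1 0 r s
  simp [par] at h
  exact eq_neg_of_add_eq_zero_left h

theorem e11_e10 (r s : ℕ) :
    ρ.e 1 1 r * ρ.e 1 0 s = ρ.e 1 0 (r + s) + ρ.e 1 0 s * ρ.e 1 1 r := by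
  have h := ρ.bracket 1 1 1 0 r s
  simp [par] at h
  rw [← h, sub_add_cancel]

theorem e00_e10 (r s : ℕ) :
    ρ.e 0 0 r * ρ.e 1 0 s = -ρ.e 1 0 (r + s) + ρ.e 1 0 s * ρ.e 0 0 r := by
  have h := ρ.bracket 0 0 1 0 r s
  simp [par] at h
  rw [← h, sub_add_cancel]

theorem e01_e10 (r s : ℕ) : ρ.e 0 1 r * ρ.e 1 0 s
    = ρ.e 0 0 (r + s) + ρ.e 1 1 (r + s) - ρ.e 1 0 s * ρ.e 0 1 r := by
  have h := ρ.bracket 0 1 1 0 r s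
  simp [par] at h
  rw [← h, add_sub_cancel_right]

theorem low_anticomm (p q : ℂ[X]) : ρ.low p * ρ.low q = -(ρ.low q * ρ.low p) := by
  induction p using polynomial_linear_induction with
  | hadd p p' hp hp' => rw [map_add, add_mul, mul_add, hp, hp', neg_add]
  | hsmul c p hp => rw [map_smul, smul_mul_assoc, mul_smul_comm, hp, smul_neg]
  | hX r =>
    induction q using polynomial_linear_induction with
    | hadd p p' hp hp' => rw [map_add, add_mul, mul_add, hp, hp', neg_add]
    | hsmul c p hp => rw [map_smul, smul_mul_assoc, mul_smul_comm, hp, smul_neg]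
    | hX s => rw [low_X_pow, low_X_pow, e10_anticomm]

theorem low_mul_self (p : ℂ[X]) : ρ.low p * ρ.low p = 0 := by
  have h := eq_neg_iff_add_eq_zero.1 (ρ.low_anticomm p p)
  rw [← two_smul ℂ] at h
  exact (smul_eq_zero.1 h).resolve_left two_ne_zero

theorem e11_low (r : ℕ) (p : ℂ[X]) :
    ρ.e 1 1 r * ρ.low p = ρ.low (X ^ r * p) + ρ.low p * ρ.e 1 1 r := by
  induction p using polynomial_linear_induction with
  | hadd p q hp hq => rw [mul_add, map_add, map_add, mul_add, hp, hq, add_mul]; abel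
  | hsmul c p hp =>
    rw [mul_smul_comm, map_smul, map_smul, mul_smul_comm, hp, smul_mul_assoc, smul_add]
  | hX s => rw [← pow_add, low_X_pow, low_X_pow, e11_e10]

/-- The action of the central element `(e_{11} + e_{22})[r]`. -/
def cent (r : ℕ) : Module.End ℂ M := ρ.e 0 0 r + ρ.e 1 1 r

theorem cent_low (r : ℕ) (p : ℂ[X]) : ρ.cent r * ρ.low p = ρ.low p * ρ.cent r := by
  induction p using polynomial_linear_induction with
  | hadd p q hp hq => rw [map_add, mul_add, hp, hq, add_mul]
  | hsmul c p hp => rw [map_smul, mul_smul_comm, hp, smul_mul_assoc]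
  | hX s => rw [low_X_pow, cent, add_mul, e00_e10, e11_e10, mul_add]; abel

/-- The smallest subspace that contains `w` and is stable under `e_{21}[r]`, `r ≥ 0`. -/
def lowSpan (w : M) : Submodule ℂ M :=
  sInf {N : Submodule ℂ M | w ∈ N ∧ ∀ p, ∀ v ∈ N, ρ.low p v ∈ N}

theorem lowSpan_le {w : M} {N : Submodule ℂ M} (hw : w ∈ N) (h : ∀ p, ∀ v ∈ N, ρ.low p v ∈ N) :
    ρ.lowSpan w ≤ N := sInf_le ⟨hw, h⟩

theorem mem_lowSpan (w : M) : w ∈ ρ.lowSpan w :=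
  Submodule.mem_sInf.2 fun _ hN => hN.1

theorem low_mem_lowSpan {w v : M} (hv : v ∈ ρ.lowSpan w) (p : ℂ[X]) :
    ρ.low p v ∈ ρ.lowSpan w :=
  Submodule.mem_sInf.2 fun N hN => hN.2 p v (Submodule.mem_sInf.1 hv N hN)

/-- `w` satisfies the defining relations of the Weyl module `W_η`. -/
structure IsWeylVector (η : ℂ[X]) (w : M) : Prop where
  e00 : ∀ r, ρ.e 0 0 r w = rootPsum η r • w
  e11 : ∀ r, ρ.e 1 1 r w = 0
  e01 : ∀ r, ρ.e 0 1 r w = 0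
  low : ρ.low η w = 0

namespace IsWeylVector

variable {ρ} {η : ℂ[X]} {w : M}

theorem cent_apply_of_mem (h : ρ.IsWeylVector η w) {v : M} (hv : v ∈ ρ.lowSpan w) (r : ℕ) :
    ρ.cent r v = rootPsum η r • v := by
  have hle : ρ.lowSpan w ≤ LinearMap.ker (ρ.cent r - rootPsum η r • 1) := by
    refine ρ.lowSpan_le ?_ fun p v hv => ?_
    · simp [cent, h.e00, h.e11]
    · rw [LinearMap.mem_ker, LinearMap.sub_apply, sub_eq_zero] at hv ⊢
      have := LinearMap.congr_fun (ρ.cent_low r p) v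
      rw [Module.End.mul_apply, Module.End.mul_apply, hv] at this
      rw [this]; simp
  have := hle hv
  rw [LinearMap.mem_ker, LinearMap.sub_apply, sub_eq_zero] at this
  exact this

theorem e11_mem (h : ρ.IsWeylVector η w) {v : M} (hv : v ∈ ρ.lowSpan w) (r : ℕ) : ρ.e 1 1 r v ∈ ρ.lowSpan w := by
  have hle : ρ.lowSpan w ≤ ρ.lowSpan w ⊓ (ρ.lowSpan w).comap (ρ.e 1 1 r) := by
    refine ρ.lowSpan_le ⟨ρ.mem_lowSpan w, ?_⟩ fun p v hv =>
      ⟨ρ.low_mem_lowSpan hv.1 p, ?_⟩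
    · change ρ.e 1 1 r w ∈ ρ.lowSpan w
      rw [h.e11]; exact zero_mem _
    · change (ρ.e 1 1 r * ρ.low p) v ∈ ρ.lowSpan w
      rw [e11_low]
      exact add_mem (ρ.low_mem_lowSpan hv.1 _) (ρ.low_mem_lowSpan hv.2 _)
  exact (hle hv).2

theorem e00_mem (h : ρ.IsWeylVector η w) {v : M} (hv : v ∈ ρ.lowSpan w) (r : ℕ) : ρ.e 0 0 r v ∈ ρ.lowSpan w := by
  have h1 := h.cent_apply_of_mem hv r
  rw [cent, LinearMap.add_apply] at h1
  rw [eq_sub_of_add_eq h1]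
  exact sub_mem (Submodule.smul_mem _ _ hv) (h.e11_mem hv r)

theorem e01_low_apply_of_mem (h : ρ.IsWeylVector η w) {v : M} (hv : v ∈ ρ.lowSpan w) (r : ℕ) (p : ℂ[X]) :
    ρ.e 0 1 r (ρ.low p v) = rootSum η (X ^ r * p) • v - ρ.low p (ρ.e 0 1 r v) := by
  induction p using polynomial_linear_induction with
  | hadd p q hp hq =>
    simp only [map_add, LinearMap.add_apply, mul_add, add_smul, hp, hq]; abel
  | hsmul c p hp =>
    simp only [map_smul, LinearMap.smul_apply, mul_smul_comm, hp, smul_sub, smul_assoc]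
  | hX s =>
    have := LinearMap.congr_fun (ρ.e01_e10 r s) v
    have hc := h.cent_apply_of_mem hv (r + s)
    rw [cent] at hc
    rw [Module.End.mul_apply, LinearMap.sub_apply, hc, Module.End.mul_apply] at this
    rw [low_X_pow, this, ← pow_add, rootSum_X_pow]

theorem e01_mem (h : ρ.IsWeylVector η w) {v : M} (hv : v ∈ ρ.lowSpan w) (r : ℕ) : ρ.e 0 1 r v ∈ ρ.lowSpan w := by
  have hle : ρ.lowSpan w ≤ ρ.lowSpan w ⊓ (ρ.lowSpan w).comap (ρ.e 0 1 r) := by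
    refine ρ.lowSpan_le ⟨ρ.mem_lowSpan w, ?_⟩ fun p v hv =>
      ⟨ρ.low_mem_lowSpan hv.1 p, ?_⟩
    · change ρ.e 0 1 r w ∈ ρ.lowSpan w
      rw [h.e01]; exact zero_mem _
    · change ρ.e 0 1 r (ρ.low p v) ∈ ρ.lowSpan w
      rw [h.e01_low_apply_of_mem hv.1]
      exact sub_mem (Submodule.smul_mem _ _ hv.1) (ρ.low_mem_lowSpan hv.2 _)
  exact (hle hv).2

/-- The span of `w` under `e_{21}[r]` is a submodule. -/
theorem e_mem (h : ρ.IsWeylVector η w) {v : M} (hv : v ∈ ρ.lowSpan w) (i j : Fin 2) (r : ℕ) :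
    ρ.e i j r v ∈ ρ.lowSpan w := by
  fin_cases i <;> fin_cases j
  · exact h.e00_mem hv r
  · exact h.e01_mem hv r
  · have := ρ.low_mem_lowSpan hv (X ^ r)
    rwa [low_X_pow] at this
  · exact h.e11_mem hv r

/-- Applying e_22[r], which kills `w`, to the relation (e_21 ⊗ η) w = 0 yields (e_21 ⊗ t^r η) w = 0.
-/
theorem low_apply_eq_zero_of_dvd (h : ρ.IsWeylVector η w) {p : ℂ[X]} (hp : η ∣ p) : ρ.low p w = 0 := by
  obtain ⟨q, rfl⟩ := hp
  rw [mul_comm]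
  induction q using polynomial_linear_induction with
  | hadd p q hp hq => rw [add_mul, map_add, LinearMap.add_apply, hp, hq, add_zero]
  | hsmul c p hp => rw [smul_mul_assoc, map_smul, LinearMap.smul_apply, hp, smul_zero]
  | hX r =>
    have := LinearMap.congr_fun (ρ.e11_low r η) w
    simpa [h.low, h.e11] using this.symm

/-- The operators e_21 ⊗ q anticommute, so vanishing at `w` propagates to all that they generate
from `w`. -/
theorem low_eq_zero_of_dvd (h : ρ.IsWeylVector η w) (hgen : ρ.lowSpan w = ⊤) {p : ℂ[X]} (hp : η ∣ p) : ρ.low p = 0 := by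
  have hle : ρ.lowSpan w ≤ LinearMap.ker (ρ.low p) := by
    refine ρ.lowSpan_le (h.low_apply_eq_zero_of_dvd hp) fun q v hv => ?_
    have := LinearMap.congr_fun (ρ.low_anticomm p q) v
    rw [LinearMap.mem_ker] at hv
    rw [LinearMap.mem_ker]
    simpa [hv] using this
  rw [hgen, top_le_iff] at hle
  exact LinearMap.ker_eq_top.1 hle

theorem cent_eq (h : ρ.IsWeylVector η w) (hgen : ρ.lowSpan w = ⊤) (r : ℕ) : ρ.cent r = rootPsum η r • 1 :=
  LinearMap.ext fun v => h.cent_apply_of_mem (hgen ▸ Submodule.mem_top : v ∈ ρ.lowSpan w) r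

theorem e01_low_apply (h : ρ.IsWeylVector η w) (hgen : ρ.lowSpan w = ⊤) (v : M) (r : ℕ) (p : ℂ[X]) :
    ρ.e 0 1 r (ρ.low p v) = rootSum η (X ^ r * p) • v - ρ.low p (ρ.e 0 1 r v) :=
  h.e01_low_apply_of_mem (hgen ▸ Submodule.mem_top : v ∈ ρ.lowSpan w) r p

theorem liftAdjoin_low_mul_self (ρ : CurrentRep M) (hη : η.Monic) (v : AdjoinRoot η) :
    liftAdjoin hη ρ.low v * liftAdjoin hη ρ.low v = 0 := ρ.low_mul_self _

variable (ρ) in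
/-- The action of the exterior algebra of `ℂ[X]/(η)` through `e_{21}`. -/
def wedgeAct (hη : η.Monic) : ExteriorAlgebra ℂ (AdjoinRoot η) →ₐ[ℂ] Module.End ℂ M :=
  ExteriorAlgebra.lift ℂ ⟨liftAdjoin hη ρ.low, liftAdjoin_low_mul_self ρ hη⟩

variable (ρ) in
/-- The map `x ↦ x w` from the exterior algebra of `ℂ[X]/(η)`. -/
def fockMap (hη : η.Monic) (w : M) : ExteriorAlgebra ℂ (AdjoinRoot η) →ₗ[ℂ] M :=
  (LinearMap.applyₗ w : Module.End ℂ M →ₗ[ℂ] M) ∘ₗ (wedgeAct ρ hη).toLinearMap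

theorem fockMap_one (hη : η.Monic) : fockMap ρ hη w 1 = w := by
  simp [fockMap]

theorem fockMap_ι_mul (h : ρ.IsWeylVector η w) (hgen : ρ.lowSpan w = ⊤)
    (hη : η.Monic) (p : ℂ[X]) (x : ExteriorAlgebra ℂ (AdjoinRoot η)) :
    fockMap ρ hη w (ExteriorAlgebra.ι ℂ (AdjoinRoot.mk η p) * x)
      = ρ.low p (fockMap ρ hη w x) := by
  have : wedgeAct ρ hη (ExteriorAlgebra.ι ℂ (AdjoinRoot.mk η p)) = ρ.low p := by
    rw [wedgeAct, ExteriorAlgebra.lift_ι_apply]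
    exact liftAdjoin_mk hη (fun p hp => h.low_eq_zero_of_dvd hgen hp) p
  simp [fockMap, this]

theorem fockMap_surjective (h : ρ.IsWeylVector η w) (hgen : ρ.lowSpan w = ⊤)
    (hη : η.Monic) : Function.Surjective (fockMap ρ hη w) := by
  rw [← LinearMap.range_eq_top, ← top_le_iff, ← hgen]
  refine ρ.lowSpan_le ⟨1, fockMap_one hη⟩ ?_
  rintro p _ ⟨x, rfl⟩
  exact ⟨_, h.fockMap_ι_mul hgen hη p x⟩

/-- `e_{12}[r]` acts by the contraction with the linear form `v ↦ ∑ a^r v(a)`. -/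
theorem fockMap_annih (h : ρ.IsWeylVector η w) (hgen : ρ.lowSpan w = ⊤)
    (hη : η.Monic) (r : ℕ) (x : ExteriorAlgebra ℂ (AdjoinRoot η)) :
    fockMap ρ hη w (Fock.annih
        (traceForm hη ∘ₗ LinearMap.mulLeft ℂ (AdjoinRoot.root η ^ r)) x)
      = ρ.e 0 1 r (fockMap ρ hη w x) := by
  rw [← sub_eq_zero]
  refine Fock.linearMap_eq_zero (fockMap ρ hη w ∘ₗ Fock.annih
        (traceForm hη ∘ₗ LinearMap.mulLeft ℂ (AdjoinRoot.root η ^ r))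
      - ρ.e 0 1 r ∘ₗ fockMap ρ hη w) ?_ (fun v x hx => ?_) x
  · simp [fockMap_one, h.e01]
  · obtain ⟨p, rfl⟩ := AdjoinRoot.mk_surjective v
    simp only [LinearMap.sub_apply, LinearMap.comp_apply, sub_eq_zero] at hx ⊢
    rw [Fock.annih_ι_mul, map_sub, map_smul, h.fockMap_ι_mul hgen, h.fockMap_ι_mul hgen, hx,
      h.e01_low_apply hgen]
    congr 2
    rw [LinearMap.comp_apply, LinearMap.mulLeft_apply, ← AdjoinRoot.mk_X, ← map_pow, ← map_mul,
      traceForm_mk]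

variable [FiniteDimensional ℂ (AdjoinRoot η)]

/-- `e_{22}[r]` acts by the derivation extending the multiplication by `X ^ r`. -/
theorem fockMap_dGamma (h : ρ.IsWeylVector η w) (hgen : ρ.lowSpan w = ⊤)
    (hη : η.Monic) (r : ℕ) (x : ExteriorAlgebra ℂ (AdjoinRoot η)) :
    fockMap ρ hη w (Fock.dGamma (LinearMap.mulLeft ℂ (AdjoinRoot.root η ^ r)) x)
      = ρ.e 1 1 r (fockMap ρ hη w x) := by
  rw [← sub_eq_zero]
  refine Fock.linearMap_eq_zero (fockMap ρ hη w ∘ₗ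
      Fock.dGamma (LinearMap.mulLeft ℂ (AdjoinRoot.root η ^ r))
      - ρ.e 1 1 r ∘ₗ fockMap ρ hη w) ?_ (fun v x hx => ?_) x
  · simp [fockMap_one, h.e11]
  · obtain ⟨p, rfl⟩ := AdjoinRoot.mk_surjective v
    simp only [LinearMap.sub_apply, LinearMap.comp_apply, sub_eq_zero] at hx ⊢
    rw [Fock.dGamma_ι_mul, map_add, h.fockMap_ι_mul hgen, hx, LinearMap.mulLeft_apply,
      ← AdjoinRoot.mk_X, ← map_pow, ← map_mul, h.fockMap_ι_mul hgen, h.fockMap_ι_mul hgen]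
    exact (LinearMap.congr_fun (ρ.e11_low r p) _).symm

end IsWeylVector

end

end CurrentRep

/-! ### Series in `x⁻¹` without constant term -/

/-- The series `∑_r c_r x^{-r-1}`. -/
def serL (c : ℕ → ℂ) : ℂ⸨X⸩ :=
  HahnSeries.single 1 1 * HahnSeries.ofPowerSeries ℤ ℂ (PowerSeries.mk c)

theorem coeff_single_mul_ofPowerSeries (k : ℤ) (F : PowerSeries ℂ) (r : ℕ) :
    ((HahnSeries.single k 1 : ℂ⸨X⸩) * HahnSeries.ofPowerSeries ℤ ℂ F).coeff (r + k)
      = PowerSeries.coeff r F := by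
  rw [HahnSeries.coeff_single_mul_add, one_mul, HahnSeries.ofPowerSeries_apply_coeff]

theorem coeff_single_mul_ofPowerSeries_of_lt (k : ℤ) (F : PowerSeries ℂ) {i : ℤ} (hi : i < k) :
    ((HahnSeries.single k 1 : ℂ⸨X⸩) * HahnSeries.ofPowerSeries ℤ ℂ F).coeff i = 0 := by
  have := HahnSeries.coeff_single_mul_add (r := (1 : ℂ)) (x := HahnSeries.ofPowerSeries ℤ ℂ F)
    (a := i - k) (b := k)
  rw [sub_add_cancel] at this
  rw [this, one_mul]
  exact (PowerSeries.coeff_coe F (i - k)).trans (if_pos (by omega))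

theorem coeff_serL (c : ℕ → ℂ) (r : ℕ) : (serL c).coeff ((r : ℤ) + 1) = c r := by
  rw [serL, coeff_single_mul_ofPowerSeries, PowerSeries.coeff_mk]

theorem serL_add (c d : ℕ → ℂ) : serL (c + d) = serL c + serL d := by
  rw [serL, serL, serL, ← mul_add, ← map_add]
  congr 2

theorem serL_zero : serL 0 = 0 := by
  have : PowerSeries.mk (0 : ℕ → ℂ) = 0 := rfl
  rw [serL, this, map_zero, mul_zero]

theorem serL_mul (c d : ℕ → ℂ) : serL c * serL d = HahnSeries.single 2 1 *
    HahnSeries.ofPowerSeries ℤ ℂ (PowerSeries.mk c * PowerSeries.mk d) := by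
  have : (HahnSeries.single 2 1 : ℂ⸨X⸩) = HahnSeries.single 1 1 * HahnSeries.single 1 1 := by
    rw [HahnSeries.single_mul_single]; norm_num
  rw [serL, serL, this, map_mul]
  ring

theorem coeff_serL_mul (c d : ℕ → ℂ) (m : ℕ) : (serL c * serL d).coeff ((m : ℤ) + 2)
    = ∑ p ∈ Finset.HasAntidiagonal.antidiagonal m, c p.1 * d p.2 := by
  rw [serL_mul, coeff_single_mul_ofPowerSeries, PowerSeries.coeff_mul]
  simp

theorem coeff_serL_mul_of_lt (c d : ℕ → ℂ) {i : ℤ} (hi : i < 2) :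
    (serL c * serL d).coeff i = 0 := by
  rw [serL_mul, coeff_single_mul_ofPowerSeries_of_lt _ _ hi]

theorem coeff_ddx (f : ℂ⸨X⸩) (i : ℤ) : (ddx f).coeff (i + 2) = -((i + 1) * f.coeff (i + 1)) := by
  rw [ddx, HahnSeries.coeff_neg, add_comm i 2, add_comm 2 i, HahnSeries.coeff_single_mul_add,
    one_mul, LaurentSeries.derivative_apply, LaurentSeries.hasseDeriv_coeff]
  simp

theorem coeff_ddx_serL_of_lt (c : ℕ → ℂ) {i : ℤ} (hi : i < 2) : (ddx (serL c)).coeff i = 0 := by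
  have := coeff_ddx (serL c) (i - 2)
  rw [sub_add_cancel] at this
  rw [this, serL, coeff_single_mul_ofPowerSeries_of_lt]
  · simp
  · omega

/-- The geometric series for 1/(x - a) at infinity. -/
theorem polyL_X_sub_C_mul_serL (a : ℂ) : polyL (X - C a) * serL (a ^ ·) = 1 := by
  have h1 : polyL (X - C a) * HahnSeries.single 1 1
      = HahnSeries.ofPowerSeries ℤ ℂ (1 - PowerSeries.C a * PowerSeries.X) := by
    simp only [polyL, xL, coe_eval₂RingHom, eval₂_X, eval₂_C, sub_mul, map_sub, map_mul,
      map_one, HahnSeries.ofPowerSeries_C, HahnSeries.ofPowerSeries_X,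
      HahnSeries.single_mul_single]
    simp
  rw [serL, ← mul_assoc, h1, ← map_mul, ← map_one (HahnSeries.ofPowerSeries ℤ ℂ)]
  congr 1
  ext n
  rw [sub_mul, one_mul, map_sub, mul_assoc, PowerSeries.coeff_C_mul]
  cases n with
  | zero => simp
  | succ n => rw [PowerSeries.coeff_succ_X_mul]; simp [pow_succ']

theorem polyL_derivative_prod (s : Multiset ℂ) :
    polyL (derivative (s.map fun a => X - C a).prod)
      = serL (fun r => (s.map (· ^ r)).sum) * polyL (s.map fun a => X - C a).prod := by
  induction s using Multiset.induction_on with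
  | empty =>
    have : (fun r : ℕ => ((0 : Multiset ℂ).map (· ^ r)).sum) = 0 := by funext r; simp
    rw [this, serL_zero]
    simp
  | cons a s ih =>
    have : (fun r : ℕ => ((a ::ₘ s).map (· ^ r)).sum)
        = (a ^ ·) + fun r => (s.map (· ^ r)).sum := by funext r; simp
    rw [this, serL_add, Multiset.map_cons, Multiset.prod_cons, derivative_mul, map_add, map_mul,
      map_mul, ih, map_mul]
    have h := polyL_X_sub_C_mul_serL a
    simp only [derivative_sub, derivative_X, derivative_C, sub_zero, map_one]
    linear_combination -polyL (s.map fun a => X - C a).prod * h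

theorem polyL_ne_zero_of_monic {y : ℂ[X]} (hy : y.Monic) : polyL y ≠ 0 := by
  rw [eq_prod_roots hy, map_multiset_prod, Multiset.map_map]
  refine Multiset.prod_ne_zero fun h => ?_
  obtain ⟨a, -, ha⟩ := Multiset.mem_map.1 h
  exact polyL_X_sub_C_ne_zero a ha

/-- The logarithmic derivative of `y`, expanded in `x⁻¹`. -/
theorem polyL_derivative_div {y : ℂ[X]} (hy : y.Monic) :
    polyL (derivative y) / polyL y = serL (rootPsum y) := by
  rw [div_eq_iff (polyL_ne_zero_of_monic hy)]
  have := polyL_derivative_prod y.roots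
  rwa [← eq_prod_roots hy] at this

/-! ### The polynomial η of the tensor product and the coefficients of the eigenvalue -/

/-- The product `∏ (x - b_s)^{n_s}`. -/
def etaPoly {k : ℕ} (n : Fin k → ℕ) (b : Fin k → ℂ) : ℂ[X] := ∏ s, (X - C (b s)) ^ n s

theorem etaPoly_monic {k : ℕ} (n : Fin k → ℕ) (b : Fin k → ℂ) : (etaPoly n b).Monic :=
  monic_prod_of_monic _ _ fun _ _ => (monic_X_sub_C _).pow _

theorem natDegree_etaPoly {k : ℕ} (n : Fin k → ℕ) (b : Fin k → ℂ) :
    (etaPoly n b).natDegree = ∑ s, n s := by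
  rw [etaPoly, natDegree_prod_of_monic _ _ fun _ _ => (monic_X_sub_C _).pow _]
  simp

theorem psi_eq_derivative {k : ℕ} (n : Fin k → ℕ) (b : Fin k → ℂ) :
    psi n b = derivative (etaPoly n b) := by
  rw [psi, etaPoly, derivative_prod_finset]
  refine Finset.sum_congr rfl fun s _ => ?_
  rw [derivative_X_sub_C_pow, mul_comm]
  simp

theorem zeta_eq_serL {k : ℕ} (n : Fin k → ℕ) (b : Fin k → ℂ) :
    zeta n b = serL (rootPsum (etaPoly n b)) := by
  have h := polyL_psi n b
  have h' : ∏ r, polyL (X - C (b r)) ^ n r = polyL (etaPoly n b) := by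
    simp [etaPoly, map_prod]
  rw [← polyL_derivative_div (etaPoly_monic n b), eq_div_iff (polyL_ne_zero_of_monic
    (etaPoly_monic n b)), ← psi_eq_derivative, h, h']

/-- The first summand is arranged as the scalar part of the transfer matrix, the term with m + 1
coming from ζ'; only the last sum depends on y. -/
theorem coeff_eigenvalue {k : ℕ} (n : Fin k → ℕ) (b : Fin k → ℂ) {y : ℂ[X]} (hy : y.Monic)
    (m : ℕ) : (eigenvalue n b y).coeff ((m : ℤ) + 2)
      = (1 / 2) * (∑ p ∈ Finset.HasAntidiagonal.antidiagonal m,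
          rootPsum (etaPoly n b) p.1 * rootPsum (etaPoly n b) p.2
          - (m + 1) * rootPsum (etaPoly n b) m)
        - ∑ p ∈ Finset.HasAntidiagonal.antidiagonal m,
          rootPsum (etaPoly n b) p.1 * rootPsum y p.2 := by
  rw [eigenvalue, polyL_derivative_div hy, zeta_eq_serL, sq, HahnSeries.coeff_add,
    HahnSeries.coeff_sub, HahnSeries.C_mul_eq_smul, HahnSeries.C_mul_eq_smul,
    HahnSeries.coeff_smul, HahnSeries.coeff_smul, coeff_serL_mul, coeff_serL_mul, coeff_ddx,
    coeff_serL]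
  simp only [smul_eq_mul]
  push_cast
  ring

theorem coeff_eigenvalue_of_lt {k : ℕ} (n : Fin k → ℕ) (b : Fin k → ℂ) {y : ℂ[X]} (hy : y.Monic)
    {i : ℤ} (hi : i < 2) : (eigenvalue n b y).coeff i = 0 := by
  rw [eigenvalue, polyL_derivative_div hy, zeta_eq_serL, sq, HahnSeries.coeff_add,
    HahnSeries.coeff_sub, HahnSeries.C_mul_eq_smul, HahnSeries.C_mul_eq_smul,
    HahnSeries.coeff_smul, HahnSeries.coeff_smul, coeff_serL_mul_of_lt _ _ hi,
    coeff_serL_mul_of_lt _ _ hi, coeff_ddx_serL_of_lt _ hi]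
  simp

open CurrentRep

/-! ### Weyl modules are exterior algebras -/

section Weyl

variable {η : ℂ[X]} (hη : η.Monic)

/-- The generator of the Weyl module. -/
def weylVec (η : ℂ[X]) : Weyl η := weylMk η 1

theorem weylMk_eq_smul (u : U) : weylMk η u = u • weylVec η := by
  rw [weylVec, ← weylMk_mul, mul_one]

theorem smul_weylVec_eq_zero {u : U} (hu : IsWeylRelation η u) : u • weylVec η = 0 := by
  rw [← weylMk_eq_smul]
  exact (Submodule.Quotient.mk_eq_zero _).2 (Submodule.subset_span hu)

theorem weylRep_e_apply (i j : Fin 2) (r : ℕ) (v : Weyl η) :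
    (weylRep η).e i j r v = uE i j r • v := rfl

theorem weylRep_parity_weylVec : (weylRep η).parity (weylVec η) = weylVec η := by
  change weylParity η (weylMk η 1) = weylMk η 1
  rw [weylParity_mk, map_one]

theorem isWeylVector_weylVec (h : η.Monic) : (weylRep η).IsWeylVector η (weylVec η) where
  e00 r := by
    have h1 := smul_weylVec_eq_zero (IsWeylRelation.e11 (η := η) r)
    rw [polyL_derivative_div h, coeff_serL, sub_smul, sub_eq_zero] at h1
    rw [weylRep_e_apply, h1, algebraMap_smul]
  e11 r := smul_weylVec_eq_zero (IsWeylRelation.e22 r)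
  e01 r := smul_weylVec_eq_zero (IsWeylRelation.e12 r)
  low := by
    have h1 := smul_weylVec_eq_zero (IsWeylRelation.e21 (η := η))
    rw [Finset.sum_smul] at h1
    rw [low_eq_sum, LinearMap.sum_apply]
    refine Eq.trans (Finset.sum_congr rfl fun i _ => ?_) h1
    rw [LinearMap.smul_apply, weylRep_e_apply, smul_assoc]

theorem U_induction {P : U → Prop} (hc : ∀ c : ℂ, P (algebraMap ℂ U c))
    (he : ∀ i j r, P (uE i j r)) (hadd : ∀ u v, P u → P v → P (u + v))
    (hmul : ∀ u v, P u → P v → P (u * v)) (u : U) : P u := by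
  obtain ⟨f, rfl⟩ : ∃ f, toU f = u := RingQuot.mkAlgHom_surjective ℂ Rel u
  induction f using FreeAlgebra.induction with
  | grade0 c => rw [AlgHom.commutes]; exact hc c
  | grade1 p => exact he p.1 p.2.1 p.2.2
  | mul a b ha hb => rw [map_mul]; exact hmul _ _ ha hb
  | add a b ha hb => rw [map_add]; exact hadd _ _ ha hb

theorem lowSpan_weylVec (h : η.Monic) : (weylRep η).lowSpan (weylVec η) = ⊤ := by
  have hw := isWeylVector_weylVec h
  have key : ∀ u : U, ∀ v ∈ (weylRep η).lowSpan (weylVec η),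
      u • v ∈ (weylRep η).lowSpan (weylVec η) := by
    intro u
    induction u using U_induction with
    | hc c => intro v hv; rw [algebraMap_smul]; exact Submodule.smul_mem _ _ hv
    | he i j r => intro v hv; exact hw.e_mem hv i j r
    | hadd u u' hu hu' => intro v hv; rw [add_smul]; exact add_mem (hu v hv) (hu' v hv)
    | hmul u u' hu hu' => intro v hv; rw [mul_smul]; exact hu _ (hu' v hv)
  rw [eq_top_iff]
  intro v _
  obtain ⟨u, rfl⟩ := weylMk_surjective η v
  rw [weylMk_eq_smul]
  exact key u _ ((weylRep η).mem_lowSpan _)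

/-- Left multiplication by `X ^ r` on `ℂ[X]/(η)`. -/
def rootMul (η : ℂ[X]) (r : ℕ) : Module.End ℂ (AdjoinRoot η) :=
  LinearMap.mulLeft ℂ (AdjoinRoot.root η ^ r)

theorem rootMul_apply (r : ℕ) (v : AdjoinRoot η) : rootMul η r v = AdjoinRoot.root η ^ r * v := rfl

theorem rootMul_mul (r s : ℕ) : rootMul η r * rootMul η s = rootMul η (r + s) := by
  ext v; simp [rootMul_apply, pow_add, mul_assoc]

theorem traceForm_root_pow (r : ℕ) :
    traceForm hη (AdjoinRoot.root η ^ r) = rootPsum η r := by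
  rw [← AdjoinRoot.mk_X, ← map_pow, traceForm_mk, rootSum_X_pow]

variable [FiniteDimensional ℂ (AdjoinRoot η)]

/-- The action of `e_{ij}[r]` on the exterior algebra of `ℂ[X]/(η)`. -/
def fockE : Fin 2 → Fin 2 → ℕ → Module.End ℂ (ExteriorAlgebra ℂ (AdjoinRoot η)) :=
  fun i j r => !![rootPsum η r • 1 - Fock.dGamma (rootMul η r),
      Fock.annih (traceForm hη ∘ₗ rootMul η r);
    LinearMap.mulLeft ℂ (ExteriorAlgebra.ι ℂ (AdjoinRoot.root η ^ r)),
      Fock.dGamma (rootMul η r)] i j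

/-- The canonical anticommutation relations: contraction against multiplication gives tr(t^(r+s)),
the scalar by which the central element acts, and the derivations act naturally on both. -/
theorem fockE_bracket (i j k l : Fin 2) (r s : ℕ) :
    fockE hη i j r * fockE hη k l s
        - (-1 : ℂ) ^ (par i j * par k l) • (fockE hη k l s * fockE hη i j r)
      = (if j = k then fockE hη i l (r + s) else 0)
        - (-1 : ℂ) ^ (par i j * par k l) • (if i = l then fockE hη k j (r + s) else 0) := by
  have LL : ∀ r s x, ExteriorAlgebra.ι ℂ (AdjoinRoot.root η ^ r)
      * (ExteriorAlgebra.ι ℂ (AdjoinRoot.root η ^ s) * x)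
      = -(ExteriorAlgebra.ι ℂ (AdjoinRoot.root η ^ s)
        * (ExteriorAlgebra.ι ℂ (AdjoinRoot.root η ^ r) * x)) :=
    fun r s x => Fock.ι_mul_anticomm _ _ x
  have AA : ∀ r s x, Fock.annih (traceForm hη ∘ₗ rootMul η r)
      (Fock.annih (traceForm hη ∘ₗ rootMul η s) x)
      = -Fock.annih (traceForm hη ∘ₗ rootMul η s)
        (Fock.annih (traceForm hη ∘ₗ rootMul η r) x) := fun r s x => Fock.annih_anticomm _ _ x
  have AL : ∀ r s x, Fock.annih (traceForm hη ∘ₗ rootMul η r)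
      (ExteriorAlgebra.ι ℂ (AdjoinRoot.root η ^ s) * x)
      = rootPsum η (r + s) • x - ExteriorAlgebra.ι ℂ (AdjoinRoot.root η ^ s)
        * Fock.annih (traceForm hη ∘ₗ rootMul η r) x := by
    intro r s x
    rw [Fock.annih_ι_mul, LinearMap.comp_apply, rootMul_apply, ← pow_add, traceForm_root_pow]
  have DL : ∀ r s x, Fock.dGamma (rootMul η r)
      (ExteriorAlgebra.ι ℂ (AdjoinRoot.root η ^ s) * x)
      = ExteriorAlgebra.ι ℂ (AdjoinRoot.root η ^ (r + s)) * x
        + ExteriorAlgebra.ι ℂ (AdjoinRoot.root η ^ s) * Fock.dGamma (rootMul η r) x := by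
    intro r s x
    rw [Fock.dGamma_ι_mul, rootMul_apply, ← pow_add]
  have AD : ∀ r s x, Fock.annih (traceForm hη ∘ₗ rootMul η r) (Fock.dGamma (rootMul η s) x)
      = Fock.dGamma (rootMul η s) (Fock.annih (traceForm hη ∘ₗ rootMul η r) x)
        + Fock.annih (traceForm hη ∘ₗ rootMul η (r + s)) x := by
    intro r s x
    rw [Fock.annih_dGamma, LinearMap.comp_assoc, ← rootMul_mul]
    rfl
  have DD : ∀ r s x, Fock.dGamma (rootMul η r) (Fock.dGamma (rootMul η s) x)
      = Fock.dGamma (rootMul η s) (Fock.dGamma (rootMul η r) x) := by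
    intro r s x
    refine Fock.dGamma_comm ?_ x
    rw [Commute, SemiconjBy, rootMul_mul, rootMul_mul, add_comm]
  refine LinearMap.ext fun x => ?_
  fin_cases i <;> fin_cases j <;> fin_cases k <;> fin_cases l <;>
    simp [fockE, par, AL, DL, AD, mul_sub] <;>
    try first
      | (rw [LL r s]; module)
      | (rw [AA r s]; module)
      | (rw [DD r s]; module)
      | rw [add_comm s r]

/-- The action of `U(gl(1|1)[t])` on the exterior algebra of `ℂ[X]/(η)`. -/
def fockAct : U →ₐ[ℂ] Module.End ℂ (ExteriorAlgebra ℂ (AdjoinRoot η)) :=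
  liftU (FreeAlgebra.lift ℂ fun p => fockE hη p.1 p.2.1 p.2.2) (by
    rintro _ _ ⟨i, j, k, l, r, s⟩
    have hg : ∀ i j r, (FreeAlgebra.lift ℂ
        fun p : Fin 2 × Fin 2 × ℕ => fockE hη p.1 p.2.1 p.2.2) (gen i j r) = fockE hη i j r :=
      fun i j r => FreeAlgebra.lift_ι_apply _ _
    simp only [map_sub, map_mul, map_smul, apply_ite (FreeAlgebra.lift ℂ
        fun p : Fin 2 × Fin 2 × ℕ => fockE hη p.1 p.2.1 p.2.2), map_zero, hg]
    exact fockE_bracket hη i j k l r s)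

theorem fockAct_uE (i j : Fin 2) (r : ℕ) : fockAct hη (uE i j r) = fockE hη i j r := by
  rw [fockAct, uE, liftU_toU]
  exact FreeAlgebra.lift_ι_apply _ _

theorem fockAct_relation {u : U} (hu : IsWeylRelation η u) : fockAct hη u 1 = 0 := by
  rcases hu with r | r | r | _
  · rw [polyL_derivative_div hη, coeff_serL, map_sub, AlgHom.commutes, fockAct_uE]
    simp [fockE, Algebra.algebraMap_eq_smul_one]
  · rw [fockAct_uE]; simp [fockE]
  · rw [fockAct_uE]; simp [fockE]
  · rw [map_sum]
    have : ∀ i, fockAct hη (η.coeff i • uE 1 0 i)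
        = η.coeff i • LinearMap.mulLeft ℂ (ExteriorAlgebra.ι ℂ (AdjoinRoot.root η ^ i)) := by
      intro i
      rw [map_smul, fockAct_uE]; rfl
    simp only [this, LinearMap.sum_apply, LinearMap.smul_apply, LinearMap.mulLeft_apply, mul_one,
      ← map_smul, ← map_sum]
    have h0 : ∑ i ∈ Finset.range (η.natDegree + 1), η.coeff i • AdjoinRoot.root η ^ i
        = aeval (AdjoinRoot.root η) η := (aeval_eq_sum_range _).symm
    rw [h0, AdjoinRoot.aeval_eq, AdjoinRoot.mk_self, map_zero]

theorem fockAct_eq_zero {u : U} (hu : u ∈ weylIdeal η) : fockAct hη u 1 = 0 := by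
  induction hu using Submodule.span_induction with
  | mem u hu => exact fockAct_relation hη hu
  | zero => simp
  | add u v _ _ hu hv => rw [map_add, LinearMap.add_apply, hu, hv, add_zero]
  | smul a u _ hu => rw [smul_eq_mul, map_mul, Module.End.mul_apply, hu, map_zero]

/-- The map from the Weyl module to the exterior algebra of `ℂ[X]/(η)`. -/
def weylToFock : Weyl η →ₗ[ℂ] ExteriorAlgebra ℂ (AdjoinRoot η) :=
  (Submodule.liftQ ((weylIdeal η).restrictScalars ℂ)
    ((LinearMap.applyₗ 1) ∘ₗ (fockAct hη).toLinearMap)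
    (fun _ hu => fockAct_eq_zero hη hu)).comp
    (Submodule.Quotient.restrictScalarsEquiv ℂ (weylIdeal η)).symm.toLinearMap

theorem weylToFock_mk (u : U) : weylToFock hη (weylMk η u) = fockAct hη u 1 := rfl

theorem weylToFock_low (p : ℂ[X]) (v : Weyl η) :
    weylToFock hη ((weylRep η).low p v)
      = ExteriorAlgebra.ι ℂ (AdjoinRoot.mk η p) * weylToFock hη v := by
  induction p using polynomial_linear_induction with
  | hadd p q hp hq => simp only [map_add, LinearMap.add_apply, hp, hq, add_mul]
  | hsmul c p hp =>
    rw [map_smul, LinearMap.smul_apply, map_smul, hp, ← AdjoinRoot.smul_mk, map_smul,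
      smul_mul_assoc]
  | hX r =>
    obtain ⟨u, rfl⟩ := weylMk_surjective η v
    rw [low_X_pow, weylRep_e_apply, ← weylMk_mul, weylToFock_mk, weylToFock_mk, map_mul,
      fockAct_uE, map_pow, AdjoinRoot.mk_X]
    rfl

/-- This is the lower bound on the Weyl module: its relations impose nothing beyond those of the
exterior algebra. -/
theorem weylToFock_fockMap (x : ExteriorAlgebra ℂ (AdjoinRoot η)) :
    weylToFock hη (IsWeylVector.fockMap (weylRep η) hη (weylVec η) x) = x := by
  rw [← sub_eq_zero]
  refine Fock.linearMap_eq_zero (weylToFock hη ∘ₗ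
    IsWeylVector.fockMap (weylRep η) hη (weylVec η) - LinearMap.id) ?_ (fun v x hx => ?_) x
  · rw [LinearMap.sub_apply, LinearMap.comp_apply, IsWeylVector.fockMap_one, weylVec,
      weylToFock_mk]
    simp
  · obtain ⟨p, rfl⟩ := AdjoinRoot.mk_surjective v
    simp only [LinearMap.sub_apply, LinearMap.comp_apply, sub_eq_zero, LinearMap.id_apply]
      at hx ⊢
    rw [(isWeylVector_weylVec hη).fockMap_ι_mul (lowSpan_weylVec hη), weylToFock_low, hx]

/-- The Weyl module `W_η` is isomorphic to the exterior algebra of `ℂ[X]/(η)`. -/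
def weylEquiv : ExteriorAlgebra ℂ (AdjoinRoot η) ≃ₗ[ℂ] Weyl η :=
  LinearEquiv.ofBijective (IsWeylVector.fockMap (weylRep η) hη (weylVec η))
    ⟨Function.LeftInverse.injective (weylToFock_fockMap hη),
      (isWeylVector_weylVec hη).fockMap_surjective (lowSpan_weylVec hη) hη⟩

end Weyl

/-- The basis of the exterior algebra of `ℂ[X]/(η)` given by the products of powers of `X`. -/
def fockBasis {η : ℂ[X]} (hη : η.Monic) :
    Module.Basis (Finset (Fin η.natDegree)) ℂ (ExteriorAlgebra ℂ (AdjoinRoot η)) :=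
  (AdjoinRoot.powerBasis' hη).basis.ExteriorAlgebra

/-- A basis of the Weyl module. -/
def weylBasis {η : ℂ[X]} (hη : η.Monic) :
    Module.Basis (Finset (Fin η.natDegree)) ℂ (Weyl η) :=
  haveI := finiteDimensional_adjoinRoot hη
  (fockBasis hη).map (weylEquiv hη)

/-! ### Tensor products of Weyl modules -/

namespace CurrentRep

variable {k : ℕ} {M : Fin k → Type*} [∀ s, AddCommGroup (M s)] [∀ s, Module ℂ (M s)]
  (ρ : ∀ s, CurrentRep (M s))

theorem slot_add (p : ℕ) (s : Fin k) (X Y : Module.End ℂ (M s)) :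
    slot ρ p s (X + Y) = slot ρ p s X + slot ρ p s Y :=
  (PiTensorProduct.mapMultilinear ℂ M M).map_update_add
    (fun q => if q < s then (ρ q).parity ^ p else 1) s X Y

/-- If the factors before `s` are even, then an operator in the factor `s` acts without signs. -/
theorem slot_tprod (p : ℕ) (s : Fin k) (X : Module.End ℂ (M s)) (m : ∀ q, M q)
    (hm : ∀ q < s, (ρ q).parity (m q) = m q) :
    slot ρ p s X (PiTensorProduct.tprod ℂ m)
      = PiTensorProduct.tprod ℂ (Function.update m s (X (m s))) := by
  rw [slot, PiTensorProduct.map_tprod]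
  congr 1
  funext q
  by_cases h : q = s
  · subst h; simp
  · rw [Function.update_of_ne h, Function.update_of_ne h]
    split_ifs with hq
    · have : ∀ p : ℕ, ((ρ q).parity ^ p) (m q) = m q := by
        intro p
        induction p with
        | zero => rfl
        | succ p ih => rw [pow_succ, Module.End.mul_apply, hm q hq, ih]
      exact this p
    · rfl

theorem tensor_low (p : ℂ[X]) :
    (tensor ρ).low p = ∑ s, slot ρ 1 s ((ρ s).low p) := by
  induction p using polynomial_linear_induction with
  | hadd p q hp hq =>
    rw [map_add, hp, hq, ← Finset.sum_add_distrib]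
    simp only [map_add, slot_add]
  | hsmul c p hp => rw [map_smul, hp, Finset.smul_sum]; simp only [map_smul, slot_smul]
  | hX r => simp only [low_X_pow]; rfl

end CurrentRep

section Tensor

variable {k : ℕ} (n : Fin k → ℕ) (b : Fin k → ℂ)

theorem factor_monic (s : Fin k) : ((X - C (b s)) ^ n s).Monic := (monic_X_sub_C _).pow _

/-- The tensor product of the generators. -/
def tensorVec : ⨂[ℂ] s, Weyl ((X - C (b s)) ^ n s) :=
  PiTensorProduct.tprod ℂ fun _ => weylVec _

theorem slot_tensorVec (p : ℕ) (s : Fin k) (A : Module.End ℂ (Weyl ((X - C (b s)) ^ n s)))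
    {c : ℂ} (hA : A (weylVec _) = c • weylVec _) :
    slot (fun s => weylPt (n s) (b s)) p s A (tensorVec n b) = c • tensorVec n b := by
  rw [tensorVec, slot_tprod, hA, MultilinearMap.map_update_smul, Function.update_eq_self]
  exact fun q _ => weylRep_parity_weylVec

theorem rootPsum_etaPoly (r : ℕ) :
    rootPsum (etaPoly n b) r = ∑ s, rootPsum ((X - C (b s)) ^ n s) r := by
  rw [rootPsum, etaPoly, roots_prod _ _ (Finset.prod_ne_zero_iff.2 fun s _ =>
    (factor_monic n b s).ne_zero), Multiset.map_bind, Multiset.sum_bind]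
  rfl

theorem factor_dvd_etaPoly (s : Fin k) : (X - C (b s)) ^ n s ∣ etaPoly n b :=
  Finset.dvd_prod_of_mem _ (Finset.mem_univ s)

theorem isWeylVector_tensorVec : (weylTensor n b).IsWeylVector (etaPoly n b) (tensorVec n b) where
  e00 r := by
    change (∑ s, slot _ _ s _) _ = _
    rw [LinearMap.sum_apply, rootPsum_etaPoly, Finset.sum_smul]
    exact Finset.sum_congr rfl fun s _ =>
      slot_tensorVec n b _ s _ ((isWeylVector_weylVec (factor_monic n b s)).e00 r)
  e11 r := by
    change (∑ s, slot _ _ s _) _ = _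
    rw [LinearMap.sum_apply]
    refine Finset.sum_eq_zero fun s _ => ?_
    refine (slot_tensorVec n b _ s _ (c := 0) ?_).trans (zero_smul _ _)
    exact ((isWeylVector_weylVec (factor_monic n b s)).e11 r).trans (zero_smul _ _).symm
  e01 r := by
    change (∑ s, slot _ _ s _) _ = _
    rw [LinearMap.sum_apply]
    refine Finset.sum_eq_zero fun s _ => ?_
    refine (slot_tensorVec n b _ s _ (c := 0) ?_).trans (zero_smul _ _)
    exact ((isWeylVector_weylVec (factor_monic n b s)).e01 r).trans (zero_smul _ _).symm
  low := by
    rw [weylTensor, tensor_low, LinearMap.sum_apply]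
    refine Finset.sum_eq_zero fun s _ => ?_
    refine (slot_tensorVec n b _ s _ (c := 0) ?_).trans (zero_smul _ _)
    exact ((isWeylVector_weylVec (factor_monic n b s)).low_apply_eq_zero_of_dvd
      (factor_dvd_etaPoly n b s)).trans (zero_smul _ _).symm

variable {b}

/-- By the Chinese remainder theorem, `e_{21} ⊗ p(t)` acting on one factor is the action of
`e_{21} ⊗ q(t)` on the tensor product, for a polynomial `q`. -/
theorem exists_low_eq_slot (hb : Function.Injective b) (s : Fin k) (p : ℂ[X]) :
    ∃ q, (weylTensor n b).low q
      = slot (fun s => weylPt (n s) (b s)) 1 s ((weylRep ((X - C (b s)) ^ n s)).low p) := by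
  have hcop : IsCoprime ((X - C (b s)) ^ n s)
      (∏ t ∈ Finset.univ.erase s, (X - C (b t)) ^ n t) := by
    refine IsCoprime.prod_right fun t ht => IsCoprime.pow ?_
    exact pairwise_coprime_X_sub_C hb (Finset.ne_of_mem_erase ht).symm
  obtain ⟨u, v, huv⟩ := hcop
  -- Congruent to `p` modulo the factor at `s` and to 0 modulo the other factors.
  refine ⟨p * (v * ∏ t ∈ Finset.univ.erase s, (X - C (b t)) ^ n t), ?_⟩
  have hz : ∀ t q, (X - C (b t)) ^ n t ∣ q → (weylPt (n t) (b t)).low q = 0 := fun t q hq =>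
    (isWeylVector_weylVec (factor_monic n b t)).low_eq_zero_of_dvd
      (lowSpan_weylVec (factor_monic n b t)) hq
  rw [weylTensor, tensor_low, Finset.sum_eq_single s]
  · congr 1
    rw [← sub_eq_zero]
    change (weylPt (n s) (b s)).low _ - (weylPt (n s) (b s)).low p = 0
    rw [← map_sub]
    refine hz s _ ⟨-(p * u), ?_⟩
    linear_combination p * huv
  · intro t _ hts
    rw [hz t, slot_zero]
    exact ((Finset.dvd_prod_of_mem _ (Finset.mem_erase.2 ⟨hts, Finset.mem_univ t⟩)).mul_left
      _).mul_left _
  · intro h; exact absurd (Finset.mem_univ s) h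

/-- Only the last `j` factors are arbitrary. Freeing them from right to left means that all factors
to the left of the active one are still even generators, so `slot` introduces no sign. -/
theorem tprod_mem_lowSpan (hb : Function.Injective b) (j : ℕ)
    (m : ∀ s, Weyl ((X - C (b s)) ^ n s)) (hm : ∀ s : Fin k, s.val + j < k → m s = weylVec _) :
    PiTensorProduct.tprod ℂ m ∈ (weylTensor n b).lowSpan (tensorVec n b) := by
  induction j generalizing m with
  | zero =>
    have : m = fun _ => weylVec _ := funext fun s => hm s (by simp)
    rw [this]
    exact (weylTensor n b).mem_lowSpan _
  | succ j ih =>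
    by_cases hj : j < k
    · let s : Fin k := ⟨k - 1 - j, by omega⟩
      have hs : s.val = k - 1 - j := rfl
      let N : Submodule ℂ (Weyl ((X - C (b s)) ^ n s)) :=
        ((weylTensor n b).lowSpan (tensorVec n b)).comap
          ((PiTensorProduct.tprod ℂ).toLinearMap m s)
      have hN : ∀ v, v ∈ N ↔ PiTensorProduct.tprod ℂ (Function.update m s v)
          ∈ (weylTensor n b).lowSpan (tensorVec n b) := fun v => Iff.rfl
      have hle := (weylRep ((X - C (b s)) ^ n s)).lowSpan_le (w := weylVec _) (N := N) ?_ ?_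
      · rw [lowSpan_weylVec (factor_monic n b s), top_le_iff] at hle
        have := (hN (m s)).1 (hle ▸ Submodule.mem_top)
        rwa [Function.update_eq_self] at this
      · rw [hN]
        refine ih _ fun t ht => ?_
        by_cases hts : t = s
        · subst hts; simp
        · rw [Function.update_of_ne hts]
          refine hm t ?_
          have : t.val ≠ s.val := fun h => hts (Fin.ext h)
          omega
      · intro p v hv
        rw [hN] at hv ⊢
        obtain ⟨q, hq⟩ := exists_low_eq_slot n hb s p
        have h1 := (weylTensor n b).low_mem_lowSpan hv q
        rw [hq, slot_tprod] at h1
        · simpa using h1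
        · intro t ht
          have hlt : t.val < s.val := ht
          rw [Function.update_of_ne ht.ne, hm t (by omega)]
          exact weylRep_parity_weylVec
    · exact ih m fun t ht => hm t (by omega)

theorem lowSpan_tensorVec (hb : Function.Injective b) :
    (weylTensor n b).lowSpan (tensorVec n b) = ⊤ := by
  rw [eq_top_iff, ← PiTensorProduct.span_tprod_eq_top, Submodule.span_le]
  rintro _ ⟨m, rfl⟩
  exact tprod_mem_lowSpan n hb k m fun s hs => by omega

/-- A surjection between spaces of the same dimension, 2 to the power ∑ n_s. -/
theorem fockMap_tensorVec_bijective (hb : Function.Injective b) : Function.Bijective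
    (IsWeylVector.fockMap (weylTensor n b) (etaPoly_monic n b) (tensorVec n b)) := by
  have hsurj := (isWeylVector_tensorVec n b).fockMap_surjective (lowSpan_tensorVec n hb)
    (etaPoly_monic n b)
  let B₁ := fockBasis (etaPoly_monic n b)
  let B₂ := Basis.piTensorProduct fun s => weylBasis (factor_monic n b s)
  have := B₁.finiteDimensional_of_finite
  have := B₂.finiteDimensional_of_finite
  refine ⟨(LinearMap.injective_iff_surjective_of_finrank_eq_finrank ?_).2 hsurj, hsurj⟩
  rw [Module.finrank_eq_card_basis B₁, Module.finrank_eq_card_basis B₂, Fintype.card_pi]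
  simp [natDegree_etaPoly, Finset.prod_pow_eq_pow_sum]

end Tensor

/-! ### The transfer matrix on the exterior algebra -/

/-- If the convolution of `f` with a sequence `c`, `c 0 ≠ 0`, has values in a subspace, then so
does `f`. -/
theorem mem_of_convolution_mem {W : Type*} [AddCommGroup W] [Module ℂ W] {c : ℕ → ℂ}
    (hc : c 0 ≠ 0) {f : ℕ → W} {S : Submodule ℂ W}
    (h : ∀ m, ∑ p ∈ Finset.HasAntidiagonal.antidiagonal m, c p.1 • f p.2 ∈ S) (r : ℕ) :
    f r ∈ S := by
  induction r using Nat.strong_induction_on with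
  | _ r ih =>
    have h1 := h r
    have hmem : ((0, r) : ℕ × ℕ) ∈ Finset.HasAntidiagonal.antidiagonal r := by simp
    rw [← Finset.add_sum_erase _ _ hmem] at h1
    have h2 : ∑ p ∈ (Finset.HasAntidiagonal.antidiagonal r).erase (0, r), c p.1 • f p.2 ∈ S := by
      refine Submodule.sum_mem _ fun p hp => Submodule.smul_mem _ _ (ih _ ?_)
      obtain ⟨hne, hp⟩ := Finset.mem_erase.1 hp
      rw [Finset.HasAntidiagonal.mem_antidiagonal] at hp
      rcases Nat.eq_zero_or_pos p.1 with h0 | h0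
      · exact absurd (Prod.ext h0 (by simpa [h0] using hp)) hne
      · omega
    exact (Submodule.smul_mem_iff _ hc).1 ((Submodule.add_mem_iff_left _ h2).1 h1)

theorem eq_of_convolution_eq {c : ℕ → ℂ} (hc : c 0 ≠ 0) {p q : ℕ → ℂ}
    (h : ∀ m, ∑ a ∈ Finset.HasAntidiagonal.antidiagonal m, c a.1 * p a.2
      = ∑ a ∈ Finset.HasAntidiagonal.antidiagonal m, c a.1 * q a.2) : p = q := by
  funext r
  have := mem_of_convolution_mem hc (f := fun r => p r - q r) (S := ⊥) (fun m => ?_) r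
  · exact sub_eq_zero.1 ((Submodule.mem_bot ℂ).1 this)
  · simp only [smul_eq_mul, mul_sub, Finset.sum_sub_distrib, h, sub_self, Submodule.zero_mem]

/-- The scalar part of the transfer matrix on a module where `(e_{11} + e_{22})[r]` acts
by `c r`. -/
def transferScalar (c : ℕ → ℂ) (m : ℕ) : ℂ :=
  (1 / 2) * (∑ p ∈ Finset.HasAntidiagonal.antidiagonal m, c p.1 * c p.2 - (m + 1) * c m)

/-- Eliminating e_11 through the central element cancels the terms quadratic in e_22. Reordering
e_12 e_21 gives one copy of c_m for each of the m + 1 pairs, the coefficient of -ζ'. -/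
theorem CurrentRep.transfer_eq {M : Type*} [AddCommGroup M] [Module ℂ M] (ρ : CurrentRep M)
    {c : ℕ → ℂ} (hc : ∀ r, ρ.cent r = c r • 1) (m : ℕ) :
    ρ.transfer m = transferScalar c m • 1
      + ∑ p ∈ Finset.HasAntidiagonal.antidiagonal m,
        (ρ.e 1 0 p.1 * ρ.e 0 1 p.2 - c p.1 • ρ.e 1 1 p.2) := by
  have h00 : ∀ r, ρ.e 0 0 r = c r • 1 - ρ.e 1 1 r := fun r => by
    rw [← hc, cent, add_sub_cancel_right]
  have hS : ∑ p ∈ Finset.HasAntidiagonal.antidiagonal m, c p.2 • ρ.e 1 1 p.1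
      = ∑ p ∈ Finset.HasAntidiagonal.antidiagonal m, c p.1 • ρ.e 1 1 p.2 :=
    Finset.Nat.sum_antidiagonal_swap (f := fun p : ℕ × ℕ => c p.1 • ρ.e 1 1 p.2)
  have hQ : ∑ p ∈ Finset.HasAntidiagonal.antidiagonal m, ρ.e 1 0 p.2 * ρ.e 0 1 p.1
      = ∑ p ∈ Finset.HasAntidiagonal.antidiagonal m, ρ.e 1 0 p.1 * ρ.e 0 1 p.2 :=
    Finset.Nat.sum_antidiagonal_swap (f := fun p : ℕ × ℕ => ρ.e 1 0 p.1 * ρ.e 0 1 p.2)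
  have hA : ∑ p ∈ Finset.HasAntidiagonal.antidiagonal m, ρ.e 0 0 p.1 * ρ.e 0 0 p.2
      = (∑ p ∈ Finset.HasAntidiagonal.antidiagonal m, c p.1 * c p.2) • 1
        - (2 : ℂ) • ∑ p ∈ Finset.HasAntidiagonal.antidiagonal m, c p.1 • ρ.e 1 1 p.2
        + ∑ p ∈ Finset.HasAntidiagonal.antidiagonal m, ρ.e 1 1 p.1 * ρ.e 1 1 p.2 := by
    rw [two_smul]
    nth_rewrite 1 [← hS]
    rw [Finset.sum_smul, ← Finset.sum_add_distrib, ← Finset.sum_sub_distrib,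
      ← Finset.sum_add_distrib]
    refine Finset.sum_congr rfl fun p _ => ?_
    rw [h00, h00]
    simp only [sub_mul, mul_sub, smul_mul_assoc, mul_smul_comm, one_mul, mul_one]
    module
  have hB : ∑ p ∈ Finset.HasAntidiagonal.antidiagonal m, ρ.e 0 1 p.1 * ρ.e 1 0 p.2
      = (((m : ℂ) + 1) * c m) • 1
        - ∑ p ∈ Finset.HasAntidiagonal.antidiagonal m, ρ.e 1 0 p.1 * ρ.e 0 1 p.2 := by
    have : ∀ p ∈ Finset.HasAntidiagonal.antidiagonal m, ρ.e 0 1 p.1 * ρ.e 1 0 p.2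
        = c m • 1 - ρ.e 1 0 p.2 * ρ.e 0 1 p.1 := by
      intro p hp
      rw [Finset.HasAntidiagonal.mem_antidiagonal] at hp
      have h1 := ρ.e01_e10 p.1 p.2
      have h2 := hc (p.1 + p.2)
      rw [cent] at h2
      rw [h1, h2, hp]
    rw [Finset.sum_congr rfl this, Finset.sum_sub_distrib, hQ, Finset.sum_const,
      Finset.Nat.card_antidiagonal, ← Nat.cast_smul_eq_nsmul ℂ, smul_smul]
    push_cast
    rfl
  rw [transfer, transferScalar]
  simp only [Fin.sum_univ_two, Fin.val_zero, Fin.val_one, pow_zero, pow_one, one_smul, neg_smul,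
    hA, hB, Finset.sum_sub_distrib]
  module

section Gaudin

variable {η : ℂ[X]} (hη : η.Monic)

/-- The coefficients of `v ↦ tr(v/(x-t))/(x-t) - ζ(x) v/(x-t)` on `ℂ[t]/(η)`. -/
def gaudinOp (m : ℕ) : Module.End ℂ (AdjoinRoot η) :=
  ∑ p ∈ Finset.HasAntidiagonal.antidiagonal m,
    ((traceForm hη ∘ₗ rootMul η p.2).smulRight (AdjoinRoot.root η ^ p.1)
      - rootPsum η p.1 • rootMul η p.2)

theorem gaudinOp_apply (m : ℕ) (v : AdjoinRoot η) : gaudinOp hη m v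
    = ∑ p ∈ Finset.HasAntidiagonal.antidiagonal m,
        traceForm hη (AdjoinRoot.root η ^ p.2 * v) • AdjoinRoot.root η ^ p.1
      - ∑ p ∈ Finset.HasAntidiagonal.antidiagonal m,
        rootPsum η p.1 • (AdjoinRoot.root η ^ p.2 * v) := by
  rw [gaudinOp, LinearMap.sum_apply, ← Finset.sum_sub_distrib]
  rfl

/-- The two sums have equal traces since tr(t^r) is the power sum of index r. -/
theorem traceForm_gaudinOp (m : ℕ) (v : AdjoinRoot η) : traceForm hη (gaudinOp hη m v) = 0 := by
  rw [gaudinOp_apply, map_sub, map_sum, map_sum, sub_eq_zero]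
  refine Finset.sum_congr rfl fun p _ => ?_
  rw [map_smul, map_smul, traceForm_root_pow, smul_eq_mul, smul_eq_mul, mul_comm]

theorem gaudinOp_succ (m : ℕ) (v : AdjoinRoot η) : gaudinOp hη (m + 1) v
    = AdjoinRoot.root η * gaudinOp hη m v + traceForm hη (AdjoinRoot.root η ^ (m + 1) * v) • 1
      - rootPsum η (m + 1) • v := by
  rw [gaudinOp_apply, gaudinOp_apply, Finset.Nat.sum_antidiagonal_succ,
    Finset.Nat.sum_antidiagonal_succ', mul_sub, Finset.mul_sum, Finset.mul_sum]
  simp only [pow_succ', mul_smul_comm, pow_zero, one_mul, mul_assoc]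
  abel

/-- On the kernel of the trace form, the resolvent identity for the compression. -/
theorem gaudinOp_eq (hN : η.natDegree ≠ 0) (m : ℕ) {v : AdjoinRoot η} (hv : traceForm hη v = 0) :
    gaudinOp hη m v = -∑ p ∈ Finset.HasAntidiagonal.antidiagonal m,
      rootPsum η p.1 • (compression hη ^ p.2) v := by
  have hN' : (η.natDegree : ℂ) ≠ 0 := Nat.cast_ne_zero.2 hN
  induction m with
  | zero => simp [gaudinOp_apply, hv]
  | succ m ih =>
    -- Both sides obey the recursion R_{m+1} = T R_m - c_{m+1} v: in `gaudinOp_succ` the multiple of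
    -- 1 is forced by the vanishing trace, exactly as in `compression`.
    have hR : -∑ p ∈ Finset.HasAntidiagonal.antidiagonal (m + 1),
        rootPsum η p.1 • (compression hη ^ p.2) v
        = compression hη (gaudinOp hη m v) - rootPsum η (m + 1) • v := by
      rw [Finset.Nat.sum_antidiagonal_succ', ih, map_neg, map_sum]
      simp only [pow_succ', Module.End.mul_apply, map_smul, pow_zero, Module.End.one_apply]
      abel
    rw [hR]
    have h1 := traceForm_gaudinOp hη (m + 1) v
    have h2 := gaudinOp_succ hη m v
    rw [h2, map_sub, map_add, map_smul, map_smul, hv, traceForm_one, smul_zero, sub_zero,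
      smul_eq_mul] at h1
    rw [h2, compression_apply, sub_eq_add_neg (AdjoinRoot.root η * _), ← neg_smul]
    congr 3
    field_simp
    linear_combination h1

variable {M : Type*} [AddCommGroup M] [Module ℂ M] {ρ : CurrentRep M} {w : M}

theorem CurrentRep.IsWeylVector.mem_sing_iff (h : ρ.IsWeylVector η w)
    (hgen : ρ.lowSpan w = ⊤) (hinj : Function.Injective (IsWeylVector.fockMap ρ hη w))
    (x : ExteriorAlgebra ℂ (AdjoinRoot η)) :
    IsWeylVector.fockMap ρ hη w x ∈ ρ.sing ↔ Fock.annih (traceForm hη) x = 0 := by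
  have h1 := h.fockMap_annih hgen hη 0 x
  have h2 : traceForm hη ∘ₗ LinearMap.mulLeft ℂ (AdjoinRoot.root η ^ 0) = traceForm hη := by
    ext v; simp
  rw [h2] at h1
  rw [sing, LinearMap.mem_ker, ← h1, map_eq_zero_iff _ hinj]

variable [FiniteDimensional ℂ (AdjoinRoot η)]

/-- An endomorphism vanishing on the hyperplane is u ⊗ tr, and its derivation factors through
contraction with tr. The vector u is found by evaluating at 1, whose trace N is nonzero. -/
theorem dGamma_eq_of_eqOn (hN : η.natDegree ≠ 0) {S S' : Module.End ℂ (AdjoinRoot η)}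
    (h : ∀ v, traceForm hη v = 0 → S v = S' v) {x : ExteriorAlgebra ℂ (AdjoinRoot η)}
    (hx : Fock.annih (traceForm hη) x = 0) : Fock.dGamma S x = Fock.dGamma S' x := by
  have hN' : (η.natDegree : ℂ) ≠ 0 := Nat.cast_ne_zero.2 hN
  have : S = S' + (traceForm hη).smulRight ((η.natDegree : ℂ)⁻¹ • (S 1 - S' 1)) := by
    ext v
    have h1 := h (v - ((η.natDegree : ℂ)⁻¹ * traceForm hη v) • 1) (by
      rw [map_sub, map_smul, traceForm_one, smul_eq_mul]; field_simp; simp)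
    rw [map_sub, map_sub, map_smul, map_smul] at h1
    rw [LinearMap.add_apply, LinearMap.smulRight_apply, smul_smul, mul_comm, smul_sub]
    rw [sub_eq_iff_eq_add] at h1
    rw [h1]
    abel
  rw [this, Fock.dGamma_add, LinearMap.add_apply, Fock.dGamma_smulRight, hx, mul_zero, add_zero]

theorem dGamma_gaudinOp (hN : η.natDegree ≠ 0) (m : ℕ) {x : ExteriorAlgebra ℂ (AdjoinRoot η)}
    (hx : Fock.annih (traceForm hη) x = 0) :
    Fock.dGamma (gaudinOp hη m) x = -∑ p ∈ Finset.HasAntidiagonal.antidiagonal m,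
      rootPsum η p.1 • Fock.dGamma (compression hη ^ p.2) x := by
  rw [dGamma_eq_of_eqOn hη hN (S' := -∑ p ∈ Finset.HasAntidiagonal.antidiagonal m,
    rootPsum η p.1 • compression hη ^ p.2) (fun v hv => ?_) hx]
  · rw [← neg_one_smul ℂ, Fock.dGamma_smul, Fock.dGamma_sum, LinearMap.smul_apply,
      LinearMap.sum_apply, neg_one_smul]
    simp only [Fock.dGamma_smul, LinearMap.smul_apply]
  · rw [gaudinOp_eq hη hN m hv]
    simp

theorem CurrentRep.IsWeylVector.transfer_fockMap (hN : η.natDegree ≠ 0)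
    (h : ρ.IsWeylVector η w) (hgen : ρ.lowSpan w = ⊤) (m : ℕ)
    {x : ExteriorAlgebra ℂ (AdjoinRoot η)} (hx : Fock.annih (traceForm hη) x = 0) :
    ρ.transfer m (IsWeylVector.fockMap ρ hη w x)
      = IsWeylVector.fockMap ρ hη w (transferScalar (rootPsum η) m • x
        - ∑ p ∈ Finset.HasAntidiagonal.antidiagonal m,
          rootPsum η p.1 • Fock.dGamma (compression hη ^ p.2) x) := by
  have h1 : ∀ r s, ρ.e 1 0 r (ρ.e 0 1 s (IsWeylVector.fockMap ρ hη w x))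
      = IsWeylVector.fockMap ρ hη w
        (Fock.dGamma ((traceForm hη ∘ₗ rootMul η s).smulRight (AdjoinRoot.root η ^ r)) x) := by
    intro r s
    rw [Fock.dGamma_smulRight, ← AdjoinRoot.mk_X, ← map_pow, h.fockMap_ι_mul hgen, low_X_pow,
      ← h.fockMap_annih hgen]
    rfl
  have h2 : ∀ r, ρ.e 1 1 r (IsWeylVector.fockMap ρ hη w x)
      = IsWeylVector.fockMap ρ hη w (Fock.dGamma (rootMul η r) x) := fun r =>
    (h.fockMap_dGamma hgen hη r x).symm
  rw [sub_eq_add_neg, ← dGamma_gaudinOp hη hN m hx, ρ.transfer_eq (h.cent_eq hgen), gaudinOp,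
    Fock.dGamma_sum]
  simp only [LinearMap.add_apply, LinearMap.smul_apply, LinearMap.sum_apply, LinearMap.sub_apply,
    Module.End.mul_apply, Module.End.one_apply, map_add, map_smul, map_sum, Fock.dGamma_sub,
    Fock.dGamma_smul, map_sub, h1, h2]

/-- Eigenvectors of the transfer matrix among the singular vectors are joint eigenvectors of the
derivations extending the powers of the compression. -/
theorem CurrentRep.IsWeylVector.exists_of_isEigenvector (hN : η.natDegree ≠ 0)
    (h : ρ.IsWeylVector η w) (hgen : ρ.lowSpan w = ⊤)
    (hbij : Function.Bijective (IsWeylVector.fockMap ρ hη w)) {v : M} (hv : v ∈ ρ.sing)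
    {ξ : ℂ⸨X⸩} (hξ : ρ.IsEigenvector ξ v) :
    ∃ (x : ExteriorAlgebra ℂ (AdjoinRoot η)) (p : ℕ → ℂ),
      IsWeylVector.fockMap ρ hη w x = v ∧ x ≠ 0 ∧ Fock.annih (traceForm hη) x = 0 ∧
      (∀ r, Fock.dGamma (compression hη ^ r) x = p r • x) ∧
      ∀ m : ℕ, ξ.coeff ((m : ℤ) + 2) = transferScalar (rootPsum η) m
        - ∑ a ∈ Finset.HasAntidiagonal.antidiagonal m, rootPsum η a.1 * p a.2 := by
  obtain ⟨x, rfl⟩ := hbij.2 v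
  have hx0 : x ≠ 0 := fun h0 => hξ.1 (by rw [h0, map_zero])
  have hx := (h.mem_sing_iff hη hgen hbij.1 x).1 hv
  have hc0 : rootPsum η 0 ≠ 0 := by
    simpa [rootPsum, card_roots_eq] using hN
  have hm : ∀ m : ℕ, ∑ a ∈ Finset.HasAntidiagonal.antidiagonal m,
      rootPsum η a.1 • Fock.dGamma (compression hη ^ a.2) x
      = (transferScalar (rootPsum η) m - ξ.coeff ((m : ℤ) + 2)) • x := by
    intro m
    have h1 := hξ.2.2 m
    rw [h.transfer_fockMap hη hN hgen m hx, ← map_smul] at h1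
    rw [sub_smul, ← hbij.1 h1]
    abel
  -- Convolution with the coefficients of ζ is invertible since c_0 = N ≠ 0, so each derivation
  -- separately has `x` as an eigenvector.
  have hspan : ∀ r, Fock.dGamma (compression hη ^ r) x ∈ Submodule.span ℂ {x} :=
    mem_of_convolution_mem hc0 (f := fun r => Fock.dGamma (compression hη ^ r) x) fun m => by
      rw [hm m]; exact Submodule.smul_mem _ _ (Submodule.mem_span_singleton_self x)
  choose p hp using fun r => Submodule.mem_span_singleton.1 (hspan r)
  refine ⟨x, p, rfl, hx0, hx, fun r => (hp r).symm, fun m => ?_⟩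
  have h1 := hm m
  simp only [← hp, smul_smul, ← Finset.sum_smul] at h1
  rw [smul_left_injective ℂ hx0 h1]
  ring

theorem CurrentRep.IsEigenvector.smul {ξ : ℂ⸨X⸩} {v : M} (h : ρ.IsEigenvector ξ v) {c : ℂ}
    (hc : c ≠ 0) : ρ.IsEigenvector ξ (c • v) :=
  ⟨smul_ne_zero hc h.1, h.2.1, fun m => by rw [map_smul, h.2.2, smul_comm]⟩

end Gaudin

/-! ### Singular eigenvectors of the tensor product and monic divisors of ψ -/

section Main

variable {k : ℕ} (n : Fin k → ℕ) {b : Fin k → ℂ}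

/-- The eigenvector attached to a monic divisor. -/
theorem exists_eigenvector_of_dvd (hb : Function.Injective b) (hn : 0 < ∑ s, n s) {y : ℂ[X]}
    (hy : y.Monic) (hyψ : y ∣ psi n b) [FiniteDimensional ℂ (AdjoinRoot (etaPoly n b))] :
    ∃ x : ExteriorAlgebra ℂ (AdjoinRoot (etaPoly n b)), x ≠ 0 ∧
      Fock.IsSupported (Fock.kerOn (compression (etaPoly_monic n b))
        (traceForm (etaPoly_monic n b)) y) y.natDegree x ∧
      IsWeylVector.fockMap (weylTensor n b) (etaPoly_monic n b) (tensorVec n b) x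
        ∈ (weylTensor n b).sing ∧
      (weylTensor n b).IsEigenvector (eigenvalue n b y)
        (IsWeylVector.fockMap (weylTensor n b) (etaPoly_monic n b) (tensorVec n b) x) := by
  have hη := etaPoly_monic n b
  have hN : (etaPoly n b).natDegree ≠ 0 := by rw [natDegree_etaPoly]; omega
  have hw := isWeylVector_tensorVec n b
  have hgen := lowSpan_tensorVec n hb
  have hbij := fockMap_tensorVec_bijective n hb
  rw [psi_eq_derivative] at hyψ
  obtain ⟨x, hx0, hs, hx⟩ := (isCyclic_compression hη hN).exists_eigenvector hy hyψ
  have hx1 := (Fock.isSupported_kerOn.1 hs).2.1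
  refine ⟨x, hx0, hs, (hw.mem_sing_iff hη hgen hbij.1 x).2 hx1, ?_,
    fun r hr => coeff_eigenvalue_of_lt n b hy hr, fun m => ?_⟩
  · rwa [Ne, map_eq_zero_iff _ hbij.1]
  · rw [hw.transfer_fockMap hη hN hgen m hx1, coeff_eigenvalue n b hy, ← map_smul]
    congr 1
    simp only [hx, smul_smul, ← Finset.sum_smul, ← sub_smul]
    rfl

/-- Singular eigenvectors with the same eigenvalue are proportional. -/
theorem exists_smul_eq_of_isEigenvector (hb : Function.Injective b) (hn : 0 < ∑ s, n s)
    {v₁ v₂ : ⨂[ℂ] s, Weyl ((X - C (b s)) ^ n s)} (h₁ : v₁ ∈ (weylTensor n b).sing)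
    (h₂ : v₂ ∈ (weylTensor n b).sing) {ξ : ℂ⸨X⸩} (hξ₁ : (weylTensor n b).IsEigenvector ξ v₁)
    (hξ₂ : (weylTensor n b).IsEigenvector ξ v₂) : ∃ c : ℂ, c ≠ 0 ∧ v₁ = c • v₂ := by
  have hη := etaPoly_monic n b
  have := finiteDimensional_adjoinRoot hη
  have hN : (etaPoly n b).natDegree ≠ 0 := by rw [natDegree_etaPoly]; omega
  have hw := isWeylVector_tensorVec n b
  have hgen := lowSpan_tensorVec n hb
  have hbij := fockMap_tensorVec_bijective n hb
  obtain ⟨x₁, p₁, rfl, hx₁, ha₁, hp₁, hc₁⟩ := hw.exists_of_isEigenvector hη hN hgen hbij h₁ hξ₁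
  obtain ⟨x₂, p₂, rfl, hx₂, ha₂, hp₂, hc₂⟩ := hw.exists_of_isEigenvector hη hN hgen hbij h₂ hξ₂
  have hc0 : rootPsum (etaPoly n b) 0 ≠ 0 := by
    simpa [rootPsum, card_roots_eq] using hN
  obtain rfl : p₁ = p₂ := eq_of_convolution_eq hc0 fun m => by
    have e1 := hc₁ m
    rw [hc₂ m] at e1
    exact (sub_right_injective e1).symm
  obtain ⟨c, hc⟩ := (isCyclic_compression hη hN).exists_eq_smul hx₂ hx₁ ha₂ ha₁ hp₂ hp₁
  refine ⟨c, fun h0 => hx₁ (by rw [hc, h0, zero_smul]), by rw [hc, map_smul]⟩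

/-- The eigenvalue of a singular eigenvector comes from a monic divisor. -/
theorem exists_dvd_of_isEigenvector (hb : Function.Injective b) (hn : 0 < ∑ s, n s)
    {v : ⨂[ℂ] s, Weyl ((X - C (b s)) ^ n s)} (h : v ∈ (weylTensor n b).sing) {ξ : ℂ⸨X⸩}
    (hξ : (weylTensor n b).IsEigenvector ξ v) :
    ∃ y : ℂ[X], y.Monic ∧ y ∣ psi n b ∧ ξ = eigenvalue n b y := by
  have hη := etaPoly_monic n b
  have := finiteDimensional_adjoinRoot hη
  have hN : (etaPoly n b).natDegree ≠ 0 := by rw [natDegree_etaPoly]; omega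
  obtain ⟨x, p, rfl, hx, ha, hp, hc⟩ := (isWeylVector_tensorVec n b).exists_of_isEigenvector hη hN
    (lowSpan_tensorVec n hb) (fockMap_tensorVec_bijective n hb) h hξ
  obtain ⟨y, hy, hyψ, hpy, -⟩ := (isCyclic_compression hη hN).exists_divisor hx ha hp
  refine ⟨y, hy, psi_eq_derivative n b ▸ hyψ, ?_⟩
  ext i
  rcases lt_or_ge i 2 with hi | hi
  · rw [hξ.2.1 i hi, coeff_eigenvalue_of_lt n b hy hi]
  · obtain ⟨m, hm⟩ := Int.eq_ofNat_of_zero_le (sub_nonneg.2 hi)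
    obtain rfl : i = (m : ℤ) + 2 := by omega
    rw [hc, coeff_eigenvalue n b hy]
    simp only [hpy]
    rfl

end Main

end GL11

end

theorem theorem5p2 {k : ℕ} (n : Fin k → ℕ) (b : Fin k → ℂ)
    (hb : Function.Injective b) (hn : 0 < ∑ s, n s) :
    (GL11.weylTensor n b).SimpleSpectrum (GL11.weylTensor n b).sing ∧
    ∃ Φ : {y : ℂ[X] // y.Monic ∧ y ∣ GL11.psi n b} ≃
        (GL11.weylTensor n b).eigenlines (GL11.weylTensor n b).sing,
      ∀ y, (GL11.weylTensor n b).IsEigenvector (GL11.eigenvalue n b y.1) (Φ y).1.rep := by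
  refine ⟨fun v₁ h₁ v₂ h₂ ξ₁ ξ₂ e₁ e₂ hne hξ => hne ?_, ?_⟩
  · subst hξ
    exact GL11.exists_smul_eq_of_isEigenvector n hb hn h₁ h₂ e₁ e₂
  have hη := GL11.etaPoly_monic n b
  have := GL11.finiteDimensional_adjoinRoot hη
  have hN : (GL11.etaPoly n b).natDegree ≠ 0 := by rw [GL11.natDegree_etaPoly]; omega
  have hinj := (GL11.fockMap_tensorVec_bijective n hb).1
  choose x hx0 hs hsing heig using
    fun y : {y : ℂ[X] // y.Monic ∧ y ∣ GL11.psi n b} =>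
      GL11.exists_eigenvector_of_dvd n hb hn y.2.1 y.2.2
  -- The chosen representative of the line differs from the constructed eigenvector by a unit `a y`,
  -- so eigenvalue and singularity carry over.
  choose a ha using fun y => Projectivization.exists_smul_eq_mk_rep ℂ _ (heig y).1
  have hrep : ∀ y, (GL11.weylTensor n b).IsEigenvector (GL11.eigenvalue n b y.1)
      (Projectivization.mk ℂ _ (heig y).1).rep := fun y =>
    ha y ▸ (heig y).smul (a y).ne_zero
  let Ψ : {y : ℂ[X] // y.Monic ∧ y ∣ GL11.psi n b} →
      (GL11.weylTensor n b).eigenlines (GL11.weylTensor n b).sing := fun y =>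
    ⟨Projectivization.mk ℂ _ (heig y).1,
      ha y ▸ Submodule.smul_mem _ (a y : ℂ) (hsing y), _, hrep y⟩
  refine ⟨Equiv.ofBijective Ψ ⟨fun y z hyz => ?_, fun ℓ => ?_⟩, hrep⟩
  -- Proportional eigenvectors have the same support, and the support determines the divisor;
  -- eigenvalues need not be compared.
  · obtain ⟨c, hc⟩ := (Projectivization.mk_eq_mk_iff' ℂ _ _ (heig y).1 (heig z).1).1
      (congrArg Subtype.val hyz)
    rw [← map_smul] at hc
    have hxc := hinj hc
    refine Subtype.ext ((GL11.isCyclic_compression hη hN).eq_of_isSupported y.2.1 z.2.1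
      (hx0 y) (hs y) ?_)
    rw [← hxc]
    exact ⟨by rw [map_smul, (hs z).1, smul_comm], fun φ hφ => by
      rw [map_smul, (hs z).2 φ hφ, smul_zero]⟩
  · obtain ⟨ℓ, hℓ, ξ, hξ⟩ := ℓ
    -- The eigenvalue of the given line comes from a divisor `y`; by simplicity of the spectrum the
    -- line is that of the eigenvector built from `y`.
    obtain ⟨y, hy, hyψ, rfl⟩ := GL11.exists_dvd_of_isEigenvector n hb hn hℓ hξ
    obtain ⟨c, -, hc⟩ := GL11.exists_smul_eq_of_isEigenvector n hb hn (hsing ⟨y, hy, hyψ⟩) hℓ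
      (heig ⟨y, hy, hyψ⟩) hξ
    refine ⟨⟨y, hy, hyψ⟩, Subtype.ext ?_⟩
    refine Eq.trans ?_ (Projectivization.mk_rep ℓ)
    exact (Projectivization.mk_eq_mk_iff' ℂ _ _ _ _).2 ⟨c, hc.symm⟩
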